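/- Let $C$ be a curve on a smooth complex surface $X$ which is unibranch (its analytic germ is irreducible) and singular at $P\in C$. Choose local coordinates $(x,y)$ at $P$ such that $x=0$ is not tangent to $C$, and a good parametrization $x=t^m$, $y=\sum_{k\ge m}c_kt^k$ of $C$. The Puiseux characteristic $(m;\beta_1,\dots,\beta_g)$ of $C$ at $P$ is defined by $m_1=m$, $\beta_j=\min\{k: c_k\ne0,\ m_j\nmid k\}$, $m_{j+1}=\gcd(m_j,\beta_j)$, the construction stopping when $m_{g+1}=1$. Put $\beta_0=m$ and, for $1\le j\le g$, $$p_j=\frac{m_j}{m_{j+1}},\qquad q_j=\frac{\beta_j-\beta_{j-1}+m_j}{m_{j+1}}.$$ An *Enriques tree* is an oriented tree with a single root, each edge of which is marked slant, horizontal or vertical. The minimal log resolution of $C$ at $P$ is the composition $\mu:Y\to X$ of the least number of point blowings up such that $\mu$ is an isomorphism outside $P$, the strict transform of $C$ is smooth over $P$, and the support of $\mu^*C$ has normal crossings over $P$. Let $P_1=P,\dots,P_r$ be the points blown up. A point $P_\beta$ is proximate to $P_\alpha$ if it is infinitely near to $P_\alpha$ and lies on the strict transform of the exceptional curve of the blowing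 up of $P_\alpha$; it is free if it is proximate to exactly one point, and satellite if it is proximate to two. The Enriques tree of $\mu$ has vertices $P_1,\dots,P_r$ and root $P_1$. There is an edge from $P_\alpha$ to $P_\beta$ iff $P_\beta$ is proximate to $P_\alpha$ and either $P_\beta$ is free, or $P_\beta$ is satellite and the other point to which it is proximate precedes $P_\alpha$. An edge is horizontal or vertical iff it ends at a satellite point, and is horizontal if it goes from a free point to a satellite point. Finally, $P_\beta$ is proximate to $P_\alpha$ iff there is an $L$-shape branch from $P_\alpha$ to $P_\beta$, that is, either a single edge, or a path with at least two edges all of which but the first are horizontal and the first is not, or all of which but the first are vertical and the first is not. For coprime integers $0<p<q$, let $a_1,\dots,a_n$ be the successive quotients in the Euclidean algorithm for $r_0=q$ and $r_1=p$ ($r_{i-1}=a_ir_i+r_{i+1}$, the last remainder being $0$). The tree $T_{p,q}$ is a path with $a_1+\dots+a_n$ vertices. Its edges are divided into consecutive blocks of $a_1,a_2,\dots,a_{n-1},a_n-1$ edges; those of the first block are slant, those of the second horizontal, those of the third vertical, and so on, alternating between horizontal and vertical. For two such paths $T,T'$, the connected sum $T\#T'$ is obtained by identifying the last vertex of $T$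 with the first vertex of $T'$, all edges keeping their marks. **Theorem (Enriques).** For every $1\le j\le g$ the numbers $p_j,q_j$ are coprime integers with $0<p_j<q_j$. The minimal log resolution of $C$ at $P$ exists and is unique, and its Enriques tree is, up to isomorphism of Enriques trees, $$T_{p_1,q_1}\#T_{p_2,q_2}\#\cdots\#T_{p_g,q_g}.$$ -/

import Mathlib

open MvPowerSeries

namespace PlaneBranch

noncomputable section

/-! ### Germs of curves on a smooth complex surface

Everything is local at the point `P`: local coordinates `(x, y)` identify the germ of the surface
at `P` with that of `ℂ²` at the origin, and a germ of function with its Taylor series in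
`x = X 0`, `y = X 1`. -/

/-- Power series in two variables over `ℂ`. -/
abbrev Germ : Type := MvPowerSeries (Fin 2) ℂ

/-- A power series in finitely many variables over `ℂ` that converges near the origin
(Cauchy estimates for its coefficients). -/
def IsConvergent {σ : Type*} (f : MvPowerSeries σ ℂ) : Prop :=
  ∃ r : ℝ, 0 < r ∧ ∃ M : ℝ, ∀ n : σ →₀ ℕ, ‖coeff n f‖ * r ^ n.degree ≤ M

/-- `f` is an irreducible element of the ring `ℂ{x, y}` of convergent power series, whose units are
the series with nonzero constant term: the analytic germ `f = 0` is unibranch at the origin. -/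
def IsUnibranch (f : Germ) : Prop :=
  IsConvergent f ∧ constantCoeff f = 0 ∧
    ∀ g h : Germ, IsConvergent g → IsConvergent h → f = g * h →
      constantCoeff g ≠ 0 ∨ constantCoeff h ≠ 0

/-- The curve `f = 0` passes through the origin and is singular there: `f` has neither a constant
nor a linear term. -/
def IsSingular (f : Germ) : Prop :=
  constantCoeff f = 0 ∧ ∀ i : Fin 2, coeff (Finsupp.single i 1) f = 0

/-- `(u, v)` is a system of local parameters at the origin. -/
def IsLocalParameters (u v : Germ) : Prop :=
  constantCoeff u = 0 ∧ constantCoeff v = 0 ∧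
    coeff (Finsupp.single 0 1) u * coeff (Finsupp.single 1 1) v
      - coeff (Finsupp.single 1 1) u * coeff (Finsupp.single 0 1) v ≠ 0

/-- The support of the curve `F = 0` has normal crossings at the origin (this includes the cases
in which the support is smooth, or empty): up to a unit, `F` is a monomial in suitable local
parameters. -/
def HasNormalCrossings (F : Germ) : Prop :=
  ∃ u v w : Germ, ∃ a b : ℕ, IsLocalParameters u v ∧ constantCoeff w ≠ 0 ∧ F = w * u ^ a * v ^ b

/-! ### The Puiseux characteristic -/

/-- The integers `m_j = gcd (β_0, …, β_{j-1})`. With `β_0 = m` one has `m_1 = m` and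
`m_{j+1} = gcd (m_j, β_j)`. -/
def charGcd (β : ℕ → ℕ) : ℕ → ℕ
  | 0 => 0
  | j + 1 => Nat.gcd (charGcd β j) (β j)

/-- `(m; β_1, …, β_g)`, with `m = β 0` and `β_j = β j`, is the Puiseux characteristic of the
unibranch curve `f = 0`: the curve has a good parametrization `x = t^m`,
`y = ∑_{k ≥ m} c_k t^k` (or the same with `x` and `y` exchanged, to be used when the axis `x = 0` is
tangent to the curve), `β_j` is the least exponent occurring in the series that is not divisible by
`m_j`, and the construction stops with `m_{g+1} = 1`. Values `β j` with `j > g` play no role. -/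
def IsPuiseuxCharacteristic (f : Germ) (g : ℕ) (β : ℕ → ℕ) : Prop :=
  0 < β 0 ∧
  ∃ y : PowerSeries ℂ, IsConvergent y ∧ (∀ k < β 0, PowerSeries.coeff k y = 0) ∧
    (subst (![PowerSeries.X ^ β 0, y] : Fin 2 → MvPowerSeries Unit ℂ) f = 0 ∨
      subst (![y, PowerSeries.X ^ β 0] : Fin 2 → MvPowerSeries Unit ℂ) f = 0) ∧
    (∀ j, 1 ≤ j → j ≤ g →
      IsLeast {k : ℕ | PowerSeries.coeff k y ≠ 0 ∧ ¬ charGcd β j ∣ k} (β j)) ∧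
    charGcd β (g + 1) = 1

/-- `p_j = m_j / m_{j+1}`. -/
def puiseuxP (β : ℕ → ℕ) (j : ℕ) : ℕ := charGcd β j / charGcd β (j + 1)

/-- `q_j = (β_j - β_{j-1} + m_j) / m_{j+1}`. -/
def puiseuxQ (β : ℕ → ℕ) (j : ℕ) : ℕ := (β j - β (j - 1) + charGcd β j) / charGcd β (j + 1)

/-! ### Blowing up a point -/

/-- A point of the exceptional curve of the blowing up of the origin, i.e. a point of `ℙ¹(ℂ)`:
`c : ℂ` is the direction of the line `y = c x`, and `∞` is the direction of `x = 0`. -/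
abbrev Direction : Type := OnePoint ℂ

/-- The blowing up of the origin, in local coordinates `(x', y')` centred at a point of the
exceptional curve: `(x, y) = (x', x' (y' + c))` at the direction `c`, and `(x, y) = (x' y', y')` at
the direction `∞`. -/
def chart : Direction → Fin 2 → Germ
  | OnePoint.some c => ![X 0, X 0 * (X 1 + C c)]
  | OnePoint.infty => ![X 0 * X 1, X 1]

/-- The index of the coordinate which is the local equation of the exceptional curve in the above
coordinates: `x' = 0` at the direction `c`, and `y' = 0` at the direction `∞`. -/
def excIndex : Direction → Fin 2
  | OnePoint.some _ => 0
  | OnePoint.infty => 1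

/-- The local equation of the exceptional curve at one of its points. -/
def excEquation (d : Direction) : Germ := X (excIndex d)

/-- The total transform of `f`: its pull-back by the blowing up. -/
def pullback (d : Direction) (f : Germ) : Germ := subst (chart d) f

/-- The quotient of a series by the `k`-th power of the `i`-th coordinate (for series that are
divisible by this power). -/
def divXPow (i : Fin 2) (k : ℕ) (f : Germ) : Germ := fun n => coeff (n + Finsupp.single i k) f

/-- The strict transform of `f`: the total transform without its exceptional component, i.e.
divided by the highest power of the equation of the exceptional curve that divides it. -/
def strictTransform (d : Direction) (f : Germ) : Germ :=
  divXPow (excIndex d) (multiplicity (excEquation d) (pullback d f)) (pullback d f)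

/-! ### Infinitely near points -/

/-- The points infinitely near to `P`, together with `P = []` itself: `[d₁, …, d_n]` is the
point in direction `d_n` on the exceptional curve of the blowing up of the point
`[d₁, …, d_{n-1}]`. Each of them comes with the local coordinates given by `chart`, centred at it.
The points to which a point is infinitely near are its proper prefixes. -/
abbrev InfNearPoint : Type := List Direction

/-- The total transform of `f` at an infinitely near point. -/
def totalTransformAt (l : InfNearPoint) (f : Germ) : Germ := l.foldl (fun h d => pullback d h) f

/-- The strict transform of `f` at an infinitely near point. -/
def strictTransformAt (l : InfNearPoint) (f : Germ) : Germ :=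
  l.foldl (fun h d => strictTransform d h) f

/-- The point `l` is proximate to the point `k`: `l` is infinitely near to `k` and lies on the
strict transform of the exceptional curve of the blowing up of `k`. -/
def Proximate (l k : InfNearPoint) : Prop :=
  ∃ (d : Direction) (s : List Direction), l = k ++ d :: s ∧
    constantCoeff (strictTransformAt s (excEquation d)) = 0

/-- A free point is proximate to exactly one other point. -/
def IsFree (l : InfNearPoint) : Prop := ∃! k, Proximate l k

/-- A satellite point is proximate to two other points. -/
def IsSatellite (l : InfNearPoint) : Prop := ∃ k k', k ≠ k' ∧ Proximate l k ∧ Proximate l k'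

/-! ### Log resolutions -/

/-- A finite set of points that contains with any point all those to which it is infinitely near.
The compositions `μ : Y → X` of finitely many blowings up of points which are isomorphisms outside
`P` are the blowings up of all points of such a set. -/
def IsCluster (K : Finset InfNearPoint) : Prop := ∀ l ∈ K, ∀ k, k <+: l → k ∈ K

/-- `l` is a point of `μ⁻¹(P) ⊂ Y`, where `μ : Y → X` is the blowing up of all points of the
cluster `K`: it is not blown up, but all points to which it is infinitely near are. -/
def IsPointAbove (K : Finset InfNearPoint) (l : InfNearPoint) : Prop :=
  l ∉ K ∧ ∀ k, k <+: l → k ≠ l → k ∈ K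

/-- The blowing up of the points of `K` is a log resolution of the curve `f = 0` at `P`: over `P`,
the strict transform of the curve is smooth and the support of its total transform has normal
crossings. -/
def IsLogResolution (f : Germ) (K : Finset InfNearPoint) : Prop :=
  IsCluster K ∧ ∀ l, IsPointAbove K l →
    ¬ IsSingular (strictTransformAt l f) ∧ HasNormalCrossings (totalTransformAt l f)

/-- A log resolution with the least possible number of blowings up. -/
def IsMinimalLogResolution (f : Germ) (K : Finset InfNearPoint) : Prop :=
  IsLogResolution f K ∧ ∀ K', IsLogResolution f K' → K.card ≤ K'.card

/-! ### Enriques trees -/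

/-- The graphical representation of an edge. -/
inductive Slope : Type
  | slant
  | horizontal
  | vertical

/-- An Enriques tree: an oriented tree with a single root, whose edges are slant, horizontal or
vertical. -/
structure EnriquesTree where
  /-- the vertices -/
  Vertex : Type
  /-- the root -/
  root : Vertex
  /-- `Edge a b` means that there is an edge that starts at `a` and ends at `b` -/
  Edge : Vertex → Vertex → Prop
  /-- the map `ε` on the edges -/
  slope : ∀ {a b : Vertex}, Edge a b → Slope
  not_edge_root : ∀ a, ¬ Edge a root
  existsUnique_edge : ∀ b, b ≠ root → ∃! a, Edge a b
  root_path : ∀ b, Relation.ReflTransGen Edge root b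

/-- Isomorphism of Enriques trees. -/
def EnriquesTree.IsIso (T T' : EnriquesTree) : Prop :=
  ∃ e : T.Vertex ≃ T'.Vertex, e T.root = T'.root ∧
    (∀ a b, T.Edge a b ↔ T'.Edge (e a) (e b)) ∧
    ∀ a b (h : T.Edge a b) (h' : T'.Edge (e a) (e b)), T.slope h = T'.slope h'

/-- There is an edge from `a` to `b` with the given slope. -/
def EnriquesTree.EdgeWithSlope (T : EnriquesTree) (s : Slope) (a b : T.Vertex) : Prop :=
  ∃ h : T.Edge a b, T.slope h = s

/-- There is an `L`-shape branch from `a` to `b`, horizontal or vertical according to `s`: a path of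
length at least `1` all of whose edges but the first have the slope `s`. If there is
more than one edge, then the first one has another slope (the path has the shape of an `L`). -/
def EnriquesTree.IsLShape (T : EnriquesTree) (s : Slope) (a b : T.Vertex) : Prop :=
  T.Edge a b ∨
    ∃ c, ∃ h : T.Edge a c, T.slope h ≠ s ∧ Relation.TransGen (T.EdgeWithSlope s) c b

/-- `T` is the Enriques tree of the blowing up of the points of the cluster `K`, the vertices of
`T` being identified with the points of `K` through `e`. -/
structure IsEnriquesTreeVia (K : Finset InfNearPoint) (T : EnriquesTree)
    (e : T.Vertex ≃ {l : InfNearPoint // l ∈ K}) : Prop where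
  /-- the root is the proper point `P` -/
  root : (e T.root : InfNearPoint) = []
  /-- there is an edge from `a` to `b` iff `b` is proximate to `a` and `b` is free, or `b` is
  satellite and the other point to which `b` is proximate precedes `a` -/
  edge : ∀ a b, T.Edge a b ↔ Proximate (e b) (e a) ∧
    (IsFree (e b) ∨ ∃ k, k ≠ (e a : InfNearPoint) ∧ k <+: (e a : InfNearPoint) ∧ Proximate (e b) k)
  /-- there is an `L`-shape branch from `a` to `b` iff `b` is proximate to `a` -/
  lshape : ∀ a b, (T.IsLShape Slope.horizontal a b ∨ T.IsLShape Slope.vertical a b) ↔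
    Proximate (e b) (e a)
  /-- the edge that ends at `b` is horizontal or vertical iff `b` is satellite -/
  satellite : ∀ a b (h : T.Edge a b),
    (T.slope h = Slope.horizontal ∨ T.slope h = Slope.vertical) ↔ IsSatellite (e b)
  /-- an edge from a free point to a satellite point is horizontal -/
  normalized : ∀ a b (h : T.Edge a b), IsFree (e a) → IsSatellite (e b) →
    T.slope h = Slope.horizontal

/-- `T` is the Enriques tree of the blowing up of the points of the cluster `K`. -/
def IsEnriquesTreeOf (K : Finset InfNearPoint) (T : EnriquesTree) : Prop :=
  ∃ e : T.Vertex ≃ {l : InfNearPoint // l ∈ K}, IsEnriquesTreeVia K T e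

/-! ### Unibranch trees, the trees `T_{p,q}` and connected sums -/

/-- A finite unibranch tree: a path with vertices `P_1, …, P_r` (`r ≥ 1`) and edges `[P_α P_{α+1}]`.
It is given by the list of the slopes of the `r - 1` edges. -/
structure UnibranchTree where
  /-- the slopes of the edges `[P_1 P_2], …, [P_{r-1} P_r]` -/
  slopes : List Slope

/-- A unibranch tree as an Enriques tree: the vertex `P_{i+1}` is `i : Fin r`. -/
def UnibranchTree.toEnriquesTree (T : UnibranchTree) : EnriquesTree where
  Vertex := Fin (T.slopes.length + 1)
  root := 0
  Edge a b := (a : ℕ) + 1 = (b : ℕ)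
  slope {a b} h := T.slopes[(a : ℕ)]'(by omega)
  not_edge_root a h := by simp at h
  existsUnique_edge b hb := by
    have h0 : (b : ℕ) ≠ 0 := fun h => hb (Fin.ext (by simpa using h))
    refine ⟨⟨(b : ℕ) - 1, by omega⟩, by simp; omega, ?_⟩
    intro a ha
    apply Fin.ext
    simp
    omega
  root_path b := by
    obtain ⟨n, hn⟩ := b
    induction n with
    | zero => exact Relation.ReflTransGen.refl
    | succ n ih => exact Relation.ReflTransGen.tail (ih (by omega)) rfl

/-- The connected sum `T # T'`: the last vertex of `T` is identified with the first one of `T'`, and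
the slopes of the edges are kept. -/
def UnibranchTree.connectedSum (T T' : UnibranchTree) : UnibranchTree := ⟨T.slopes ++ T'.slopes⟩

/-- `T_1 # T_2 # ⋯ # T_g`. The one-vertex tree is neutral for `#`. -/
def UnibranchTree.iteratedSum (T : ℕ → UnibranchTree) : ℕ → UnibranchTree
  | 0 => ⟨[]⟩
  | j + 1 => (UnibranchTree.iteratedSum T j).connectedSum (T (j + 1))

/-- The quotients `a_1, …, a_m` in the Euclidean algorithm for `a` and `b`: `r_0 = a`, `r_1 = b`,
`r_0 = a_1 r_1 + r_2`, …, `r_{m-1} = a_m r_m`. -/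
def euclidQuotients (a b : ℕ) : List ℕ :=
  if b = 0 then [] else a / b :: euclidQuotients b (a % b)
termination_by b
decreasing_by exact Nat.mod_lt _ (by omega)

/-- The constant slope of the edges of the `j`-th block, `j = 0, 1, 2, …`: slant, horizontal,
vertical, horizontal, vertical, … -/
def blockSlope : ℕ → Slope
  | 0 => Slope.slant
  | j + 1 => if Even j then Slope.horizontal else Slope.vertical

/-- The tree `T_{p,q}`, for coprime `p < q`: with `a_1, …, a_m` the quotients in the Euclidean
algorithm for `q` and `p`, it has `a_1 + ⋯ + a_m` vertices; the first `a_1` edges are slant,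
the next `a_2` are horizontal, the next `a_3` are vertical, and so on alternatingly, with
`a_m - 1` edges in the last block. -/
def treeTpq (p q : ℕ) : UnibranchTree :=
  ⟨((euclidQuotients q p).mapIdx fun j a => List.replicate a (blockSlope j)).flatten.dropLast⟩

end

end PlaneBranch

open PlaneBranch

/-!
Why the theorem is true.

Call a point infinitely near to `P` *bad* if the strict transform is singular there or the total
transform does not have normal crossings there (`IsBad`). Every log resolution must blow up all bad
points, and blowing up exactly these is a log resolution as soon as they form a finite chain
(`isMinimalLogResolution_iff`). So the theorem amounts to: the bad points are the prefixes of a list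
`D` of directions, and the Enriques tree of such a chain is the connected sum.

*The tree of a chain.* As long as the strict transform of the exceptional curve of a point passes
through the later points, it is a coordinate axis there, so that proximity in a chain of points can
be read off from the directions (`proximate_take_iff`), and the marking of the edges that is
required of an Enriques tree is determined by proximity (`IsMarking.eq`, `IsMarking.lShapeAt_iff`).
The slopes are produced by a small automaton, whose states are the sets of exceptional axes
(`AxisState`, `slopeWord`, `isEnriquesTreeOf_iff`).

*The chain of bad points.* At each point the branch is followed through a parametrization
`(t ^ a * W₁, t ^ b * W₂)` with units `W₁`, `W₂`, and the intersection multiplicities of the curve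
with the two axes are `a` and `b`. A blowing up subtracts the smaller of the two numbers from the
other one; if `a = b` the tangent is transversal to both axes, and a new coordinate `y / x - γ` has
to be used (`IsBranchAt.blowUp_zero`, `IsBranchAt.blowUp_infty`, `IsBranchAt.blowUp_diagonal`). All
other points of the exceptional curve are good, and so are all points infinitely near to them,
because the initial form of the curve is a power of a linear form (`exists_pullback_eq_of_ne`).
Thus the chain performs the subtractive Euclidean algorithm. The remaining characteristic exponents
only undergo a shift by some `θ`; this is visible in the gaps of the exponents of `W₁` and `W₂`
(`IsLacunaryPair`), which are stable under division and under the subtraction of constants, and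
whenever a new coordinate is used, the order of the new component is a multiple of `a` or the next
characteristic exponent (`IsFresh.exists_pair`). Comparing with the blocks of the trees `T_{p,q}`
gives the slopes (`IsBranchAt.hasBadChain`).

*The start.* It has to be known that the intersection multiplicity of `f = 0` with `x = 0` is `m`
when `f (t ^ m, y (t)) = 0`. The series `f (t ^ m, Y)` is divisible by the product of the
`Y - y (ζ t)` over the roots of unity `ζ` of order `m`, since the parametrization is injective
(`exists_factorization`). The product and the quotient are series in `t ^ m`, and both converge; as
`f` is irreducible among convergent series, the quotient is a unit (`hasYOrder_of_isUnibranch`).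
-/

namespace PlaneBranch

/-! ### Coefficients and substitutions in two variables -/

/-- The exponent of the monomial `x ^ i * y ^ j`. -/
noncomputable def pt (i j : ℕ) : Fin 2 →₀ ℕ := Finsupp.single 0 i + Finsupp.single 1 j

@[simp] theorem pt_zero (i j : ℕ) : pt i j 0 = i := by simp [pt]
@[simp] theorem pt_one (i j : ℕ) : pt i j 1 = j := by simp [pt]

theorem pt_eta (n : Fin 2 →₀ ℕ) : pt (n 0) (n 1) = n := by
  ext i; fin_cases i <;> simp

theorem pt_inj {i j k l : ℕ} : pt i j = pt k l ↔ i = k ∧ j = l := by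
  constructor
  · intro h
    exact ⟨by simpa using DFunLike.congr_fun h 0, by simpa using DFunLike.congr_fun h 1⟩
  · rintro ⟨rfl, rfl⟩; rfl

theorem pt_zero_zero : pt 0 0 = 0 := by simp [pt]

theorem pt_add (i j k l : ℕ) : pt i j + pt k l = pt (i + k) (j + l) := by
  ext x; fin_cases x <;> simp

theorem pt_degree (i j : ℕ) : (pt i j).degree = i + j := by
  simp [pt]

/-- The coefficient of `x ^ i * y ^ j`. -/
noncomputable def cf (F : Germ) (i j : ℕ) : ℂ := coeff (pt i j) F

theorem coeff_eq_cf (F : Germ) (n : Fin 2 →₀ ℕ) : coeff n F = cf F (n 0) (n 1) := by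
  rw [cf, pt_eta]

theorem germ_ext {F G : Germ} (h : ∀ i j, cf F i j = cf G i j) : F = G := by
  ext n; rw [coeff_eq_cf, coeff_eq_cf, h]

theorem constantCoeff_eq_cf (F : Germ) : constantCoeff F = cf F 0 0 := by
  rw [cf, pt_zero_zero, coeff_zero_eq_constantCoeff_apply]

/-- The series with prescribed coefficients. -/
noncomputable def germOf (c : ℕ → ℕ → ℂ) : Germ := fun n => c (n 0) (n 1)

@[simp] theorem cf_germOf (c : ℕ → ℕ → ℂ) (i j : ℕ) : cf (germOf c) i j = c i j := by
  simp [cf, germOf, coeff_apply]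

@[simp] theorem cf_zero (i j : ℕ) : cf 0 i j = 0 := by simp [cf]

theorem cf_X0_pow_mul (k : ℕ) (F : Germ) (i j : ℕ) :
    cf (X 0 ^ k * F) i j = if k ≤ i then cf F (i - k) j else 0 := by
  rw [cf, X_pow_eq, coeff_monomial_mul]
  have h : Finsupp.single 0 k ≤ pt i j ↔ k ≤ i := by
    constructor
    · intro h; simpa using h 0
    · intro h x; fin_cases x <;> simp [h]
  simp only [h, one_mul]
  split_ifs
  · rw [coeff_eq_cf]; simp
  · rfl

theorem cf_X1_pow_mul (k : ℕ) (F : Germ) (i j : ℕ) :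
    cf (X 1 ^ k * F) i j = if k ≤ j then cf F i (j - k) else 0 := by
  rw [cf, X_pow_eq, coeff_monomial_mul]
  have h : Finsupp.single 1 k ≤ pt i j ↔ k ≤ j := by
    constructor
    · intro h; simpa using h 1
    · intro h x; fin_cases x <;> simp [h]
  simp only [h, one_mul]
  split_ifs
  · rw [coeff_eq_cf]; simp
  · rfl

theorem exists_eq_X0_pow_mul {k : ℕ} {F : Germ} (h : ∀ i j, i < k → cf F i j = 0) :
    ∃ G : Germ, F = X 0 ^ k * G ∧ ∀ i j, cf G i j = cf F (i + k) j := by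
  refine ⟨germOf fun i j => cf F (i + k) j, germ_ext fun i j => ?_, by simp⟩
  rw [cf_X0_pow_mul]
  split_ifs with hk
  · simp [Nat.sub_add_cancel hk]
  · exact h i j (by omega)

theorem exists_eq_X1_pow_mul {k : ℕ} {F : Germ} (h : ∀ i j, j < k → cf F i j = 0) :
    ∃ G : Germ, F = X 1 ^ k * G ∧ ∀ i j, cf G i j = cf F i (j + k) := by
  refine ⟨germOf fun i j => cf F i (j + k), germ_ext fun i j => ?_, by simp⟩
  rw [cf_X1_pow_mul]
  split_ifs with hk
  · simp [Nat.sub_add_cancel hk]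
  · exact h i j (by omega)

theorem hasSubst_pair {τ : Type*} {A B : MvPowerSeries τ ℂ} (hA : constantCoeff A = 0)
    (hB : constantCoeff B = 0) : HasSubst (![A, B] : Fin 2 → MvPowerSeries τ ℂ) := by
  apply hasSubst_of_constantCoeff_zero
  intro s; fin_cases s <;> simp [hA, hB]

theorem prod_pair {τ : Type*} (A B : MvPowerSeries τ ℂ) (d : Fin 2 →₀ ℕ) :
    (d.prod fun s e => (![A, B] : Fin 2 → MvPowerSeries τ ℂ) s ^ e) = A ^ d 0 * B ^ d 1 := by
  rw [Finsupp.prod_fintype _ _ (by simp), Fin.prod_univ_two]; simp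

/-- A coefficient of `F (A, B)` which comes from finitely many monomials of `F`. -/
theorem coeff_subst_pair {τ : Type*} {A B : MvPowerSeries τ ℂ} (hA : constantCoeff A = 0)
    (hB : constantCoeff B = 0) (F : Germ) (e : τ →₀ ℕ) (s : Finset (Fin 2 →₀ ℕ))
    (hs : ∀ d, d ∉ s → coeff e (A ^ d 0 * B ^ d 1) = 0) :
    coeff e (subst ![A, B] F) = ∑ d ∈ s, coeff d F * coeff e (A ^ d 0 * B ^ d 1) := by
  rw [coeff_subst (hasSubst_pair hA hB)]
  rw [finsum_eq_sum_of_support_subset (s := s)]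
  · simp only [prod_pair, smul_eq_mul]
  · intro d hd
    by_contra hd'
    exact hd (by simp only [prod_pair]; rw [hs d hd', smul_zero])

theorem cf_C_mul (c : ℂ) (F : Germ) (i j : ℕ) : cf (C c * F) i j = c * cf F i j := by
  rw [cf, coeff_C_mul, cf]

theorem cf_X0_pow_X1_pow (k l i j : ℕ) :
    cf (X 0 ^ k * X 1 ^ l) i j = if i = k ∧ j = l then 1 else 0 := by
  rw [cf, X_pow_eq, X_pow_eq, monomial_mul_monomial, one_mul]
  change coeff (pt i j) (monomial (pt k l) 1) = _
  classical
  rw [coeff_monomial]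
  simp [pt_inj]

theorem cf_one (i j : ℕ) : cf 1 i j = if i = 0 ∧ j = 0 then 1 else 0 := by
  simpa using cf_X0_pow_X1_pow 0 0 i j

theorem cf_X0_pow_mul_X1_add_C_pow (k l : ℕ) (c : ℂ) (i j : ℕ) :
    cf (X 0 ^ k * (X 1 + C c) ^ l) i j = if i = k then c ^ (l - j) * (l.choose j : ℂ) else 0 := by
  have h : (X 0 ^ k * (X 1 + C c) ^ l : Germ) =
      ∑ m ∈ Finset.range (l + 1), C (c ^ (l - m) * (l.choose m : ℂ)) * (X 0 ^ k * X 1 ^ m) := by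
    rw [add_pow, Finset.mul_sum]
    refine Finset.sum_congr rfl fun m _ => ?_
    rw [map_mul, map_pow, map_natCast]; ring
  rw [h, cf, map_sum]
  change ∑ m ∈ _, cf _ i j = _
  simp only [cf_C_mul, cf_X0_pow_X1_pow]
  by_cases hi : i = k
  · simp only [hi, true_and, if_true, mul_ite, mul_one, mul_zero]
    rw [Finset.sum_ite_eq]
    simp only [Finset.mem_range]
    split_ifs with hj
    · rfl
    · rw [Nat.choose_eq_zero_of_lt (by omega)]; simp
  · simp [hi]

/-- The blowing up, in the chart at the direction `c`. -/
theorem cf_pullback_some (c : ℂ) (F : Germ) (n j : ℕ) :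
    cf (pullback (OnePoint.some c) F) n j =
      ∑ k ∈ Finset.range (n + 1), cf F (n - k) k * (c ^ (k - j) * (k.choose j : ℂ)) := by
  have h1 : constantCoeff (X 0 * (X 1 + C c) : Germ) = 0 := by simp
  have key : ∀ d : Fin 2 →₀ ℕ, coeff (pt n j) ((X 0 : Germ) ^ d 0 * (X 0 * (X 1 + C c)) ^ d 1) =
      if n = d 0 + d 1 then c ^ (d 1 - j) * ((d 1).choose j : ℂ) else 0 := by
    intro d
    rw [← cf_X0_pow_mul_X1_add_C_pow, cf, mul_pow, pow_add, mul_assoc]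
  change coeff (pt n j) (subst ![_, _] F) = _
  rw [coeff_subst_pair (by simp) h1 F (pt n j)
    ((Finset.range (n + 1)).image fun k => pt (n - k) k)]
  · rw [Finset.sum_image (fun a _ b _ h => (pt_inj.1 h).2)]
    refine Finset.sum_congr rfl fun k hk => ?_
    have hk' : n = (n - k) + k := by have := Finset.mem_range.1 hk; omega
    rw [key]
    simp only [pt_zero, pt_one, if_pos hk', cf]
  · intro d hd
    rw [key, if_neg]
    intro hn
    apply hd
    rw [Finset.mem_image]
    exact ⟨d 1, by simp; omega, by rw [show n - d 1 = d 0 by omega, pt_eta]⟩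

theorem cf_pullback_infty (F : Germ) (i j : ℕ) :
    cf (pullback OnePoint.infty F) i j = if i ≤ j then cf F i (j - i) else 0 := by
  have h1 : constantCoeff (X 0 * X 1 : Germ) = 0 := by simp
  have key : ∀ d : Fin 2 →₀ ℕ, coeff (pt i j) ((X 0 * X 1 : Germ) ^ d 0 * X 1 ^ d 1) =
      if i = d 0 ∧ j = d 0 + d 1 then 1 else 0 := by
    intro d
    rw [← cf_X0_pow_X1_pow, cf]; congr 1; ring
  change coeff (pt i j) (subst ![_, _] F) = _
  rw [coeff_subst_pair h1 (by simp) F (pt i j) {pt i (j - i)}]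
  · rw [Finset.sum_singleton, key]
    simp only [pt_zero, pt_one, true_and, cf]
    split_ifs <;> first | omega | simp
  · intro d hd
    rw [key, if_neg]
    rintro ⟨rfl, rfl⟩
    apply hd
    rw [Finset.mem_singleton, Nat.add_sub_cancel_left, pt_eta]

theorem cf_subst_X0_pow (a : ℕ) (ha : 0 < a) (F : Germ) (i j : ℕ) :
    cf (subst (![X 0 ^ a, X 1] : Fin 2 → Germ) F) i j = if a ∣ i then cf F (i / a) j else 0 := by
  have h1 : constantCoeff (X 0 ^ a : Germ) = 0 := by simp [ha.ne']
  have key : ∀ d : Fin 2 →₀ ℕ, coeff (pt i j) ((X 0 ^ a : Germ) ^ d 0 * X 1 ^ d 1) =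
      if i = a * d 0 ∧ j = d 1 then 1 else 0 := by
    intro d
    rw [← cf_X0_pow_X1_pow, cf, pow_mul]
  rw [cf, coeff_subst_pair h1 (by simp) F (pt i j) {pt (i / a) j}]
  · rw [Finset.sum_singleton, key]
    simp only [pt_zero, pt_one, and_true, cf]
    split_ifs with h2 h3 h3
    · simp
    · exact absurd ⟨_, h2⟩ h3
    · exact absurd (Nat.mul_div_cancel' h3).symm h2
    · simp
  · intro d hd
    rw [key, if_neg]
    rintro ⟨h2, h3⟩
    apply hd
    rw [Finset.mem_singleton, h2, h3, Nat.mul_div_cancel_left _ ha, pt_eta]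

/-- The series with the two coordinates exchanged. -/
noncomputable def swapXY (F : Germ) : Germ := germOf fun i j => cf F j i

@[simp] theorem cf_swapXY (F : Germ) (i j : ℕ) : cf (swapXY F) i j = cf F j i := by simp [swapXY]

@[simp] theorem swapXY_swapXY (F : Germ) : swapXY (swapXY F) = F := germ_ext (by simp)

theorem swapXY_eq_subst (F : Germ) : swapXY F = subst (![X 1, X 0] : Fin 2 → Germ) F := by
  refine germ_ext fun i j => ?_
  have key : ∀ d : Fin 2 →₀ ℕ, coeff (pt i j) ((X 1 : Germ) ^ d 0 * X 0 ^ d 1) =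
      if i = d 1 ∧ j = d 0 then 1 else 0 := by
    intro d
    rw [← cf_X0_pow_X1_pow, cf, mul_comm]
  rw [cf_swapXY]
  change _ = coeff (pt i j) _
  rw [coeff_subst_pair (by simp) (by simp) F (pt i j) {pt j i}]
  · rw [Finset.sum_singleton, key]
    simp [cf]
  · intro d hd
    rw [key, if_neg]
    rintro ⟨rfl, rfl⟩
    exact hd (by rw [Finset.mem_singleton, pt_eta])

theorem hasSubst_swap : HasSubst (![X 1, X 0] : Fin 2 → Germ) := hasSubst_pair (by simp) (by simp)

theorem subst_pair_subst_pair {τ : Type*} {A B : Germ} {A' B' : MvPowerSeries τ ℂ}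
    (hA : constantCoeff A = 0) (hB : constantCoeff B = 0) (hA' : constantCoeff A' = 0)
    (hB' : constantCoeff B' = 0) (F : Germ) :
    subst ![A', B'] (subst ![A, B] F) = subst ![subst ![A', B'] A, subst ![A', B'] B] F := by
  rw [subst_comp_subst_apply (hasSubst_pair hA hB) (hasSubst_pair hA' hB')]
  congr 1
  funext s; fin_cases s <;> rfl

theorem subst_pair_X0 {τ : Type*} {A B : MvPowerSeries τ ℂ} (hA : constantCoeff A = 0)
    (hB : constantCoeff B = 0) : subst ![A, B] (X 0 : Germ) = A := by
  rw [subst_X (hasSubst_pair hA hB)]; rfl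

theorem subst_pair_X1 {τ : Type*} {A B : MvPowerSeries τ ℂ} (hA : constantCoeff A = 0)
    (hB : constantCoeff B = 0) : subst ![A, B] (X 1 : Germ) = B := by
  rw [subst_X (hasSubst_pair hA hB)]; rfl

theorem swapXY_mul (F G : Germ) : swapXY (F * G) = swapXY F * swapXY G := by
  simp only [swapXY_eq_subst, subst_mul hasSubst_swap]

theorem swapXY_pow (F : Germ) (n : ℕ) : swapXY (F ^ n) = swapXY F ^ n := by
  simp only [swapXY_eq_subst, subst_pow hasSubst_swap]

theorem swapXY_X0 : swapXY (X 0) = X 1 := by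
  rw [swapXY_eq_subst, subst_pair_X0 (by simp) (by simp)]

theorem swapXY_X1 : swapXY (X 1) = X 0 := by
  rw [swapXY_eq_subst, subst_pair_X1 (by simp) (by simp)]

theorem subst_swapXY {τ : Type*} {A B : MvPowerSeries τ ℂ} (hA : constantCoeff A = 0)
    (hB : constantCoeff B = 0) (F : Germ) : subst ![A, B] (swapXY F) = subst ![B, A] F := by
  rw [swapXY_eq_subst, subst_pair_subst_pair (by simp) (by simp) hA hB, subst_pair_X0 hA hB,
    subst_pair_X1 hA hB]

theorem constantCoeff_swapXY (F : Germ) : constantCoeff (swapXY F) = constantCoeff F := by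
  simp [constantCoeff_eq_cf]

theorem pullback_infty_eq (F : Germ) :
    pullback OnePoint.infty F = swapXY (pullback (OnePoint.some (0 : ℂ)) (swapXY F)) := by
  refine germ_ext fun i j => ?_
  rw [cf_pullback_infty, cf_swapXY, cf_pullback_some]
  split_ifs with h
  · rw [Finset.sum_eq_single i]
    · simp
    · intro k _ hk
      rcases lt_or_gt_of_ne hk with h1 | h1
      · simp [Nat.choose_eq_zero_of_lt h1]
      · simp [zero_pow (show k - i ≠ 0 by omega)]
    · intro h'; exact absurd (Finset.mem_range.2 (by omega)) h'
  · symm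
    refine Finset.sum_eq_zero fun k hk => ?_
    rw [Nat.choose_eq_zero_of_lt (by have := Finset.mem_range.1 hk; omega)]; simp

theorem constantCoeff_subst_pair {τ : Type*} {A B : MvPowerSeries τ ℂ} (hA : constantCoeff A = 0)
    (hB : constantCoeff B = 0) (F : Germ) : constantCoeff (subst ![A, B] F) = constantCoeff F := by
  rw [← coeff_zero_eq_constantCoeff_apply, coeff_subst_pair hA hB F 0 {0}]
  · simp
  · intro d hd
    rw [coeff_zero_eq_constantCoeff_apply, map_mul, map_pow, map_pow, hA, hB]
    by_contra h
    apply hd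
    rw [Finset.mem_singleton, ← pt_eta d]
    have h0 : d 0 = 0 := by by_contra h0; simp [h0] at h
    have h1 : d 1 = 0 := by by_contra h1; simp [h1] at h
    rw [h0, h1, pt_zero_zero]

/-! ### Strict transforms and initial forms -/

theorem hasSubst_chart (d : Direction) : HasSubst (chart d) := by
  induction d using OnePoint.rec with
  | infty => exact hasSubst_pair (by simp) (by simp)
  | coe c => exact hasSubst_pair (by simp) (by simp)

theorem pullback_mul (d : Direction) (F G : Germ) :
    pullback d (F * G) = pullback d F * pullback d G := subst_mul (hasSubst_chart d) F G

theorem pullback_pow (d : Direction) (F : Germ) (n : ℕ) :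
    pullback d (F ^ n) = pullback d F ^ n := subst_pow (hasSubst_chart d) F n

theorem pullback_X (d : Direction) (i : Fin 2) : pullback d (X i) = chart d i :=
  subst_X (hasSubst_chart d) i

theorem pullback_some_X0 (c : ℂ) : pullback (OnePoint.some c) (X 0) = X 0 := pullback_X _ 0
theorem pullback_some_X1 (c : ℂ) : pullback (OnePoint.some c) (X 1) = X 0 * (X 1 + C c) :=
  pullback_X _ 1
theorem pullback_infty_X0 : pullback OnePoint.infty (X 0) = X 0 * X 1 := pullback_X _ 0
theorem pullback_infty_X1 : pullback OnePoint.infty (X 1) = X 1 := pullback_X _ 1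

theorem constantCoeff_pullback (d : Direction) (F : Germ) :
    constantCoeff (pullback d F) = constantCoeff F := by
  induction d using OnePoint.rec with
  | infty => exact constantCoeff_subst_pair (by simp) (by simp) F
  | coe c => exact constantCoeff_subst_pair (by simp) (by simp) F

theorem not_X_dvd_of_constantCoeff_ne_zero {F : Germ} (i : Fin 2) (h : constantCoeff F ≠ 0) :
    ¬ X i ∣ F := by
  rintro ⟨G, rfl⟩
  simp at h

theorem not_X0_dvd {F : Germ} {j : ℕ} (h : cf F 0 j ≠ 0) : ¬ X 0 ∣ F := by
  rintro ⟨G, rfl⟩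
  apply h
  simpa using cf_X0_pow_mul 1 G 0 j

theorem not_X1_dvd {F : Germ} {i : ℕ} (h : cf F i 0 ≠ 0) : ¬ X 1 ∣ F := by
  rintro ⟨G, rfl⟩
  apply h
  simpa using cf_X1_pow_mul 1 G i 0

theorem X_ne_zero' (i : Fin 2) : (X i : Germ) ≠ 0 := by
  intro h
  have := congrArg (coeff (Finsupp.single i 1)) h
  simp at this

theorem divXPow_X_pow_mul (i : Fin 2) (k : ℕ) (G : Germ) : divXPow i k (X i ^ k * G) = G := by
  ext n
  change coeff (n + Finsupp.single i k) (X i ^ k * G) = _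
  rw [X_pow_eq, add_comm, coeff_add_monomial_mul, one_mul]

theorem strictTransform_eq {d : Direction} {F G : Germ} {m : ℕ}
    (h : pullback d F = X (excIndex d) ^ m * G) (hG : ¬ X (excIndex d) ∣ G) :
    strictTransform d F = G := by
  have hm : multiplicity (excEquation d) (pullback d F) = m := by
    apply multiplicity_eq_of_dvd_of_not_dvd
    · rw [h]; exact Dvd.intro _ rfl
    · rw [h, pow_succ]
      intro h'
      exact hG ((mul_dvd_mul_iff_left (pow_ne_zero m (X_ne_zero' (excIndex d)))).1 h')
  rw [strictTransform, hm, h, divXPow_X_pow_mul]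

/-- A point with the total transform `T` and the strict transform `S` is bad if `S` is singular
there or `T` does not have normal crossings there. -/
def IsBad (T S : Germ) : Prop := IsSingular S ∨ ¬ HasNormalCrossings T

/-- The strict transform does not pass through the point, and the total transform is supported on
the coordinate axes. -/
def IsMonomialPair (T S : Germ) : Prop :=
  constantCoeff S ≠ 0 ∧ ∃ w : Germ, ∃ A B : ℕ, constantCoeff w ≠ 0 ∧ T = w * X 0 ^ A * X 1 ^ B

theorem isLocalParameters_X : IsLocalParameters (X 0) (X 1) := by
  refine ⟨by simp, by simp, ?_⟩
  simp [coeff_X, Finsupp.single_left_inj]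

theorem IsMonomialPair.not_isBad {T S : Germ} (h : IsMonomialPair T S) : ¬ IsBad T S := by
  obtain ⟨hS, w, A, B, hw, hT⟩ := h
  rintro (h | h)
  · exact hS h.1
  · exact h ⟨X 0, X 1, w, A, B, isLocalParameters_X, hw, hT⟩

theorem strictTransform_of_unit (d : Direction) {S : Germ} (h : constantCoeff S ≠ 0) :
    strictTransform d S = pullback d S :=
  strictTransform_eq (m := 0) (by simp)
    (not_X_dvd_of_constantCoeff_ne_zero _ (by rwa [constantCoeff_pullback]))

/-- Pull-backs of monomials are monomials up to units. -/
theorem exists_pullback_monomial (d : Direction) (A B : ℕ) : ∃ w : Germ, ∃ A' B' : ℕ,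
    constantCoeff w ≠ 0 ∧ pullback d (X 0 ^ A * X 1 ^ B) = w * X 0 ^ A' * X 1 ^ B' := by
  induction d using OnePoint.rec with
  | infty =>
    refine ⟨1, A, A + B, by simp, ?_⟩
    rw [pullback_mul, pullback_pow, pullback_pow, pullback_infty_X0, pullback_infty_X1]; ring
  | coe c =>
    by_cases hc : c = 0
    · refine ⟨1, A + B, B, by simp, ?_⟩
      rw [pullback_mul, pullback_pow, pullback_pow]
      rw [pullback_some_X0, pullback_some_X1, hc, map_zero]; ring
    · refine ⟨(X 1 + C c) ^ B, A + B, 0, by simp [hc], ?_⟩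
      rw [pullback_mul, pullback_pow, pullback_pow]
      rw [pullback_some_X0, pullback_some_X1, mul_pow]; ring

/-- A direction which is not tangent to the curve: the strict transform avoids that point. -/
theorem isMonomialPair_of_pullback {d : Direction} {T S w U : Germ} {A B m : ℕ}
    (hw : constantCoeff w ≠ 0) (hT : T = w * X 0 ^ A * X 1 ^ B * S)
    (hU : constantCoeff U ≠ 0) (hS : pullback d S = X (excIndex d) ^ m * U) :
    IsMonomialPair (pullback d T) (strictTransform d S) := by
  rw [strictTransform_eq hS (not_X_dvd_of_constantCoeff_ne_zero _ hU)]
  refine ⟨hU, ?_⟩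
  obtain ⟨w', A', B', hw', h'⟩ := exists_pullback_monomial d A B
  have : ∃ A'' B'' : ℕ, X 0 ^ A' * X 1 ^ B' * X (excIndex d) ^ m =
      (X 0 ^ A'' * X 1 ^ B'' : Germ) := by
    induction d using OnePoint.rec with
    | infty => exact ⟨A', B' + m, by simp only [excIndex]; ring⟩
    | coe c => exact ⟨A' + m, B', by simp only [excIndex]; ring⟩
  obtain ⟨A'', B'', h''⟩ := this
  refine ⟨pullback d w * w' * U, A'', B'', by simp [constantCoeff_pullback, hw, hw', hU], ?_⟩
  rw [hT, mul_assoc w, pullback_mul, pullback_mul, h', hS]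
  linear_combination (pullback d w * w' * U) * h''

theorem IsMonomialPair.blowUp {T S : Germ} (h : IsMonomialPair T S) (d : Direction) :
    IsMonomialPair (pullback d T) (strictTransform d S) := by
  obtain ⟨hS, w, A, B, hw, hT⟩ := h
  obtain ⟨-, h2⟩ := isMonomialPair_of_pullback (d := d) (T := T) (S := 1) (U := 1) (m := 0) hw
    (by rw [hT, mul_one]) (by simp) (by
      rw [pow_zero, one_mul]
      exact (congrFun (coe_substAlgHom (hasSubst_chart d)) 1).symm.trans (map_one _))
  refine ⟨?_, h2⟩
  rwa [strictTransform_of_unit d hS, constantCoeff_pullback]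

theorem IsMonomialPair.transformAt (l : InfNearPoint) : ∀ {T S : Germ}, IsMonomialPair T S →
    IsMonomialPair (totalTransformAt l T) (strictTransformAt l S) := by
  induction l with
  | nil => exact id
  | cons d l ih => exact fun h => ih (h.blowUp d)

/-- The strict transform is smooth and transversal to `x = 0`, and `x = 0` is the only possible
exceptional curve at the point. -/
def IsTransversalPair (T S : Germ) : Prop :=
  constantCoeff S = 0 ∧ cf S 0 1 ≠ 0 ∧ ∃ w : Germ, ∃ A : ℕ, constantCoeff w ≠ 0 ∧
    T = w * X 0 ^ A * S

theorem coeff_single_zero (S : Germ) : coeff (Finsupp.single 0 1) S = cf S 1 0 := by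
  simp [cf, pt]

theorem coeff_single_one (S : Germ) : coeff (Finsupp.single 1 1) S = cf S 0 1 := by
  simp [cf, pt]

theorem IsTransversalPair.not_isBad {T S : Germ} (h : IsTransversalPair T S) : ¬ IsBad T S := by
  obtain ⟨h0, h1, w, A, hw, hT⟩ := h
  rintro (h | h)
  · exact h1 (by rw [← coeff_single_one]; exact h.2 1)
  · refine h ⟨X 0, S, w, A, 1, ⟨by simp, h0, ?_⟩, hw, by rw [hT, pow_one]⟩
    rw [coeff_single_one S]
    simpa [coeff_X, Finsupp.single_left_inj] using h1

theorem IsTransversalPair.blowUp {T S : Germ} (h : IsTransversalPair T S) (d : Direction) :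
    IsMonomialPair (pullback d T) (strictTransform d S) ∨
      IsTransversalPair (pullback d T) (strictTransform d S) := by
  obtain ⟨h0, h1, w, A, hw, hT⟩ := h
  have h00 : cf S 0 0 = 0 := by rwa [← constantCoeff_eq_cf]
  have hT' : T = w * X 0 ^ A * X 1 ^ 0 * S := by rw [hT, pow_zero, mul_one]
  induction d using OnePoint.rec with
  | infty =>
    left
    obtain ⟨G, hG, hG'⟩ := exists_eq_X1_pow_mul (k := 1) (F := pullback OnePoint.infty S) (by
      intro i j hj
      obtain rfl : j = 0 := by omega
      rw [cf_pullback_infty]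
      split_ifs with hi
      · obtain rfl : i = 0 := by omega
        exact h00
      · rfl)
    refine isMonomialPair_of_pullback hw hT' (U := G) (m := 1) ?_ hG
    rw [constantCoeff_eq_cf, hG', cf_pullback_infty]
    simpa using h1
  | coe c =>
    obtain ⟨G, hG, hG'⟩ := exists_eq_X0_pow_mul (k := 1) (F := pullback (OnePoint.some c) S) (by
      intro i j hj
      obtain rfl : i = 0 := by omega
      rw [cf_pullback_some]
      simp [h00])
    have hG1 : cf G 0 1 ≠ 0 := by
      rw [hG', cf_pullback_some]
      simpa [Finset.sum_range_succ] using h1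
    by_cases hc : constantCoeff G = 0
    · right
      have hs : strictTransform (OnePoint.some c) S = G := strictTransform_eq hG (not_X0_dvd hG1)
      change IsTransversalPair _ (strictTransform (OnePoint.some c) S)
      rw [hs]
      refine ⟨hc, hG1, pullback (OnePoint.some c) w, A + 1,
        by rwa [constantCoeff_pullback], ?_⟩
      rw [hT, pullback_mul, pullback_mul, pullback_pow, pullback_some_X0, hG]; ring
    · left
      exact isMonomialPair_of_pullback hw hT' hc hG

theorem IsTransversalPair.transformAt (l : InfNearPoint) : ∀ {T S : Germ},
    IsTransversalPair T S → ¬ IsBad (totalTransformAt l T) (strictTransformAt l S) := by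
  induction l with
  | nil => exact fun h => h.not_isBad
  | cons d l ih =>
    intro T S h
    rcases h.blowUp d with h | h
    · exact (h.transformAt l).not_isBad
    · exact ih h

/-- The form of degree `n` of `F`, evaluated at `x = 1`. -/
noncomputable def formPoly (F : Germ) (n : ℕ) : Polynomial ℂ :=
  ∑ k ∈ Finset.range (n + 1), Polynomial.C (cf F (n - k) k) * Polynomial.X ^ k

theorem coeff_formPoly (F : Germ) (n k : ℕ) :
    (formPoly F n).coeff k = if k ≤ n then cf F (n - k) k else 0 := by
  rw [formPoly, Polynomial.finsetSum_coeff]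
  simp only [Polynomial.coeff_C_mul, Polynomial.coeff_X_pow, mul_ite, mul_one, mul_zero]
  rw [Finset.sum_ite_eq]
  simp

theorem cf_pullback_some_eq (c : ℂ) (F : Germ) (n j : ℕ) :
    cf (pullback (OnePoint.some c) F) n j =
      ((formPoly F n).comp (Polynomial.X + Polynomial.C c)).coeff j := by
  rw [cf_pullback_some, formPoly, Polynomial.sum_comp, Polynomial.finsetSum_coeff]
  refine Finset.sum_congr rfl fun k _ => ?_
  rw [Polynomial.mul_comp, Polynomial.C_comp, Polynomial.X_pow_comp, Polynomial.coeff_C_mul,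
    Polynomial.coeff_X_add_C_pow]

theorem comp_add_C_injective (c : ℂ) {p q : Polynomial ℂ}
    (h : p.comp (Polynomial.X + Polynomial.C c) = q.comp (Polynomial.X + Polynomial.C c)) :
    p = q := by
  have := congrArg (fun r => Polynomial.comp r (Polynomial.X - Polynomial.C c)) h
  simpa [Polynomial.comp_assoc] using this

/-- If the strict transform at the direction `γ` meets the exceptional curve with multiplicity `m`
there, where `m` is the multiplicity of the curve, then the initial form is a power of the equation
of the direction `γ`. -/
theorem formPoly_of_pullback {γ : ℂ} {S G : Germ} {m : ℕ}
    (hS : pullback (OnePoint.some γ) S = X 0 ^ m * G) (hlt : ∀ j < m, cf G 0 j = 0) :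
    (∀ n < m, formPoly S n = 0) ∧ formPoly S m =
      Polynomial.C (cf G 0 m) * (Polynomial.X - Polynomial.C γ) ^ m := by
  constructor
  · intro n hn
    apply comp_add_C_injective γ
    ext j
    rw [← cf_pullback_some_eq, hS, cf_X0_pow_mul, if_neg (by omega)]; simp
  · apply comp_add_C_injective γ
    ext j
    rw [← cf_pullback_some_eq]
    have h1 : (Polynomial.C (cf G 0 m) * (Polynomial.X - Polynomial.C γ) ^ m).comp
        (Polynomial.X + Polynomial.C γ) = Polynomial.C (cf G 0 m) * Polynomial.X ^ m := by
      simp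
    rw [h1, Polynomial.coeff_C_mul, Polynomial.coeff_X_pow]
    rcases lt_trichotomy j m with h | h | h
    · rw [hS, cf_X0_pow_mul, if_pos le_rfl, Nat.sub_self, hlt j h, if_neg (by omega)]; simp
    · rw [hS, cf_X0_pow_mul, if_pos le_rfl, Nat.sub_self, h]; simp
    · rw [cf_pullback_some, if_neg (by omega), mul_zero]
      refine Finset.sum_eq_zero fun k hk => ?_
      rw [Nat.choose_eq_zero_of_lt (by have := Finset.mem_range.1 hk; omega)]; simp

/-- The tangent cone of the curve is the direction `γ`, with multiplicity `m`; so the strict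
transform avoids all other points of the exceptional curve. -/
theorem exists_pullback_eq_of_ne {γ : ℂ} {S G : Germ} {m : ℕ}
    (hS : pullback (OnePoint.some γ) S = X 0 ^ m * G) (hlt : ∀ j < m, cf G 0 j = 0)
    (hm : cf G 0 m ≠ 0) (d : Direction) (hd : d ≠ OnePoint.some γ) :
    ∃ U : Germ, constantCoeff U ≠ 0 ∧ pullback d S = X (excIndex d) ^ m * U := by
  obtain ⟨h1, h2⟩ := formPoly_of_pullback hS hlt
  induction d using OnePoint.rec with
  | infty =>
    obtain ⟨U, hU, hU'⟩ := exists_eq_X1_pow_mul (k := m) (F := pullback OnePoint.infty S) (by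
      intro i j hj
      rw [cf_pullback_infty]
      split_ifs with hi
      · have := coeff_formPoly S j (j - i)
        rw [h1 j hj, if_pos (by omega), show j - (j - i) = i by omega] at this
        simpa using this.symm
      · rfl)
    refine ⟨U, ?_, hU⟩
    rw [constantCoeff_eq_cf, hU', cf_pullback_infty, if_pos (by omega)]
    have := coeff_formPoly S m m
    rw [h2, if_pos le_rfl, Polynomial.coeff_C_mul, Nat.sub_self] at this
    have h3 : ((Polynomial.X - Polynomial.C γ) ^ m).coeff m = 1 := by
      simpa using ((Polynomial.monic_X_sub_C γ).pow m).coeff_natDegree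
    rw [h3, mul_one] at this
    simpa [this] using hm
  | coe c =>
    obtain ⟨U, hU, hU'⟩ := exists_eq_X0_pow_mul (k := m) (F := pullback (OnePoint.some c) S) (by
      intro i j hj
      rw [cf_pullback_some_eq, h1 i hj]; simp)
    refine ⟨U, ?_, hU⟩
    rw [constantCoeff_eq_cf, hU', cf_pullback_some_eq, zero_add, h2]
    have hc : c - γ ≠ 0 := fun h => hd (by rw [sub_eq_zero.1 h])
    simpa [Polynomial.coeff_zero_eq_eval_zero] using ⟨hm, fun h => absurd h hc⟩

/-! ### Parametrizations -/

/-- The series `F (φ (t), ψ (t))`. -/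
noncomputable def evalAt (φ ψ : PowerSeries ℂ) (F : Germ) : PowerSeries ℂ :=
  subst (![φ, ψ] : Fin 2 → MvPowerSeries Unit ℂ) F

section evalAt

variable {φ ψ : PowerSeries ℂ}

theorem evalAt_mul (hφ : PowerSeries.constantCoeff φ = 0)
    (hψ : PowerSeries.constantCoeff ψ = 0) (F G : Germ) :
    evalAt φ ψ (F * G) = evalAt φ ψ F * evalAt φ ψ G := subst_mul (hasSubst_pair hφ hψ) F G

theorem evalAt_pow (hφ : PowerSeries.constantCoeff φ = 0)
    (hψ : PowerSeries.constantCoeff ψ = 0) (F : Germ) (n : ℕ) :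
    evalAt φ ψ (F ^ n) = evalAt φ ψ F ^ n := subst_pow (hasSubst_pair hφ hψ) F n

theorem evalAt_X0 (hφ : PowerSeries.constantCoeff φ = 0)
    (hψ : PowerSeries.constantCoeff ψ = 0) : evalAt φ ψ (X 0) = φ := subst_pair_X0 hφ hψ

theorem evalAt_X1 (hφ : PowerSeries.constantCoeff φ = 0)
    (hψ : PowerSeries.constantCoeff ψ = 0) : evalAt φ ψ (X 1) = ψ := subst_pair_X1 hφ hψ

theorem evalAt_subst (hφ : PowerSeries.constantCoeff φ = 0)
    (hψ : PowerSeries.constantCoeff ψ = 0) {A B : Germ} (hA : constantCoeff A = 0)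
    (hB : constantCoeff B = 0) (F : Germ) :
    evalAt φ ψ (subst ![A, B] F) = evalAt (evalAt φ ψ A) (evalAt φ ψ B) F :=
  subst_pair_subst_pair hA hB hφ hψ F

theorem evalAt_add (hφ : PowerSeries.constantCoeff φ = 0)
    (hψ : PowerSeries.constantCoeff ψ = 0) (F G : Germ) :
    evalAt φ ψ (F + G) = evalAt φ ψ F + evalAt φ ψ G := subst_add (hasSubst_pair hφ hψ) F G

theorem evalAt_sub (hφ : PowerSeries.constantCoeff φ = 0)
    (hψ : PowerSeries.constantCoeff ψ = 0) (F G : Germ) :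
    evalAt φ ψ (F - G) = evalAt φ ψ F - evalAt φ ψ G := subst_sub (hasSubst_pair hφ hψ) F G

theorem evalAt_prod (hφ : PowerSeries.constantCoeff φ = 0)
    (hψ : PowerSeries.constantCoeff ψ = 0) {ι : Type*} (s : Finset ι) (F : ι → Germ) :
    evalAt φ ψ (∏ k ∈ s, F k) = ∏ k ∈ s, evalAt φ ψ (F k) := by
  have h := coe_substAlgHom (R := ℂ) (hasSubst_pair (A := (φ : MvPowerSeries Unit ℂ)) hφ hψ)
  simp only [evalAt, ← h]
  exact map_prod _ _ _

theorem evalAt_swapXY (hφ : PowerSeries.constantCoeff φ = 0)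
    (hψ : PowerSeries.constantCoeff ψ = 0) (F : Germ) :
    evalAt φ ψ (swapXY F) = evalAt ψ φ F := subst_swapXY hφ hψ F

theorem constantCoeff_evalAt (hφ : PowerSeries.constantCoeff φ = 0)
    (hψ : PowerSeries.constantCoeff ψ = 0) (F : Germ) :
    PowerSeries.constantCoeff (evalAt φ ψ F) = constantCoeff F :=
  constantCoeff_subst_pair hφ hψ F

/-- Reparametrization. -/
theorem subst_evalAt (hφ : PowerSeries.constantCoeff φ = 0)
    (hψ : PowerSeries.constantCoeff ψ = 0) {τ : PowerSeries ℂ}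
    (hτ : PowerSeries.constantCoeff τ = 0) (F : Germ) :
    PowerSeries.subst τ (evalAt φ ψ F) =
      evalAt (PowerSeries.subst τ φ) (PowerSeries.subst τ ψ) F := by
  have hτ' : PowerSeries.HasSubst τ := PowerSeries.HasSubst.of_constantCoeff_zero hτ
  rw [evalAt, PowerSeries.subst, subst_comp_subst_apply (hasSubst_pair hφ hψ) hτ'.const]
  rw [evalAt]
  congr 1
  funext s; fin_cases s <;> rfl

end evalAt

theorem coeff_powerSeries (n : ℕ) (f : PowerSeries ℂ) :
    PowerSeries.coeff n f = MvPowerSeries.coeff (Finsupp.single () n) f := rfl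

theorem coeff_evalAt_X_zero (F : Germ) (n : ℕ) :
    PowerSeries.coeff n (evalAt PowerSeries.X 0 F) = cf F n 0 := by
  rw [coeff_powerSeries, evalAt, coeff_subst_pair (by exact PowerSeries.constantCoeff_X) (by simp)
    F _ {pt n 0}]
  · rw [Finset.sum_singleton, ← coeff_powerSeries]
    simp [cf, PowerSeries.coeff_X_pow]
  · intro d hd
    rw [← coeff_powerSeries]
    by_cases h1 : d 1 = 0
    · rw [h1, pow_zero, mul_one, PowerSeries.coeff_X_pow, if_neg]
      rintro rfl
      exact hd (by rw [Finset.mem_singleton, ← h1, pt_eta])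
    · rw [zero_pow h1, mul_zero, map_zero]

theorem coeff_evalAt_zero_X (F : Germ) (n : ℕ) :
    PowerSeries.coeff n (evalAt 0 PowerSeries.X F) = cf F 0 n := by
  rw [← cf_swapXY, ← coeff_evalAt_X_zero, evalAt_swapXY (by simp) (by simp)]

/-- A series in one variable, as a series in `x`. -/
noncomputable def inX0 (ρ : PowerSeries ℂ) : Germ := PowerSeries.subst (X 0 : Germ) ρ

theorem hasSubst_X0 : PowerSeries.HasSubst (X 0 : Germ) := PowerSeries.HasSubst.X 0

theorem cf_inX0 (ρ : PowerSeries ℂ) (i j : ℕ) :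
    cf (inX0 ρ) i j = if j = 0 then PowerSeries.coeff i ρ else 0 := by
  rw [cf, inX0, PowerSeries.coeff_subst_single]
  by_cases h : j = 0
  · subst h
    simp [pt]
  · rw [if_neg h, if_neg]
    intro h'
    exact h (by simpa using DFunLike.congr_fun h' 1)

theorem inX0_mul (ρ σ : PowerSeries ℂ) : inX0 (ρ * σ) = inX0 ρ * inX0 σ :=
  PowerSeries.subst_mul hasSubst_X0 ρ σ

theorem inX0_add (ρ σ : PowerSeries ℂ) : inX0 (ρ + σ) = inX0 ρ + inX0 σ :=
  PowerSeries.subst_add hasSubst_X0 ρ σ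

theorem inX0_pow (ρ : PowerSeries ℂ) (n : ℕ) : inX0 (ρ ^ n) = inX0 ρ ^ n :=
  PowerSeries.subst_pow hasSubst_X0 ρ n

theorem inX0_X : inX0 PowerSeries.X = X 0 := PowerSeries.subst_X hasSubst_X0

theorem inX0_C (c : ℂ) : inX0 (PowerSeries.C c) = C c := PowerSeries.subst_C c

theorem constantCoeff_inX0 {ρ : PowerSeries ℂ} (h : PowerSeries.constantCoeff ρ = 0) :
    constantCoeff (inX0 ρ) = 0 := by
  rw [constantCoeff_eq_cf, cf_inX0, if_pos rfl, PowerSeries.coeff_zero_eq_constantCoeff_apply, h]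

theorem subst_inX0 {τ : Type*} {A B : MvPowerSeries τ ℂ} (hA : constantCoeff A = 0)
    (hB : constantCoeff B = 0) (ρ : PowerSeries ℂ) :
    subst ![A, B] (inX0 ρ) = PowerSeries.subst A ρ := by
  rw [inX0, PowerSeries.subst, subst_comp_subst_apply hasSubst_X0.const (hasSubst_pair hA hB),
    PowerSeries.subst, subst_pair_X0 hA hB]

theorem evalAt_inX0 {φ ψ : PowerSeries ℂ} (hφ : PowerSeries.constantCoeff φ = 0)
    (hψ : PowerSeries.constantCoeff ψ = 0) (ρ : PowerSeries ℂ) :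
    evalAt φ ψ (inX0 ρ) = PowerSeries.subst φ ρ := subst_inX0 hφ hψ ρ

theorem subst_id_pair (F : Germ) : subst (![X 0, X 1] : Fin 2 → Germ) F = F := by
  have h : (![X 0, X 1] : Fin 2 → Germ) = X := by funext s; fin_cases s <;> rfl
  rw [h, subst_self]; rfl

/-- If `G (t, ρ (t)) = 0`, then `y - ρ (x)` divides `G`. -/
theorem exists_eq_X1_sub_mul {ρ : PowerSeries ℂ} (hρ : PowerSeries.constantCoeff ρ = 0) {G : Germ}
    (hG : evalAt PowerSeries.X ρ G = 0) : ∃ Q : Germ, G = (X 1 - inX0 ρ) * Q := by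
  have hρ' := constantCoeff_inX0 hρ
  have h0 : constantCoeff (X 0 : Germ) = 0 := by simp
  have h1 : constantCoeff (X 1 + inX0 ρ : Germ) = 0 := by simp [hρ']
  have h2 : constantCoeff (X 1 - inX0 ρ : Germ) = 0 := by simp [hρ']
  have hX : PowerSeries.constantCoeff (PowerSeries.X : PowerSeries ℂ) = 0 := by simp
  have hz : PowerSeries.constantCoeff (0 : PowerSeries ℂ) = 0 := by simp
  obtain ⟨H, hH, -⟩ := exists_eq_X1_pow_mul (k := 1) (F := subst ![X 0, X 1 + inX0 ρ] G) (by
    intro i j hj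
    obtain rfl : j = 0 := by omega
    rw [← coeff_evalAt_X_zero, evalAt_subst hX hz h0 h1, evalAt_X0 hX hz, evalAt_add hX hz,
      evalAt_X1 hX hz, evalAt_inX0 hX hz, PowerSeries.X_subst, zero_add, hG, map_zero])
  refine ⟨subst ![X 0, X 1 - inX0 ρ] H, ?_⟩
  have h3 := congrArg (subst ![X 0, X 1 - inX0 ρ]) hH
  rw [subst_pair_subst_pair h0 h1 h0 h2, subst_pair_X0 h0 h2, subst_add (hasSubst_pair h0 h2),
    subst_pair_X1 h0 h2, subst_inX0 h0 h2, pow_one, subst_mul (hasSubst_pair h0 h2),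
    subst_pair_X1 h0 h2] at h3
  rw [← h3]
  change G = subst ![X 0, X 1 - inX0 ρ + inX0 ρ] G
  rw [sub_add_cancel, subst_id_pair]

theorem evalAt_X1_sub {ρ σ φ : PowerSeries ℂ} (hφ : PowerSeries.constantCoeff φ = 0)
    (hσ : PowerSeries.constantCoeff σ = 0) :
    evalAt φ σ (X 1 - inX0 ρ) = σ - PowerSeries.subst φ ρ := by
  rw [evalAt_sub hφ hσ, evalAt_X1 hφ hσ, evalAt_inX0 hφ hσ]

theorem exists_eq_prod_mul {ρ : ℕ → PowerSeries ℂ} (hρ : ∀ k, PowerSeries.constantCoeff (ρ k) = 0)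
    {G : Germ} (n : ℕ) (hinj : ∀ i < n, ∀ j < n, ρ i = ρ j → i = j)
    (hG : ∀ k < n, evalAt PowerSeries.X (ρ k) G = 0) :
    ∃ Q : Germ, G = (∏ k ∈ Finset.range n, (X 1 - inX0 (ρ k))) * Q := by
  have hX : PowerSeries.constantCoeff (PowerSeries.X : PowerSeries ℂ) = 0 := by simp
  induction n with
  | zero => exact ⟨G, by simp⟩
  | succ n ih =>
    obtain ⟨Q, hQ⟩ := ih (fun i hi j hj => hinj i (by omega) j (by omega))
      (fun k hk => hG k (by omega))
    have h := hG n (by omega)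
    rw [hQ, evalAt_mul hX (hρ n), evalAt_prod hX (hρ n)] at h
    have hne : (∏ k ∈ Finset.range n, evalAt PowerSeries.X (ρ n) (X 1 - inX0 (ρ k))) ≠ 0 := by
      rw [Finset.prod_ne_zero_iff]
      intro k hk
      rw [evalAt_X1_sub hX (hρ n), PowerSeries.X_subst, sub_ne_zero]
      intro h'
      have := hinj n (by omega) k (by have := Finset.mem_range.1 hk; omega) h'
      have := Finset.mem_range.1 hk
      omega
    obtain ⟨Q', hQ'⟩ := exists_eq_X1_sub_mul (hρ n) ((mul_eq_zero.1 h).resolve_left hne)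
    exact ⟨Q', by rw [hQ, hQ', Finset.prod_range_succ]; ring⟩

/-- The parametrization `(φ, ψ)` is injective near the origin: it has no automorphisms. -/
def IsPrimitiveParam (φ ψ : PowerSeries ℂ) : Prop :=
  ∀ σ : PowerSeries ℂ, PowerSeries.constantCoeff σ = 0 → PowerSeries.subst σ φ = φ →
    PowerSeries.subst σ ψ = ψ → σ = PowerSeries.X

theorem IsPrimitiveParam.swap {φ ψ : PowerSeries ℂ} (h : IsPrimitiveParam φ ψ) :
    IsPrimitiveParam ψ φ := fun σ h0 h1 h2 => h σ h0 h2 h1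

theorem subst_smul_X (c : ℂ) (ψ : PowerSeries ℂ) :
    PowerSeries.subst (c • PowerSeries.X : PowerSeries ℂ) ψ = PowerSeries.rescale c ψ :=
  (PowerSeries.rescale_eq_subst c ψ).symm

/-- The `k`-th conjugate `ψ (ζ ^ k * t)` of a series. -/
noncomputable def conj (ζ : ℂ) (ψ : PowerSeries ℂ) (k : ℕ) : PowerSeries ℂ :=
  PowerSeries.rescale (ζ ^ k) ψ

theorem constantCoeff_conj {ζ : ℂ} {ψ : PowerSeries ℂ} (h : PowerSeries.constantCoeff ψ = 0)
    (k : ℕ) : PowerSeries.constantCoeff (conj ζ ψ k) = 0 := by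
  rw [← PowerSeries.coeff_zero_eq_constantCoeff_apply] at h ⊢
  rw [conj, PowerSeries.coeff_rescale, h, mul_zero]

theorem conj_injective {a : ℕ} {ψ : PowerSeries ℂ} {ζ : ℂ}
    (hζ : IsPrimitiveRoot ζ a) (hp : IsPrimitiveParam (PowerSeries.X ^ a) ψ) :
    ∀ i < a, ∀ j < a, conj ζ ψ i = conj ζ ψ j → i = j := by
  have key : ∀ i j, i ≤ j → j < a → conj ζ ψ i = conj ζ ψ j → i = j := by
    intro i j hij hj h
    have hz : ζ ≠ 0 := hζ.ne_zero (by omega)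
    have h1 : PowerSeries.rescale (ζ ^ (j - i)) ψ = ψ := by
      have h2 := congrArg (PowerSeries.rescale ((ζ ^ i)⁻¹)) h
      rw [conj, conj, PowerSeries.rescale_rescale, PowerSeries.rescale_rescale,
        mul_inv_cancel₀ (pow_ne_zero _ hz)] at h2
      rw [show ζ ^ (j - i) = ζ ^ j * (ζ ^ i)⁻¹ by rw [pow_sub₀ _ hz hij], ← h2]
      simp
    have h3 := hp (ζ ^ (j - i) • PowerSeries.X) (by simp) (by
      rw [subst_smul_X, map_pow, PowerSeries.rescale_X, mul_pow, ← map_pow, ← pow_mul,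
        mul_comm (j - i), pow_mul, hζ.pow_eq_one]; simp) (by rw [subst_smul_X, h1])
    have h4 := congrArg (PowerSeries.coeff 1) h3
    simp only [PowerSeries.coeff_smul, PowerSeries.coeff_one_X, smul_eq_mul, mul_one] at h4
    have := hζ.dvd_of_pow_eq_one _ h4
    have := Nat.eq_zero_of_dvd_of_lt this (by omega)
    omega
  intro i hi j hj h
  rcases le_total i j with hij | hij
  · exact key i j hij hj h
  · exact (key j i hij hi h.symm).symm

theorem evalAt_X_pow_conj {a : ℕ} (ha : 0 < a) {ψ : PowerSeries ℂ}
    (hψ : PowerSeries.constantCoeff ψ = 0) {ζ : ℂ} (hζ : ζ ^ a = 1) (S : Germ)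
    (hS : evalAt (PowerSeries.X ^ a) ψ S = 0) (k : ℕ) :
    evalAt PowerSeries.X (conj ζ ψ k) (subst ![X 0 ^ a, X 1] S) = 0 := by
  have hX : PowerSeries.constantCoeff (PowerSeries.X : PowerSeries ℂ) = 0 := by simp
  have hXa : PowerSeries.constantCoeff (PowerSeries.X ^ a : PowerSeries ℂ) = 0 := by simp [ha.ne']
  have hc := constantCoeff_conj (ζ := ζ) hψ k
  rw [evalAt_subst hX hc (by simp [ha.ne']) (by simp), evalAt_pow hX hc, evalAt_X0 hX hc,
    evalAt_X1 hX hc]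
  have := subst_evalAt hXa hψ (τ := ζ ^ k • PowerSeries.X) (by simp) S
  rw [hS, subst_smul_X, subst_smul_X, subst_smul_X, map_zero] at this
  rw [this]
  congr 1
  rw [map_pow, PowerSeries.rescale_X, mul_pow, ← map_pow, ← pow_mul, mul_comm k, pow_mul, hζ]
  simp

/-- The equation of a curve with the parametrization `(t ^ a, ψ)` is a product over the
conjugates of `ψ`. -/
theorem exists_factorization {a : ℕ} (ha : 0 < a) {ψ : PowerSeries ℂ}
    (hψ : PowerSeries.constantCoeff ψ = 0) {ζ : ℂ} (hζ : IsPrimitiveRoot ζ a)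
    (hp : IsPrimitiveParam (PowerSeries.X ^ a) ψ) {S : Germ}
    (hS : evalAt (PowerSeries.X ^ a) ψ S = 0) :
    ∃ Q : Germ, subst ![X 0 ^ a, X 1] S =
      (∏ k ∈ Finset.range a, (X 1 - inX0 (conj ζ ψ k))) * Q :=
  exists_eq_prod_mul (constantCoeff_conj hψ) a (conj_injective hζ hp)
    (fun k _ => evalAt_X_pow_conj ha hψ hζ.pow_eq_one S hS k)

theorem evalAt_zero_X_prod {ρ : ℕ → PowerSeries ℂ}
    (hρ : ∀ k, PowerSeries.constantCoeff (ρ k) = 0) (a : ℕ) :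
    evalAt 0 PowerSeries.X (∏ k ∈ Finset.range a, (X 1 - inX0 (ρ k))) = PowerSeries.X ^ a := by
  have hX : PowerSeries.constantCoeff (PowerSeries.X : PowerSeries ℂ) = 0 := by simp
  have hz : PowerSeries.constantCoeff (0 : PowerSeries ℂ) = 0 := by simp
  rw [evalAt_prod hz hX, Finset.prod_congr rfl (g := fun _ => PowerSeries.X)]
  · simp
  · intro k _
    rw [evalAt_X1_sub hz hX, PowerSeries.subst_zero_of_constantCoeff_zero (hρ k), sub_zero]

theorem cf_zero_prod_mul {ρ : ℕ → PowerSeries ℂ}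
    (hρ : ∀ k, PowerSeries.constantCoeff (ρ k) = 0) (a : ℕ) (Q : Germ) (j : ℕ) :
    cf ((∏ k ∈ Finset.range a, (X 1 - inX0 (ρ k))) * Q) 0 j =
      if a ≤ j then cf Q 0 (j - a) else 0 := by
  rw [← coeff_evalAt_zero_X, evalAt_mul (by simp) (by simp), evalAt_zero_X_prod hρ,
    PowerSeries.coeff_X_pow_mul', coeff_evalAt_zero_X]

/-- Units of `ℂ⟦t⟧` have roots of all orders (Hensel's lemma). -/
theorem exists_pow_eq {u : PowerSeries ℂ} (hu : PowerSeries.constantCoeff u ≠ 0) {a : ℕ}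
    (ha : 0 < a) : ∃ v : PowerSeries ℂ, v ^ a = u := by
  obtain ⟨c, hc⟩ := IsAlgClosed.exists_pow_nat_eq (PowerSeries.constantCoeff u) ha
  have hc0 : c ≠ 0 := by rintro rfl; rw [zero_pow ha.ne'] at hc; exact hu hc.symm
  obtain ⟨v, hv, -⟩ := HenselianRing.is_henselian (R := PowerSeries ℂ)
    (I := Ideal.span {PowerSeries.X}) (Polynomial.X ^ a - Polynomial.C u)
    (Polynomial.monic_X_pow_sub_C u ha.ne') (PowerSeries.C c) (by
      rw [Ideal.mem_span_singleton, PowerSeries.X_dvd_iff]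
      simp [hc]) (by
      rw [Polynomial.derivative_sub, Polynomial.derivative_C, sub_zero,
        Polynomial.derivative_X_pow]
      apply IsUnit.map
      rw [PowerSeries.isUnit_iff_constantCoeff]
      simp [hc0, ha.ne'])
  refine ⟨v, ?_⟩
  rw [Polynomial.IsRoot.def] at hv
  simpa [sub_eq_zero] using hv

/-- A series of order `a` becomes `t ^ a` after a reparametrization. -/
theorem exists_reparam {a : ℕ} (ha : 0 < a) {u : PowerSeries ℂ}
    (hu : PowerSeries.constantCoeff u ≠ 0) :
    ∃ τ τ' w : PowerSeries ℂ, τ = PowerSeries.X * w ∧ PowerSeries.constantCoeff w ≠ 0 ∧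
      PowerSeries.constantCoeff τ' = 0 ∧ PowerSeries.subst τ τ' = PowerSeries.X ∧
      PowerSeries.subst τ' τ = PowerSeries.X ∧
      PowerSeries.subst τ (PowerSeries.X ^ a * u) = PowerSeries.X ^ a := by
  obtain ⟨v, hv⟩ := exists_pow_eq hu ha
  have hv0 : PowerSeries.constantCoeff v ≠ 0 := by
    intro h; apply hu; rw [← hv, map_pow, h, zero_pow ha.ne']
  set P : PowerSeries ℂ := PowerSeries.X * v with hP
  have hP0 : PowerSeries.constantCoeff P = 0 := by simp [hP]
  have hP1 : PowerSeries.coeff 1 P ≠ 0 := by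
    rw [hP, show (1 : ℕ) = 0 + 1 from rfl, PowerSeries.coeff_succ_X_mul]; simpa using hv0
  have hP1' : IsUnit (PowerSeries.coeff 1 P) := hP1.isUnit
  have hl := PowerSeries.subst_substInvOfIsUnit_left P hP0 hP1'
  have hr := PowerSeries.subst_substInvOfIsUnit_right P hP0 hP1'
  have hτ0 := PowerSeries.constantCoeff_substInvOfIsUnit P hP1'
  have hτ1 := PowerSeries.coeff_one_substInvOfIsUnit P hP1'
  set τ := P.substInvOfIsUnit hP1'
  obtain ⟨w, hw⟩ := PowerSeries.X_dvd_iff.2 hτ0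
  have hs : PowerSeries.HasSubst τ := PowerSeries.HasSubst.of_constantCoeff_zero hτ0
  refine ⟨τ, P, w, hw, ?_, hP0, hr, hl, ?_⟩
  · intro h0
    have h1 : PowerSeries.coeff (0 + 1) τ = 0 := by
      rw [hw, PowerSeries.coeff_succ_X_mul, PowerSeries.coeff_zero_eq_constantCoeff_apply, h0]
    exact (hP1'.unit⁻¹).ne_zero (hτ1.symm.trans h1)
  · rw [← hv, ← mul_pow, ← hP, PowerSeries.subst_pow hs, hr]

theorem IsPrimitiveParam.subst {φ ψ τ τ' : PowerSeries ℂ} (h : IsPrimitiveParam φ ψ)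
    (hτ : PowerSeries.constantCoeff τ = 0) (hτ' : PowerSeries.constantCoeff τ' = 0)
    (h1 : PowerSeries.subst τ τ' = PowerSeries.X) (h2 : PowerSeries.subst τ' τ = PowerSeries.X) :
    IsPrimitiveParam (PowerSeries.subst τ φ) (PowerSeries.subst τ ψ) := by
  intro σ hσ hφ hψ
  have s1 : PowerSeries.HasSubst τ := PowerSeries.HasSubst.of_constantCoeff_zero hτ
  have s2 : PowerSeries.HasSubst τ' := PowerSeries.HasSubst.of_constantCoeff_zero hτ'
  have s3 : PowerSeries.HasSubst σ := PowerSeries.HasSubst.of_constantCoeff_zero hσ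
  have h4 : PowerSeries.constantCoeff (PowerSeries.subst σ τ) = 0 :=
    PowerSeries.constantCoeff_subst_eq_zero hσ _ hτ
  have s4 : PowerSeries.HasSubst (PowerSeries.subst σ τ) :=
    PowerSeries.HasSubst.of_constantCoeff_zero h4
  -- `σ` is conjugate to the automorphism `τ ∘ σ ∘ τ'` of `(φ, ψ)`
  have key : ∀ f : PowerSeries ℂ, PowerSeries.subst σ (PowerSeries.subst τ f) =
      PowerSeries.subst τ f →
      PowerSeries.subst (PowerSeries.subst τ' (PowerSeries.subst σ τ)) f = f := by
    intro f hf
    rw [PowerSeries.subst_comp_subst_apply s1 s3] at hf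
    rw [← PowerSeries.subst_comp_subst_apply s4 s2, hf, PowerSeries.subst_comp_subst_apply s1 s2,
      h2, PowerSeries.X_subst]
  have h5 := h _ (PowerSeries.constantCoeff_subst_eq_zero hτ' _ h4) (key φ hφ) (key ψ hψ)
  have h6 := congrArg (PowerSeries.subst τ) h5
  rw [PowerSeries.subst_comp_subst_apply s2 s1, h1, PowerSeries.X_subst,
    PowerSeries.subst_X s1] at h6
  have h7 := congrArg (fun f => PowerSeries.subst f τ') h6
  beta_reduce at h7
  rw [← PowerSeries.subst_comp_subst_apply s1 s3, h1, PowerSeries.subst_X s3] at h7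
  exact h7

/-- `F (0, y)` has the order `a`: the curve meets `x = 0` with multiplicity `a`. -/
def HasYOrder (F : Germ) (a : ℕ) : Prop := (∀ j < a, cf F 0 j = 0) ∧ cf F 0 a ≠ 0

/-- `F (x, 0)` has the order `b`: the curve meets `y = 0` with multiplicity `b`. -/
def HasXOrder (F : Germ) (b : ℕ) : Prop := (∀ i < b, cf F i 0 = 0) ∧ cf F b 0 ≠ 0

/-- The factorization over the conjugates, for a curve whose intersection multiplicity with `x = 0`
is that of the parametrization. -/
theorem exists_unit_factorization {a : ℕ} (ha : 0 < a) {ψ : PowerSeries ℂ}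
    (hψ : PowerSeries.constantCoeff ψ = 0) {ζ : ℂ} (hζ : IsPrimitiveRoot ζ a)
    (hp : IsPrimitiveParam (PowerSeries.X ^ a) ψ) {S : Germ}
    (hS : evalAt (PowerSeries.X ^ a) ψ S = 0) (hSa : cf S 0 a ≠ 0) :
    ∃ Q : Germ, constantCoeff Q ≠ 0 ∧ subst ![X 0 ^ a, X 1] S =
      (∏ k ∈ Finset.range a, (X 1 - inX0 (conj ζ ψ k))) * Q := by
  obtain ⟨Q, hQ⟩ := exists_factorization ha hψ hζ hp hS
  refine ⟨Q, ?_, hQ⟩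
  have h := cf_subst_X0_pow a ha S 0 a
  rw [hQ, cf_zero_prod_mul (constantCoeff_conj hψ), if_pos le_rfl, if_pos (dvd_zero a),
    Nat.sub_self, Nat.zero_div, ← constantCoeff_eq_cf] at h
  rwa [h]

theorem rescale_X_pow_mul (c : ℂ) (b : ℕ) (v : PowerSeries ℂ) :
    PowerSeries.rescale c (PowerSeries.X ^ b * v) =
      PowerSeries.X ^ b * (PowerSeries.C (c ^ b) * PowerSeries.rescale c v) := by
  rw [map_mul, map_pow, PowerSeries.rescale_X, mul_pow, ← map_pow]; ring

theorem constantCoeff_rescale (c : ℂ) (v : PowerSeries ℂ) :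
    PowerSeries.constantCoeff (PowerSeries.rescale c v) = PowerSeries.constantCoeff v := by
  rw [← PowerSeries.coeff_zero_eq_constantCoeff_apply, PowerSeries.coeff_rescale, pow_zero,
    one_mul, PowerSeries.coeff_zero_eq_constantCoeff_apply]

theorem rescale_C (c γ : ℂ) :
    PowerSeries.rescale c (PowerSeries.C γ) = PowerSeries.C γ := by
  ext n
  rw [PowerSeries.coeff_rescale, PowerSeries.coeff_C]
  split_ifs with h <;> simp [h]

/-- The intersection multiplicity of the curve with `y = 0`, in a normalized parametrization. -/
theorem hasXOrder_of_X_pow {a b : ℕ} (ha : 0 < a) (hb : 0 < b) {v : PowerSeries ℂ}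
    (hv : PowerSeries.constantCoeff v ≠ 0)
    (hp : IsPrimitiveParam (PowerSeries.X ^ a) (PowerSeries.X ^ b * v)) {S : Germ}
    (hS : evalAt (PowerSeries.X ^ a) (PowerSeries.X ^ b * v) S = 0) (hSa : cf S 0 a ≠ 0) :
    HasXOrder S b := by
  have hψ : PowerSeries.constantCoeff (PowerSeries.X ^ b * v) = 0 := by simp [hb.ne']
  have hX : PowerSeries.constantCoeff (PowerSeries.X : PowerSeries ℂ) = 0 := by simp
  have hz : PowerSeries.constantCoeff (0 : PowerSeries ℂ) = 0 := by simp
  have hζ := Complex.isPrimitiveRoot_exp a ha.ne'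
  obtain ⟨Q, hQ0, hQ⟩ := exists_unit_factorization ha hψ hζ hp hS hSa
  set ζ := Complex.exp (2 * Real.pi * Complex.I / a)
  -- the restriction to `y = 0` of the factorization
  have h1 : ∃ W : PowerSeries ℂ, PowerSeries.constantCoeff W ≠ 0 ∧
      evalAt PowerSeries.X 0 (subst ![X 0 ^ a, X 1] S) = PowerSeries.X ^ (b * a) * W := by
    refine ⟨(∏ k ∈ Finset.range a, (- (PowerSeries.C ((ζ ^ k) ^ b) *
      PowerSeries.rescale (ζ ^ k) v))) * evalAt PowerSeries.X 0 Q, ?_, ?_⟩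
    · rw [map_mul, map_prod, constantCoeff_evalAt hX hz]
      refine mul_ne_zero (Finset.prod_ne_zero_iff.2 fun k _ => ?_) hQ0
      rw [map_neg, map_mul, constantCoeff_rescale, PowerSeries.constantCoeff_C]
      exact neg_ne_zero.2 (mul_ne_zero (pow_ne_zero _ (pow_ne_zero _ (hζ.ne_zero ha.ne'))) hv)
    · rw [hQ, evalAt_mul hX hz, evalAt_prod hX hz, ← mul_assoc]
      congr 1
      rw [Finset.prod_congr rfl (g := fun k => PowerSeries.X ^ b *
        (- (PowerSeries.C ((ζ ^ k) ^ b) * PowerSeries.rescale (ζ ^ k) v)))]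
      · rw [Finset.prod_mul_distrib, Finset.prod_const, Finset.card_range, pow_mul]
      · intro k _
        rw [evalAt_X1_sub hX hz, PowerSeries.X_subst, conj, rescale_X_pow_mul]; ring
  obtain ⟨W, hW0, hW⟩ := h1
  have h2 : ∀ i, cf S i 0 = PowerSeries.coeff (a * i) (PowerSeries.X ^ (b * a) * W) := by
    intro i
    rw [← hW, coeff_evalAt_X_zero, cf_subst_X0_pow a ha, if_pos (Dvd.intro _ rfl),
      Nat.mul_div_cancel_left _ ha]
  constructor
  · intro i hi
    rw [h2, PowerSeries.coeff_X_pow_mul', if_neg]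
    rw [mul_comm b a, not_le]
    exact Nat.mul_lt_mul_of_pos_left hi ha
  · rw [h2, PowerSeries.coeff_X_pow_mul', mul_comm b a, if_pos le_rfl, Nat.sub_self]
    simpa using hW0

theorem subst_pullback_some {τ : Type*} {A B : MvPowerSeries τ ℂ} (hA : constantCoeff A = 0)
    (hB : constantCoeff B = 0) (γ : ℂ) (S : Germ) :
    subst ![A, B] (pullback (OnePoint.some γ) S) = subst ![A, A * (B + C γ)] S := by
  have hs := hasSubst_pair hA hB
  change subst ![A, B] (subst (![X 0, X 0 * (X 1 + C γ)] : Fin 2 → Germ) S) = _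
  rw [subst_pair_subst_pair (by simp) (by simp) hA hB, subst_mul hs, subst_add hs,
    subst_pair_X0 hA hB, subst_pair_X1 hA hB]
  rw [show (subst ![A, B] (C γ : Germ) : MvPowerSeries τ ℂ) = C γ from subst_C γ]

/-- The strict transform at the tangent direction, in a normalized parametrization. -/
theorem exists_pullback_eq_of_X_pow {a : ℕ} (ha : 0 < a) {γ : ℂ} {ψ' : PowerSeries ℂ}
    (hψ' : PowerSeries.constantCoeff ψ' = 0)
    (hp : IsPrimitiveParam (PowerSeries.X ^ a) (PowerSeries.X ^ a * (PowerSeries.C γ + ψ')))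
    {S : Germ} (hS : evalAt (PowerSeries.X ^ a) (PowerSeries.X ^ a * (PowerSeries.C γ + ψ')) S = 0)
    (hSa : cf S 0 a ≠ 0) :
    ∃ G : Germ, pullback (OnePoint.some γ) S = X 0 ^ a * G ∧ HasYOrder G a := by
  have hψ : PowerSeries.constantCoeff (PowerSeries.X ^ a * (PowerSeries.C γ + ψ')) = 0 := by
    simp [ha.ne']
  have hζ := Complex.isPrimitiveRoot_exp a ha.ne'
  obtain ⟨Q, hQ0, hQ⟩ := exists_unit_factorization ha hψ hζ hp hS hSa
  set ζ := Complex.exp (2 * Real.pi * Complex.I / a)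
  have h0 : constantCoeff (X 0 : Germ) = 0 := by simp
  have h0a : constantCoeff (X 0 ^ a : Germ) = 0 := by simp [ha.ne']
  have h1 : constantCoeff (X 1 : Germ) = 0 := by simp
  have hB : constantCoeff (X 0 ^ a * (X 1 + C γ) : Germ) = 0 := by simp [ha.ne']
  have hC : constantCoeff (X 0 * (X 1 + C γ) : Germ) = 0 := by simp
  have hs := hasSubst_pair h0 hB
  -- both sides of the factorization after the substitution `y = x ^ a * (y' + γ)`
  have key : subst (![X 0 ^ a, X 1] : Fin 2 → Germ) (pullback (OnePoint.some γ) S) =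
      X 0 ^ (a * a) * ((∏ k ∈ Finset.range a, (X 1 - inX0 (conj ζ ψ' k))) *
        subst (![X 0, X 0 ^ a * (X 1 + C γ)] : Fin 2 → Germ) Q) := by
    have h2 := congrArg (fun F : Germ => subst (![X 0, X 0 ^ a * (X 1 + C γ)] : Fin 2 → Germ) F) hQ
    beta_reduce at h2
    rw [subst_pair_subst_pair h0a h1 h0 hB, subst_pow hs, subst_pair_X0 h0 hB,
      subst_pair_X1 h0 hB, subst_mul hs] at h2
    rw [subst_pullback_some h0a h1, h2, ← mul_assoc]
    congr 1
    have h4 : subst (![X 0, X 0 ^ a * (X 1 + C γ)] : Fin 2 → Germ) (∏ k ∈ Finset.range a,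
        (X 1 - inX0 (conj ζ (PowerSeries.X ^ a * (PowerSeries.C γ + ψ')) k))) =
        ∏ k ∈ Finset.range a, subst (![X 0, X 0 ^ a * (X 1 + C γ)] : Fin 2 → Germ)
        (X 1 - inX0 (conj ζ (PowerSeries.X ^ a * (PowerSeries.C γ + ψ')) k)) := by
      rw [← coe_substAlgHom (R := ℂ) hs]; exact map_prod _ _ _
    rw [h4, Finset.prod_congr rfl (g := fun k => X 0 ^ a * (X 1 - inX0 (conj ζ ψ' k)))]
    · rw [Finset.prod_mul_distrib, Finset.prod_const, Finset.card_range, pow_mul]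
    · intro k _
      rw [subst_sub hs, subst_pair_X1 h0 hB, subst_inX0 h0 hB]
      change _ - inX0 _ = _
      rw [conj, rescale_X_pow_mul, ← pow_mul, mul_comm k a, pow_mul, hζ.pow_eq_one, one_pow,
        map_one, one_mul, map_add, inX0_mul, inX0_pow, inX0_X, inX0_add]
      rw [rescale_C, inX0_C,
        ← conj]
      ring
  have hcf : ∀ n j, cf (pullback (OnePoint.some γ) S) n j =
      cf (subst (![X 0 ^ a, X 1] : Fin 2 → Germ) (pullback (OnePoint.some γ) S)) (a * n) j := by
    intro n j
    rw [cf_subst_X0_pow a ha, if_pos (Dvd.intro _ rfl), Nat.mul_div_cancel_left _ ha]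
  obtain ⟨G, hG, hG'⟩ := exists_eq_X0_pow_mul (k := a) (F := pullback (OnePoint.some γ) S) (by
    intro n j hn
    rw [hcf, key, cf_X0_pow_mul, if_neg]
    rw [not_le]
    exact Nat.mul_lt_mul_of_pos_left hn ha)
  have hG0 : ∀ j, cf G 0 j = if a ≤ j then
      cf (subst (![X 0, X 0 ^ a * (X 1 + C γ)] : Fin 2 → Germ) Q) 0 (j - a) else 0 := by
    intro j
    rw [hG', hcf, key, zero_add, cf_X0_pow_mul, if_pos le_rfl, Nat.sub_self,
      cf_zero_prod_mul (constantCoeff_conj hψ')]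
  refine ⟨G, hG, fun j hj => ?_, ?_⟩
  · rw [hG0, if_neg (by omega)]
  · rw [hG0, if_pos le_rfl, Nat.sub_self, ← constantCoeff_eq_cf, constantCoeff_subst_pair h0 hB]
    exact hQ0

/-- The power series `φ` has the order `a`. -/
def HasOrd (φ : PowerSeries ℂ) (a : ℕ) : Prop :=
  ∃ u : PowerSeries ℂ, PowerSeries.constantCoeff u ≠ 0 ∧ φ = PowerSeries.X ^ a * u

theorem HasOrd.constantCoeff {φ : PowerSeries ℂ} {a : ℕ} (h : HasOrd φ a) (ha : 0 < a) :
    PowerSeries.constantCoeff φ = 0 := by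
  obtain ⟨u, -, rfl⟩ := h
  simp [ha.ne']

theorem HasOrd.ne_zero {φ : PowerSeries ℂ} {a : ℕ} (h : HasOrd φ a) : φ ≠ 0 := by
  obtain ⟨u, hu, rfl⟩ := h
  refine mul_ne_zero (pow_ne_zero _ PowerSeries.X_ne_zero) ?_
  rintro rfl
  simp at hu

/-- `(φ, ψ)` is an injective parametrization of a branch on which `S` vanishes. -/
structure HasParam (S : Germ) (φ ψ : PowerSeries ℂ) : Prop where
  eval : evalAt φ ψ S = 0
  prim : IsPrimitiveParam φ ψ

theorem HasParam.swap {S : Germ} {φ ψ : PowerSeries ℂ} (hφ : PowerSeries.constantCoeff φ = 0)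
    (hψ : PowerSeries.constantCoeff ψ = 0) (h : HasParam S φ ψ) : HasParam (swapXY S) ψ φ :=
  ⟨by rw [evalAt_swapXY hψ hφ, h.eval], h.prim.swap⟩

theorem hasXOrder_swapXY {S : Germ} {a : ℕ} : HasXOrder (swapXY S) a ↔ HasYOrder S a := by
  simp [HasXOrder, HasYOrder]

theorem hasYOrder_swapXY {S : Germ} {a : ℕ} : HasYOrder (swapXY S) a ↔ HasXOrder S a := by
  simp [HasXOrder, HasYOrder]

/-- A parametrization can be normalized such that its first component is a power of `t`. -/
theorem HasParam.exists_normalized {S : Germ} {φ ψ : PowerSeries ℂ} {a : ℕ} (ha : 0 < a)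
    (hφ : HasOrd φ a) (hψ : PowerSeries.constantCoeff ψ = 0) (h : HasParam S φ ψ) :
    ∃ τ w : PowerSeries ℂ, τ = PowerSeries.X * w ∧ PowerSeries.constantCoeff w ≠ 0 ∧
      PowerSeries.subst τ φ = PowerSeries.X ^ a ∧
      HasParam S (PowerSeries.X ^ a) (PowerSeries.subst τ ψ) := by
  have hφ0 := hφ.constantCoeff ha
  obtain ⟨u, hu, rfl⟩ := hφ
  obtain ⟨τ, τ', w, hτ, hw, hτ', h1, h2, h3⟩ := exists_reparam ha hu
  have hτ0 : PowerSeries.constantCoeff τ = 0 := by simp [hτ]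
  refine ⟨τ, w, hτ, hw, h3, ?_, ?_⟩
  · rw [← h3, ← subst_evalAt hφ0 hψ hτ0, h.eval, ← PowerSeries.coe_substAlgHom
      (PowerSeries.HasSubst.of_constantCoeff_zero hτ0), map_zero]
  · rw [← h3]; exact h.prim.subst hτ0 hτ' h1 h2

/-- For a branch, the intersection multiplicities with the two axes are the orders of the components
of a parametrization, as soon as this is true for one of the axes. -/
theorem HasParam.hasXOrder {S : Germ} {φ ψ : PowerSeries ℂ} {a b : ℕ} (ha : 0 < a) (hb : 0 < b)
    (hφ : HasOrd φ a) (hψ : HasOrd ψ b) (h : HasParam S φ ψ) (hS : HasYOrder S a) :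
    HasXOrder S b := by
  obtain ⟨τ, w, hτ, hw, -, h2⟩ := h.exists_normalized ha hφ (hψ.constantCoeff hb)
  have hτ0 : PowerSeries.constantCoeff τ = 0 := by simp [hτ]
  have hs := PowerSeries.HasSubst.of_constantCoeff_zero hτ0
  obtain ⟨v, hv, rfl⟩ := hψ
  have h3 : PowerSeries.subst τ (PowerSeries.X ^ b * v) =
      PowerSeries.X ^ b * (w ^ b * PowerSeries.subst τ v) := by
    rw [PowerSeries.subst_mul hs, PowerSeries.subst_pow hs, PowerSeries.subst_X hs]
    nth_rw 1 [hτ]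
    ring
  rw [h3] at h2
  refine hasXOrder_of_X_pow ha hb ?_ h2.prim h2.eval hS.2
  rw [map_mul, map_pow]
  refine mul_ne_zero (pow_ne_zero _ hw) ?_
  have : PowerSeries.constantCoeff (PowerSeries.subst τ v) = PowerSeries.constantCoeff v := by
    have h5 : v = (v - PowerSeries.C (PowerSeries.constantCoeff v)) +
      PowerSeries.C (PowerSeries.constantCoeff v) := by ring
    rw [h5, PowerSeries.subst_add hs, map_add]
    have h6 : PowerSeries.constantCoeff (PowerSeries.subst τ
        (v - PowerSeries.C (PowerSeries.constantCoeff v))) = 0 :=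
      PowerSeries.constantCoeff_subst_eq_zero hτ0 _ (by simp)
    rw [h6, PowerSeries.subst_C]
    simp
    rfl
  rwa [this]

theorem HasParam.hasYOrder {S : Germ} {φ ψ : PowerSeries ℂ} {a b : ℕ} (ha : 0 < a) (hb : 0 < b)
    (hφ : HasOrd φ a) (hψ : HasOrd ψ b) (h : HasParam S φ ψ) (hS : HasXOrder S b) :
    HasYOrder S a := by
  rw [← hasXOrder_swapXY]
  exact (h.swap (hφ.constantCoeff ha) (hψ.constantCoeff hb)).hasXOrder hb ha hψ hφ
    (hasYOrder_swapXY.2 hS)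

/-- The strict transform at the tangent direction `γ`. -/
theorem HasParam.exists_pullback_some {S : Germ} {φ ψ' : PowerSeries ℂ} {a : ℕ} {γ : ℂ}
    (ha : 0 < a) (hφ : HasOrd φ a) (hψ' : PowerSeries.constantCoeff ψ' = 0)
    (h : HasParam S φ (φ * (PowerSeries.C γ + ψ'))) (hS : HasYOrder S a) :
    ∃ G : Germ, pullback (OnePoint.some γ) S = X 0 ^ a * G ∧ HasYOrder G a ∧
      HasParam G φ ψ' := by
  have hφ0 := hφ.constantCoeff ha
  obtain ⟨τ, w, hτ, hw, h1, h2⟩ := h.exists_normalized ha hφ (by simp [hφ0])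
  have hτ0 : PowerSeries.constantCoeff τ = 0 := by simp [hτ]
  have hs := PowerSeries.HasSubst.of_constantCoeff_zero hτ0
  have h3 : PowerSeries.subst τ (φ * (PowerSeries.C γ + ψ')) =
      PowerSeries.X ^ a * (PowerSeries.C γ + PowerSeries.subst τ ψ') := by
    rw [PowerSeries.subst_mul hs, PowerSeries.subst_add hs, h1, PowerSeries.subst_C]
    rfl
  rw [h3] at h2
  obtain ⟨G, hG, hG'⟩ := exists_pullback_eq_of_X_pow ha
    (PowerSeries.constantCoeff_subst_eq_zero hτ0 _ hψ') h2.prim h2.eval hS.2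
  refine ⟨G, hG, hG', ?_, ?_⟩
  · have h4 : evalAt φ ψ' (pullback (OnePoint.some γ) S) = 0 := by
      rw [evalAt, subst_pullback_some hφ0 hψ', add_comm ψ']
      exact h.eval
    rw [hG, evalAt_mul hφ0 hψ', evalAt_pow hφ0 hψ', evalAt_X0 hφ0 hψ'] at h4
    exact (mul_eq_zero.1 h4).resolve_left (pow_ne_zero _ hφ.ne_zero)
  · intro σ hσ h5 h6
    have hs' := PowerSeries.HasSubst.of_constantCoeff_zero hσ
    refine h.prim σ hσ h5 ?_
    rw [PowerSeries.subst_mul hs', PowerSeries.subst_add hs', h5, h6, PowerSeries.subst_C]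
    rfl

/-- The strict transform at the direction `∞`, when it is tangent. -/
theorem HasParam.exists_pullback_infty {S : Germ} {φ' ψ : PowerSeries ℂ} {b : ℕ}
    (hb : 0 < b) (hψ : HasOrd ψ b) (hφ' : PowerSeries.constantCoeff φ' = 0)
    (h : HasParam S (ψ * φ') ψ) (hS : HasXOrder S b) :
    ∃ G : Germ, pullback OnePoint.infty S = X 1 ^ b * G ∧ HasXOrder G b ∧
      HasParam G φ' ψ := by
  have hψ0 := hψ.constantCoeff hb
  have h1 := h.swap (by simp [hψ0]) hψ0
  obtain ⟨G, hG, hG', hG''⟩ := HasParam.exists_pullback_some (γ := 0) hb hψ hφ'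
    (by rwa [map_zero, zero_add]) (hasYOrder_swapXY.2 hS)
  refine ⟨swapXY G, ?_, hasXOrder_swapXY.2 hG', hG''.swap hψ0 hφ'⟩
  rw [pullback_infty_eq, hG, swapXY_mul, swapXY_pow, swapXY_X0]

/-- When the direction `∞` is tangent, the strict transform avoids all other points of the
exceptional curve. -/
theorem exists_pullback_eq_of_ne_infty {S G : Germ} {b : ℕ}
    (hS : pullback OnePoint.infty S = X 1 ^ b * G) (hG : HasXOrder G b) (d : Direction)
    (hd : d ≠ OnePoint.infty) :
    ∃ U : Germ, constantCoeff U ≠ 0 ∧ pullback d S = X (excIndex d) ^ b * U := by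
  induction d using OnePoint.rec with
  | infty => exact absurd rfl hd
  | coe c =>
    have h0 : pullback (OnePoint.some (0 : ℂ)) (swapXY S) = X 0 ^ b * swapXY G := by
      have := congrArg swapXY hS
      rwa [pullback_infty_eq, swapXY_swapXY, swapXY_mul, swapXY_pow, swapXY_X1] at this
    obtain ⟨h1, h2⟩ := formPoly_of_pullback h0 (by simpa using hG.1)
    rw [map_zero, sub_zero] at h2
    have h3 : ∀ n < b, ∀ k ≤ n, cf S (n - k) k = 0 := by
      intro n hn k hk
      have := coeff_formPoly (swapXY S) n (n - k)
      rw [h1 n hn, if_pos (by omega), cf_swapXY, show n - (n - k) = k by omega] at this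
      simpa using this.symm
    have h4 : ∀ k ≤ b, cf S (b - k) k = if k = 0 then cf G b 0 else 0 := by
      intro k hk
      have := coeff_formPoly (swapXY S) b (b - k)
      rw [h2, if_pos (by omega), show b - (b - k) = k by omega] at this
      simp only [cf_swapXY] at this
      rw [← this, Polynomial.coeff_C_mul, Polynomial.coeff_X_pow]
      split_ifs <;> first | omega | simp
    obtain ⟨U, hU, hU'⟩ := exists_eq_X0_pow_mul (k := b) (F := pullback (OnePoint.some c) S) (by
      intro i j hj
      rw [cf_pullback_some]
      refine Finset.sum_eq_zero fun k hk => ?_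
      rw [h3 i hj k (by have := Finset.mem_range.1 hk; omega), zero_mul])
    refine ⟨U, ?_, hU⟩
    rw [constantCoeff_eq_cf, hU', cf_pullback_some, zero_add, Finset.sum_eq_single 0]
    · rw [h4 0 (by omega)]
      simpa using hG.2
    · intro k hk hk0
      rw [h4 k (by have := Finset.mem_range.1 hk; omega), if_neg hk0, zero_mul]
    · intro h; simp at h

/-! ### Points at which the total transform has no normal crossings -/

theorem X0_dvd_iff (F : Germ) : X 0 ∣ F ↔ evalAt 0 PowerSeries.X F = 0 := by
  constructor
  · rintro ⟨G, rfl⟩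
    rw [evalAt_mul (by simp) (by simp), evalAt_X0 (by simp) (by simp), zero_mul]
  · intro h
    obtain ⟨G, hG, -⟩ := exists_eq_X0_pow_mul (k := 1) (F := F) (by
      intro i j hi
      obtain rfl : i = 0 := by omega
      rw [← coeff_evalAt_zero_X, h, map_zero])
    exact ⟨G, by rw [hG, pow_one]⟩

theorem X0_dvd_mul {F G : Germ} (h : X 0 ∣ F * G) : X 0 ∣ F ∨ X 0 ∣ G := by
  rw [X0_dvd_iff, evalAt_mul (by simp) (by simp)] at h
  rw [X0_dvd_iff, X0_dvd_iff]
  exact mul_eq_zero.1 h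

theorem X1_dvd_iff (F : Germ) : X 1 ∣ F ↔ X 0 ∣ swapXY F := by
  constructor
  · rintro ⟨G, rfl⟩; exact ⟨swapXY G, by rw [swapXY_mul, swapXY_X1]⟩
  · rintro ⟨G, hG⟩
    exact ⟨swapXY G, by rw [← swapXY_X0, ← swapXY_mul, ← hG, swapXY_swapXY]⟩

theorem X_prime (i : Fin 2) : Prime (X i : Germ) := by
  refine ⟨X_ne_zero' i, ?_, ?_⟩
  · intro h
    simpa using h.map (constantCoeff (σ := Fin 2) (R := ℂ))
  · intro F G h
    fin_cases i
    · exact X0_dvd_mul h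
    · change X 1 ∣ F * G at h
      change X 1 ∣ F ∨ X 1 ∣ G
      rw [X1_dvd_iff, swapXY_mul] at h
      rw [X1_dvd_iff, X1_dvd_iff]
      exact X0_dvd_mul h

theorem X_pow_mul_cancel {i : Fin 2} {A p : ℕ} {R R' : Germ} (h : X i ^ A * R = X i ^ p * R')
    (hR : ¬ X i ∣ R) (hR' : ¬ X i ∣ R') : A = p ∧ R = R' := by
  have h0 := X_ne_zero' i
  rcases lt_trichotomy A p with hlt | rfl | hlt
  · exfalso
    obtain ⟨k, rfl⟩ := Nat.exists_eq_add_of_lt hlt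
    rw [show A + k + 1 = A + (k + 1) by omega, pow_add, mul_assoc] at h
    exact hR ⟨X i ^ k * R', by rw [mul_left_cancel₀ (pow_ne_zero _ h0) h, pow_succ']; ring⟩
  · exact ⟨rfl, mul_left_cancel₀ (pow_ne_zero _ h0) h⟩
  · exfalso
    obtain ⟨k, rfl⟩ := Nat.exists_eq_add_of_lt hlt
    rw [show p + k + 1 = p + (k + 1) by omega, pow_add, mul_assoc] at h
    exact hR' ⟨X i ^ k * R, by rw [← mul_left_cancel₀ (pow_ne_zero _ h0) h, pow_succ']; ring⟩

theorem cf_mul_one_zero (F G : Germ) :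
    cf (F * G) 1 0 = cf F 0 0 * cf G 1 0 + cf F 1 0 * cf G 0 0 := by
  simp only [← coeff_evalAt_X_zero]
  rw [evalAt_mul (by simp) (by simp), PowerSeries.coeff_mul]
  simp [Finset.Nat.antidiagonal_succ]

theorem cf_mul_zero_one (F G : Germ) :
    cf (F * G) 0 1 = cf F 0 0 * cf G 0 1 + cf F 0 1 * cf G 0 0 := by
  have := cf_mul_one_zero (swapXY F) (swapXY G)
  rwa [← swapXY_mul, cf_swapXY, cf_swapXY, cf_swapXY, cf_swapXY, cf_swapXY] at this

theorem isLocalParameters_iff (u v : Germ) : IsLocalParameters u v ↔ cf u 0 0 = 0 ∧ cf v 0 0 = 0 ∧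
    cf u 1 0 * cf v 0 1 - cf u 0 1 * cf v 1 0 ≠ 0 := by
  rw [IsLocalParameters, coeff_single_zero, coeff_single_zero, coeff_single_one, coeff_single_one,
    constantCoeff_eq_cf, constantCoeff_eq_cf]

theorem IsLocalParameters.symm {u v : Germ} (h : IsLocalParameters u v) :
    IsLocalParameters v u := by
  rw [isLocalParameters_iff] at h ⊢
  refine ⟨h.2.1, h.1, fun h' => h.2.2 ?_⟩
  linear_combination -h'

theorem isSingular_iff (S : Germ) :
    IsSingular S ↔ cf S 0 0 = 0 ∧ cf S 1 0 = 0 ∧ cf S 0 1 = 0 := by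
  rw [IsSingular, Fin.forall_fin_two, coeff_single_zero, coeff_single_one, constantCoeff_eq_cf]

theorem isSingular_swapXY {S : Germ} : IsSingular (swapXY S) ↔ IsSingular S := by
  simp only [isSingular_iff, cf_swapXY]
  tauto

theorem isSingular_mul {F G : Germ} (hF : constantCoeff F = 0) (hG : constantCoeff G = 0) :
    IsSingular (F * G) := by
  rw [constantCoeff_eq_cf] at hF hG
  rw [isSingular_iff, cf_mul_one_zero, cf_mul_zero_one, hF, hG, ← constantCoeff_eq_cf, map_mul,
    constantCoeff_eq_cf, hF]
  simp

theorem hasNormalCrossings_swapXY {T : Germ} (h : HasNormalCrossings T) :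
    HasNormalCrossings (swapXY T) := by
  obtain ⟨u, v, w, a, b, huv, hw, rfl⟩ := h
  refine ⟨swapXY v, swapXY u, swapXY w, b, a, ?_, by rwa [constantCoeff_swapXY], ?_⟩
  · rw [isLocalParameters_iff] at huv ⊢
    simp only [cf_swapXY]
    refine ⟨huv.2.1, huv.1, fun h' => huv.2.2 ?_⟩
    linear_combination h'
  · rw [swapXY_mul, swapXY_mul, swapXY_pow, swapXY_pow]; ring

theorem isBad_swapXY {T S : Germ} (h : IsBad T S) : IsBad (swapXY T) (swapXY S) := by
  rcases h with h | h
  · exact Or.inl (isSingular_swapXY.2 h)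
  · refine Or.inr fun h' => h ?_
    simpa using hasNormalCrossings_swapXY h'

/-- If `x = 0` is part of a curve with normal crossings, then the rest of the curve is a multiple of
a smooth curve transversal to `x = 0` (or empty). -/
theorem exists_eq_of_hasNormalCrossings {w R : Germ} {A : ℕ} (hA : 0 < A)
    (hw : constantCoeff w ≠ 0) (hR : ¬ X 0 ∣ R) (h : HasNormalCrossings (w * X 0 ^ A * R)) :
    ∃ U v : Germ, ∃ q : ℕ, constantCoeff U ≠ 0 ∧ IsLocalParameters (X 0) v ∧
      w * R = U * v ^ q := by
  obtain ⟨u, v, w', p, q, huv, hw', h⟩ := h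
  -- one of the two local parameters is a multiple of `x`
  have main : ∀ (u v : Germ) (p q : ℕ), IsLocalParameters u v → X 0 ∣ u →
      w * X 0 ^ A * R = w' * u ^ p * v ^ q → ∃ U v : Germ, ∃ q : ℕ, constantCoeff U ≠ 0 ∧
      IsLocalParameters (X 0) v ∧ w * R = U * v ^ q := by
    rintro u v p q huv ⟨e, rfl⟩ h
    rw [isLocalParameters_iff, cf_mul_one_zero, cf_mul_zero_one] at huv
    have hx : ∀ i j, cf (X 0 : Germ) i j = if i = 1 ∧ j = 0 then 1 else 0 := by
      intro i j; simpa using cf_X0_pow_X1_pow 1 0 i j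
    have h1 : cf e 0 0 ≠ 0 ∧ cf v 0 1 ≠ 0 := by
      have := huv.2.2
      simp only [hx] at this
      constructor <;> intro h0 <;> simp [h0] at this
    have hv : ¬ X 0 ∣ v := not_X0_dvd h1.2
    have he : ¬ X 0 ∣ e :=
      not_X_dvd_of_constantCoeff_ne_zero 0 (by rw [constantCoeff_eq_cf]; exact h1.1)
    have hX := X_prime 0
    have h2 : X 0 ^ A * (w * R) = X 0 ^ p * (w' * e ^ p * v ^ q) := by
      rw [mul_pow] at h; linear_combination h
    obtain ⟨-, h3⟩ := X_pow_mul_cancel h2 (fun h4 => (hX.dvd_or_dvd h4).elim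
        (not_X_dvd_of_constantCoeff_ne_zero 0 hw) hR) (fun h4 => by
      rcases hX.dvd_or_dvd h4 with h4 | h4
      · rcases hX.dvd_or_dvd h4 with h4 | h4
        · exact not_X_dvd_of_constantCoeff_ne_zero 0 hw' h4
        · exact he (hX.dvd_of_dvd_pow h4)
      · exact hv (hX.dvd_of_dvd_pow h4))
    refine ⟨w' * e ^ p, v, q, ?_, ?_, h3⟩
    · rw [map_mul, map_pow, constantCoeff_eq_cf e]
      exact mul_ne_zero hw' (pow_ne_zero _ h1.1)
    · rw [isLocalParameters_iff]
      simp only [hx]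
      exact ⟨by simp, huv.2.1, by simpa using h1.2⟩
  have hd : X 0 ∣ w' * u ^ p * v ^ q := by
    rw [← h]
    exact Dvd.dvd.mul_right (Dvd.dvd.mul_left (dvd_pow_self _ hA.ne') _) _
  have hX := X_prime 0
  rcases hX.dvd_or_dvd hd with hd | hd
  · rcases hX.dvd_or_dvd hd with hd | hd
    · exact absurd hd (not_X_dvd_of_constantCoeff_ne_zero 0 hw')
    · exact main u v p q huv (hX.dvd_of_dvd_pow hd) h
  · exact main v u q p huv.symm (hX.dvd_of_dvd_pow hd) (by rw [h]; ring)

theorem HasYOrder.not_X0_dvd {S : Germ} {a : ℕ} (h : HasYOrder S a) : ¬ X 0 ∣ S :=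
  PlaneBranch.not_X0_dvd h.2

theorem HasXOrder.not_X1_dvd {S : Germ} {b : ℕ} (h : HasXOrder S b) : ¬ X 1 ∣ S :=
  PlaneBranch.not_X1_dvd h.2

/-- A branch which is singular or tangent to the exceptional curve `x = 0`. -/
theorem isBad_of_two_le {T S w : Germ} {A a : ℕ} (hA : 0 < A) (hw : constantCoeff w ≠ 0)
    (hT : T = w * X 0 ^ A * S) (ha : 2 ≤ a) (hS : HasYOrder S a) : IsBad T S := by
  by_contra hbad
  rw [IsBad, not_or, not_not, hT] at hbad
  obtain ⟨U, v, q, hU, hv, h⟩ := exists_eq_of_hasNormalCrossings hA hw hS.not_X0_dvd hbad.2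
  have h00 : cf S 0 0 = 0 := hS.1 0 (by omega)
  have h01 : cf S 0 1 = 0 := hS.1 1 (by omega)
  rw [isLocalParameters_iff] at hv
  have hw0 : cf w 0 0 ≠ 0 := by rwa [← constantCoeff_eq_cf]
  have hU0 : cf U 0 0 ≠ 0 := by rwa [← constantCoeff_eq_cf]
  -- `w * S = U * v ^ q` passes through the point, so `q > 0`; for `q = 1` it would be transversal
  -- to `x = 0`, and for `q > 1` singular
  rcases q with _ | _ | q
  · have := congrArg constantCoeff h
    rw [map_mul, constantCoeff_eq_cf S, h00] at this
    simp at this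
    exact hU this.symm
  · have := congrArg (fun F => cf F 0 1) h
    simp only [zero_add, pow_one] at this
    rw [cf_mul_zero_one, cf_mul_zero_one, h00, h01, hv.2.1] at this
    simp [hU0] at this
    apply hv.2.2
    have hx : cf (X 0 : Germ) 0 1 = 0 := by simpa using cf_X0_pow_X1_pow 1 0 0 1
    rw [this, hx]; ring
  · have hsing : IsSingular (w * S) := by
      rw [h, pow_succ, ← mul_assoc]
      have h0 : constantCoeff v = 0 := by rw [constantCoeff_eq_cf]; exact hv.2.1
      exact isSingular_mul (by simp [h0]) h0
    rw [isSingular_iff, cf_mul_one_zero, cf_mul_zero_one, h00] at hsing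
    apply hbad.1
    rw [isSingular_iff]
    exact ⟨h00, by simpa [hw0] using hsing.2.1, h01⟩

theorem isBad_of_two_le' {T S w : Germ} {B b : ℕ} (hB : 0 < B) (hw : constantCoeff w ≠ 0)
    (hT : T = w * X 1 ^ B * S) (hb : 2 ≤ b) (hS : HasXOrder S b) : IsBad T S := by
  have h : IsBad (swapXY T) (swapXY S) :=
    isBad_of_two_le (w := swapXY w) hB (by rwa [constantCoeff_swapXY])
    (by rw [hT, swapXY_mul, swapXY_mul, swapXY_pow, swapXY_X1]) hb (hasYOrder_swapXY.2 hS)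
  simpa using isBad_swapXY h

/-- A branch through an intersection point of two exceptional curves. -/
theorem isBad_of_axes {T S w : Germ} {A B a b : ℕ} (hA : 0 < A) (hB : 0 < B)
    (hw : constantCoeff w ≠ 0) (hT : T = w * X 0 ^ A * X 1 ^ B * S) (ha : 0 < a)
    (hSa : HasYOrder S a) (hSb : HasXOrder S b) : IsBad T S := by
  right
  rw [hT, mul_assoc]
  intro hnc
  have hX0 : ¬ X 0 ∣ (X 1 ^ B * S : Germ) := by
    intro h
    rcases (X_prime 0).dvd_or_dvd h with h | h
    · have h' := (X_prime 0).dvd_of_dvd_pow h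
      exact not_X0_dvd (j := 1) (by
        have := cf_X0_pow_X1_pow 0 1 0 1
        simp only [pow_zero, one_mul, pow_one] at this
        rw [this]; simp) h'
    · exact hSa.not_X0_dvd h
  obtain ⟨U, v, q, hU, hv, h⟩ := exists_eq_of_hasNormalCrossings hA hw hX0 hnc
  have hX := X_prime 1
  have hd : X 1 ∣ U * v ^ q := by
    rw [← h]; exact Dvd.dvd.mul_left (Dvd.dvd.mul_right (dvd_pow_self _ hB.ne') _) _
  -- `v` is a unit times `y`, so `S` would not pass through the point
  obtain ⟨e, rfl⟩ := hX.dvd_of_dvd_pow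
    ((hX.dvd_or_dvd hd).resolve_left (not_X_dvd_of_constantCoeff_ne_zero 1 hU))
  rw [isLocalParameters_iff, cf_mul_one_zero, cf_mul_zero_one] at hv
  have he : constantCoeff e ≠ 0 := by
    rw [constantCoeff_eq_cf]
    intro h0
    apply hv.2.2
    have hx : ∀ i j, cf (X 1 : Germ) i j = if i = 0 ∧ j = 1 then 1 else 0 := by
      intro i j; simpa using cf_X0_pow_X1_pow 0 1 i j
    simp [h0, hx]
  have h2 : X 1 ^ B * (w * S) = X 1 ^ q * (U * e ^ q) := by
    rw [mul_pow] at h; linear_combination h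
  obtain ⟨-, h3⟩ := X_pow_mul_cancel h2 (fun h4 => (hX.dvd_or_dvd h4).elim
        (not_X_dvd_of_constantCoeff_ne_zero 1 hw) hSb.not_X1_dvd)
    (not_X_dvd_of_constantCoeff_ne_zero 1 (by simp [hU, he]))
  have h4 := congrArg constantCoeff h3
  rw [map_mul, constantCoeff_eq_cf S, hSa.1 0 ha, mul_zero] at h4
  simp only [map_mul, map_pow] at h4
  exact mul_ne_zero hU (pow_ne_zero q he) h4.symm

theorem isSingular_of_two_le {S : Germ} {a b : ℕ} (ha : 2 ≤ a) (hb : 2 ≤ b) (hSa : HasYOrder S a)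
    (hSb : HasXOrder S b) : IsSingular S := by
  rw [isSingular_iff]
  exact ⟨hSa.1 0 (by omega), hSb.1 1 (by omega), hSa.1 1 (by omega)⟩

/-! ### Convergent series and the multiplicity of an irreducible germ -/

/-- Cauchy estimates at the radius `r`. -/
def IsBoundedAt (F : Germ) (r M : ℝ) : Prop := ∀ i j, ‖cf F i j‖ * r ^ (i + j) ≤ M

theorem isConvergent_iff (F : Germ) :
    IsConvergent F ↔ ∃ r : ℝ, 0 < r ∧ ∃ M : ℝ, IsBoundedAt F r M := by
  constructor
  · rintro ⟨r, hr, M, h⟩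
    exact ⟨r, hr, M, fun i j => by simpa only [pt_degree, cf] using h (pt i j)⟩
  · rintro ⟨r, hr, M, h⟩
    refine ⟨r, hr, M, fun n => ?_⟩
    have := h (n 0) (n 1)
    rwa [← coeff_eq_cf, ← pt_degree, pt_eta] at this

theorem IsBoundedAt.mono {F : Germ} {r r' M : ℝ} (h : IsBoundedAt F r M) (h0 : 0 ≤ r')
    (hr : r' ≤ r) : IsBoundedAt F r' M := fun i j =>
  (mul_le_mul_of_nonneg_left (pow_le_pow_left₀ h0 hr _) (norm_nonneg _)).trans (h i j)

theorem exists_bound_of_isConvergent {y : PowerSeries ℂ} (h : IsConvergent y) :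
    ∃ r : ℝ, 0 < r ∧ ∃ M : ℝ, ∀ k, ‖PowerSeries.coeff k y‖ * r ^ k ≤ M := by
  obtain ⟨r, hr, M, h⟩ := h
  refine ⟨r, hr, M, fun k => ?_⟩
  have := h (Finsupp.single () k)
  rwa [Finsupp.degree_single] at this

theorem cf_inX0_mul (ρ : PowerSeries ℂ) (F : Germ) (i j : ℕ) :
    cf (inX0 ρ * F) i j = ∑ p ∈ Finset.HasAntidiagonal.antidiagonal i,
      PowerSeries.coeff p.1 ρ * cf F p.2 j := by
  classical
  rw [cf, coeff_mul]
  symm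
  refine Finset.sum_of_injOn (fun p => (pt p.1 0, pt p.2 j)) ?_ ?_ ?_ ?_
  · rintro ⟨a, b⟩ - ⟨c, d⟩ - h
    simp only [Prod.mk.injEq, pt_inj] at h
    simp [h.1.1, h.2.1]
  · rintro ⟨a, b⟩ h
    have h' : a + b = i := Finset.HasAntidiagonal.mem_antidiagonal.1 (Finset.mem_coe.1 h)
    simp [pt_add, h']
  · rintro ⟨n, n'⟩ h h'
    rw [Finset.HasAntidiagonal.mem_antidiagonal] at h
    simp only at h
    have h0 := DFunLike.congr_fun h 0
    have h1 := DFunLike.congr_fun h 1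
    simp only [Finsupp.add_apply, pt_zero, pt_one] at h0 h1
    by_cases hn : n 1 = 0
    · exfalso
      apply h'
      refine ⟨(n 0, n' 0), by simpa using h0, ?_⟩
      simp only
      rw [← hn, pt_eta, show j = n' 1 by omega, pt_eta]
    · simp only
      rw [coeff_eq_cf (inX0 ρ), cf_inX0, if_neg hn, zero_mul]
  · rintro ⟨a, b⟩ -
    simp only
    rw [coeff_eq_cf (inX0 ρ), cf_inX0]
    simp [cf]

theorem isBoundedAt_X1_sub_mul {ρ : PowerSeries ℂ} {F : Germ} {r M M' : ℝ} (hr : 0 < r)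
    (hF : IsBoundedAt F r M) (hρ : ∀ k, ‖PowerSeries.coeff k ρ‖ * r ^ k ≤ M') :
    IsBoundedAt ((X 1 - inX0 ρ) * F) (r / 2) (r * M + M' * M) := by
  intro i j
  have hM : 0 ≤ M := (mul_nonneg (norm_nonneg _) (by positivity)).trans (hF 0 0)
  have hM' : 0 ≤ M' := (mul_nonneg (norm_nonneg _) (by positivity)).trans (hρ 0)
  have e : cf ((X 1 - inX0 ρ) * F) i j = cf (X 1 * F) i j - cf (inX0 ρ * F) i j := by
    rw [sub_mul, cf, map_sub, cf, cf]
  have h1 : ‖cf (X 1 * F) i j‖ * (r / 2) ^ (i + j) ≤ r * M := by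
    have := cf_X1_pow_mul 1 F i j
    rw [pow_one] at this
    rw [this]
    split_ifs with hj
    · obtain ⟨j, rfl⟩ : ∃ k, j = k + 1 := ⟨j - 1, by omega⟩
      have h2 := hF i j
      have h3 : (r / 2) ^ (i + (j + 1)) ≤ r * r ^ (i + j) := by
        rw [show r * r ^ (i + j) = r ^ (i + (j + 1)) by ring]
        exact pow_le_pow_left₀ (by positivity) (by linarith) _
      calc _ ≤ ‖cf F i (j + 1 - 1)‖ * (r * r ^ (i + j)) :=
            mul_le_mul_of_nonneg_left h3 (norm_nonneg _)
        _ = r * (‖cf F i j‖ * r ^ (i + j)) := by rw [Nat.add_sub_cancel]; ring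
        _ ≤ r * M := mul_le_mul_of_nonneg_left h2 hr.le
    · simp; positivity
  have h2 : ‖cf (inX0 ρ * F) i j‖ * (r / 2) ^ (i + j) ≤ M' * M := by
    have h3 : ‖cf (inX0 ρ * F) i j‖ * r ^ (i + j) ≤ (i + 1) * (M' * M) := by
      rw [cf_inX0_mul]
      calc _ ≤ (∑ p ∈ Finset.HasAntidiagonal.antidiagonal i,
            ‖PowerSeries.coeff p.1 ρ * cf F p.2 j‖) * r ^ (i + j) := mul_le_mul_of_nonneg_right (norm_sum_le _ _) (by positivity)
        _ = ∑ p ∈ Finset.HasAntidiagonal.antidiagonal i, (‖PowerSeries.coeff p.1 ρ‖ * r ^ p.1) *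
            (‖cf F p.2 j‖ * r ^ (p.2 + j)) := by
          rw [Finset.sum_mul]
          refine Finset.sum_congr rfl fun p hp => ?_
          rw [← Finset.HasAntidiagonal.mem_antidiagonal.1 hp, norm_mul]; ring
        _ ≤ ∑ p ∈ Finset.HasAntidiagonal.antidiagonal i, M' * M := Finset.sum_le_sum fun p _ =>
            mul_le_mul (hρ _) (hF _ _) (by positivity) hM'
        _ = _ := by rw [Finset.sum_const, Finset.Nat.card_antidiagonal]; simp
    have h4 : ((i : ℝ) + 1) ≤ 2 ^ (i + j) := by
      have h5 : i + 1 ≤ 2 ^ i := Nat.lt_two_pow_self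
      calc ((i : ℝ) + 1) ≤ 2 ^ i := by exact_mod_cast h5
        _ ≤ 2 ^ (i + j) := pow_le_pow_right₀ (by norm_num) (by omega)
    rw [div_pow, ← mul_div_assoc, div_le_iff₀ (by positivity)]
    calc _ ≤ (i + 1) * (M' * M) := h3
      _ ≤ 2 ^ (i + j) * (M' * M) := mul_le_mul_of_nonneg_right h4 (by positivity)
      _ = _ := by ring
  calc _ ≤ (‖cf (X 1 * F) i j‖ + ‖cf (inX0 ρ * F) i j‖) * (r / 2) ^ (i + j) := by
        rw [e]; exact mul_le_mul_of_nonneg_right (norm_sub_le _ _) (by positivity)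
    _ ≤ _ := by rw [add_mul]; exact add_le_add h1 h2

/-- The quotient of a convergent series by `y - ρ (x)` is convergent: the coefficients of the
quotient are determined recursively, and the estimates are preserved on a small bidisc. -/
theorem isBoundedAt_of_X1_sub_mul {ρ : PowerSeries ℂ} (hρ0 : PowerSeries.constantCoeff ρ = 0)
    {Q : Germ} {r M M' : ℝ} (hr : 0 < r)
    (hG : IsBoundedAt ((X 1 - inX0 ρ) * Q) r M) (hρ : ∀ k, ‖PowerSeries.coeff k ρ‖ * r ^ k ≤ M') :
    ∃ r' : ℝ, 0 < r' ∧ ∃ K : ℝ, IsBoundedAt Q r' K := by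
  have hM : 0 ≤ M := (mul_nonneg (norm_nonneg _) (by positivity)).trans (hG 0 0)
  have hM' : 0 ≤ M' := (mul_nonneg (norm_nonneg _) (by positivity)).trans (hρ 0)
  -- `ε` is so small that the sum of the recursion is at most one half of the bound `K`
  obtain ⟨ε, hε0, hε1, hε2⟩ : ∃ ε : ℝ, 0 < ε ∧ ε ≤ 1 / 2 ∧ 4 * M' * ε ≤ r := by
    refine ⟨min (1 / 2) (r / (4 * M' + 1)), by positivity, min_le_left _ _, ?_⟩
    calc 4 * M' * min (1 / 2) (r / (4 * M' + 1)) ≤ 4 * M' * (r / (4 * M' + 1)) :=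
          mul_le_mul_of_nonneg_left (min_le_right _ _) (by positivity)
      _ = r * (4 * M' / (4 * M' + 1)) := by ring
      _ ≤ r * 1 := mul_le_mul_of_nonneg_left
          ((div_le_one (by positivity)).2 (by linarith)) hr.le
      _ = r := mul_one r
  set K : ℝ := 2 * M / r with hK
  have hK0 : 0 ≤ K := by positivity
  have hrec : ∀ i j, cf Q i j = cf ((X 1 - inX0 ρ) * Q) i (j + 1) +
      ∑ p ∈ Finset.range i, PowerSeries.coeff (p + 1) ρ * cf Q (i - (p + 1)) (j + 1) := by
    intro i j
    have e : cf ((X 1 - inX0 ρ) * Q) i (j + 1) =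
        cf (X 1 ^ 1 * Q) i (j + 1) - cf (inX0 ρ * Q) i (j + 1) := by
      rw [sub_mul, cf, map_sub, cf, cf, pow_one]
    rw [e, cf_X1_pow_mul, cf_inX0_mul, Finset.Nat.sum_antidiagonal_eq_sum_range_succ_mk,
      Finset.sum_range_succ']
    simp [hρ0]
  have main : ∀ i j, ‖cf Q i j‖ * ((ε * r) ^ i * r ^ j) ≤ K := by
    intro i
    induction i using Nat.strong_induction_on with
    | _ i ih =>
      intro j
      have h1 : ‖cf ((X 1 - inX0 ρ) * Q) i (j + 1)‖ * ((ε * r) ^ i * r ^ j) ≤ M / r := by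
        rw [le_div_iff₀ hr]
        calc _ = ‖cf ((X 1 - inX0 ρ) * Q) i (j + 1)‖ * (r ^ (i + (j + 1))) * ε ^ i := by
              rw [mul_pow]; ring
          _ ≤ M * 1 := mul_le_mul (hG _ _) (pow_le_one₀ hε0.le (by linarith)) (by positivity) hM
          _ = M := mul_one M
      have h2 : ∀ p ∈ Finset.range i, ‖PowerSeries.coeff (p + 1) ρ * cf Q (i - (p + 1)) (j + 1)‖ *
          ((ε * r) ^ i * r ^ j) ≤ (M' * ε * K / r) * (1 / 2) ^ p := by
        intro p hp
        have hp' := Finset.mem_range.1 hp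
        have h3 := ih (i - (p + 1)) (by omega) (j + 1)
        have h4 : (ε * r) ^ i = (ε * r) ^ (p + 1) * (ε * r) ^ (i - (p + 1)) := by
          rw [← pow_add]; congr 1; omega
        rw [norm_mul, h4]
        have h5 : ‖PowerSeries.coeff (p + 1) ρ‖ * (ε * r) ^ (p + 1) ≤ M' * (ε * (1 / 2) ^ p) := by
          calc _ = (‖PowerSeries.coeff (p + 1) ρ‖ * r ^ (p + 1)) * (ε * ε ^ p) := by
                rw [mul_pow]; ring
            _ ≤ _ := mul_le_mul (hρ _) (mul_le_mul_of_nonneg_left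
                (pow_le_pow_left₀ hε0.le hε1 _) hε0.le) (by positivity) hM'
        calc _ = (‖PowerSeries.coeff (p + 1) ρ‖ * (ε * r) ^ (p + 1)) *
              (‖cf Q (i - (p + 1)) (j + 1)‖ * ((ε * r) ^ (i - (p + 1)) * r ^ (j + 1))) / r := by
                field_simp; ring
          _ ≤ (M' * (ε * (1 / 2) ^ p)) * K / r := by
                gcongr
          _ = _ := by ring
      have h6 : ∑ p ∈ Finset.range i, (M' * ε * K / r) * (1 / 2 : ℝ) ^ p ≤ K / 2 := by
        rw [← Finset.mul_sum]
        calc _ ≤ (M' * ε * K / r) * 2 :=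
              mul_le_mul_of_nonneg_left (sum_geometric_two_le i) (by positivity)
          _ = (4 * M' * ε) * (K / (2 * r)) := by ring
          _ ≤ r * (K / (2 * r)) := mul_le_mul_of_nonneg_right hε2 (by positivity)
          _ = K / 2 := by field_simp
      calc ‖cf Q i j‖ * ((ε * r) ^ i * r ^ j)
          ≤ (‖cf ((X 1 - inX0 ρ) * Q) i (j + 1)‖ + ∑ p ∈ Finset.range i,
            ‖PowerSeries.coeff (p + 1) ρ * cf Q (i - (p + 1)) (j + 1)‖) *
            ((ε * r) ^ i * r ^ j) := by
            rw [hrec i j]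
            exact mul_le_mul_of_nonneg_right ((norm_add_le _ _).trans
              (add_le_add le_rfl (norm_sum_le _ _))) (by positivity)
        _ ≤ M / r + K / 2 := by
            rw [add_mul, Finset.sum_mul]
            exact add_le_add h1 ((Finset.sum_le_sum h2).trans h6)
        _ = K := by rw [hK]; ring
  refine ⟨ε * r, by positivity, K, fun i j => ?_⟩
  rw [pow_add]
  refine le_trans (mul_le_mul_of_nonneg_left (mul_le_mul_of_nonneg_left ?_ (by positivity))
    (norm_nonneg _)) (main i j)
  exact pow_le_pow_left₀ (by positivity) (by nlinarith) _

theorem isConvergent_X1_sub_mul {ρ : PowerSeries ℂ} {F : Germ} (hρ : IsConvergent ρ)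
    (hF : IsConvergent F) : IsConvergent ((X 1 - inX0 ρ) * F) := by
  obtain ⟨r, hr, M, h⟩ := (isConvergent_iff F).1 hF
  obtain ⟨r', hr', M', h'⟩ := exists_bound_of_isConvergent hρ
  have h0 : 0 < min r r' := lt_min hr hr'
  exact (isConvergent_iff _).2 ⟨_, half_pos h0, _, isBoundedAt_X1_sub_mul h0
    (h.mono h0.le (min_le_left _ _)) (fun k => (mul_le_mul_of_nonneg_left
      (pow_le_pow_left₀ h0.le (min_le_right _ _) _) (norm_nonneg _)).trans (h' k))⟩

theorem isConvergent_of_X1_sub_mul {ρ : PowerSeries ℂ} (hρ0 : PowerSeries.constantCoeff ρ = 0)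
    {Q : Germ} (hρ : IsConvergent ρ) (hQ : IsConvergent ((X 1 - inX0 ρ) * Q)) :
    IsConvergent Q := by
  obtain ⟨r, hr, M, h⟩ := (isConvergent_iff _).1 hQ
  obtain ⟨r', hr', M', h'⟩ := exists_bound_of_isConvergent hρ
  have h0 : 0 < min r r' := lt_min hr hr'
  exact (isConvergent_iff _).2 (isBoundedAt_of_X1_sub_mul hρ0 h0
    (h.mono h0.le (min_le_left _ _)) (fun k => (mul_le_mul_of_nonneg_left
      (pow_le_pow_left₀ h0.le (min_le_right _ _) _) (norm_nonneg _)).trans (h' k)))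

theorem isConvergent_one : IsConvergent (1 : Germ) := by
  refine (isConvergent_iff _).2 ⟨1, one_pos, 1, fun i j => ?_⟩
  rw [cf_one]
  split_ifs <;> simp

theorem isConvergent_prod {ρ : ℕ → PowerSeries ℂ} (hρ : ∀ k, IsConvergent (ρ k)) (n : ℕ) :
    IsConvergent (∏ k ∈ Finset.range n, (X 1 - inX0 (ρ k))) := by
  induction n with
  | zero => simpa using isConvergent_one
  | succ n ih => rw [Finset.prod_range_succ, mul_comm]; exact isConvergent_X1_sub_mul (hρ n) ih

theorem isConvergent_of_prod_mul {ρ : ℕ → PowerSeries ℂ}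
    (hρ0 : ∀ k, PowerSeries.constantCoeff (ρ k) = 0) (hρ : ∀ k, IsConvergent (ρ k)) (n : ℕ)
    {Q : Germ} (h : IsConvergent ((∏ k ∈ Finset.range n, (X 1 - inX0 (ρ k))) * Q)) :
    IsConvergent Q := by
  induction n with
  | zero => simpa using h
  | succ n ih =>
    rw [Finset.prod_range_succ, mul_comm _ (X 1 - _), mul_assoc] at h
    exact ih (isConvergent_of_X1_sub_mul (hρ0 n) (hρ n) h)

theorem isConvergent_conj {ζ : ℂ} {a : ℕ} (ha : 0 < a) (hζ : IsPrimitiveRoot ζ a)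
    {y : PowerSeries ℂ} (hy : IsConvergent y) (k : ℕ) : IsConvergent (conj ζ y k) := by
  obtain ⟨r, hr, M, h⟩ := exists_bound_of_isConvergent hy
  refine ⟨r, hr, M, fun n => ?_⟩
  obtain ⟨n, rfl⟩ : ∃ m, n = Finsupp.single () m := ⟨n (), by ext; simp⟩
  rw [← coeff_powerSeries, conj, PowerSeries.coeff_rescale, norm_mul, norm_pow, norm_pow,
    hζ.norm'_eq_one ha.ne', Finsupp.degree_single]
  simpa using h n

theorem isConvergent_subst_X0_pow {a : ℕ} (ha : 0 < a) {F : Germ} (hF : IsConvergent F) :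
    IsConvergent (subst (![X 0 ^ a, X 1] : Fin 2 → Germ) F) := by
  obtain ⟨r, hr, M, h⟩ := (isConvergent_iff F).1 hF
  have h0 : 0 < min r 1 := lt_min hr one_pos
  have h' := h.mono h0.le (min_le_left _ _)
  have hM : 0 ≤ M := (mul_nonneg (norm_nonneg _) (by positivity)).trans (h 0 0)
  refine (isConvergent_iff _).2 ⟨min r 1, h0, M, fun i j => ?_⟩
  rw [cf_subst_X0_pow a ha]
  split_ifs with hi
  · refine (mul_le_mul_of_nonneg_left ?_ (norm_nonneg _)).trans (h' (i / a) j)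
    exact pow_le_pow_of_le_one h0.le (min_le_right _ _)
      (Nat.add_le_add_right (Nat.div_le_self _ _) _)
  · simpa using hM

/-- A series in `x ^ a` and `y`, written as a series in `x` and `y`. -/
noncomputable def descend (a : ℕ) (F : Germ) : Germ := germOf fun i j => cf F (a * i) j

theorem cf_descend (a : ℕ) (F : Germ) (i j : ℕ) : cf (descend a F) i j = cf F (a * i) j := by
  simp [descend]

theorem subst_descend {a : ℕ} (ha : 0 < a) {F : Germ} (hF : ∀ i j, ¬ a ∣ i → cf F i j = 0) :
    subst (![X 0 ^ a, X 1] : Fin 2 → Germ) (descend a F) = F := by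
  refine germ_ext fun i j => ?_
  rw [cf_subst_X0_pow a ha, cf_descend]
  split_ifs with h
  · rw [Nat.mul_div_cancel' h]
  · exact (hF i j h).symm

theorem descend_subst {a : ℕ} (ha : 0 < a) (F : Germ) :
    descend a (subst (![X 0 ^ a, X 1] : Fin 2 → Germ) F) = F := by
  refine germ_ext fun i j => ?_
  rw [cf_descend, cf_subst_X0_pow a ha, if_pos (Dvd.intro _ rfl), Nat.mul_div_cancel_left _ ha]

theorem isConvergent_descend {a : ℕ} {F : Germ} (hF : IsConvergent F) :
    IsConvergent (descend (a + 1) F) := by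
  obtain ⟨r, hr, M, h⟩ := (isConvergent_iff F).1 hF
  have h0 : 0 < min r 1 := lt_min hr one_pos
  have h' := h.mono h0.le (min_le_left _ _)
  refine (isConvergent_iff _).2 ⟨min r 1 ^ (a + 1), by positivity, M, fun i j => ?_⟩
  rw [cf_descend, ← pow_mul]
  refine (mul_le_mul_of_nonneg_left ?_ (norm_nonneg _)).trans (h' ((a + 1) * i) j)
  refine pow_le_pow_of_le_one h0.le (min_le_right _ _) ?_
  rw [mul_add]
  exact Nat.add_le_add_left (Nat.le_mul_of_pos_left _ (by omega)) _

/-- The automorphism `x ↦ ζ * x`. -/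
noncomputable def rotate (ζ : ℂ) : Germ →+* Germ := MvPowerSeries.rescale ![ζ, 1]

theorem cf_rotate (ζ : ℂ) (F : Germ) (i j : ℕ) : cf (rotate ζ F) i j = ζ ^ i * cf F i j := by
  rw [cf, rotate, coeff_rescale, Finsupp.prod_fintype _ _ (by simp), Fin.prod_univ_two]
  simp [cf]

theorem rotate_X1_sub (ζ : ℂ) (y : PowerSeries ℂ) (k : ℕ) :
    rotate ζ (X 1 - inX0 (conj ζ y k)) = X 1 - inX0 (conj ζ y (k + 1)) := by
  rw [map_sub]
  congr 1
  · refine germ_ext fun i j => ?_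
    have := cf_X0_pow_X1_pow 0 1 i j
    simp only [pow_zero, one_mul, pow_one] at this
    rw [cf_rotate, this]
    split_ifs with h <;> simp [h]
  · refine germ_ext fun i j => ?_
    rw [cf_rotate, cf_inX0, cf_inX0]
    split_ifs
    · rw [conj, conj, PowerSeries.coeff_rescale, PowerSeries.coeff_rescale]; ring
    · simp

theorem rotate_prod {ζ : ℂ} {a : ℕ} (hζ : ζ ^ a = 1) (y : PowerSeries ℂ) :
    rotate ζ (∏ k ∈ Finset.range a, (X 1 - inX0 (conj ζ y k))) =
      ∏ k ∈ Finset.range a, (X 1 - inX0 (conj ζ y k)) := by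
  rw [map_prod]
  simp only [rotate_X1_sub]
  have h : conj ζ y a = conj ζ y 0 := by rw [conj, conj, hζ, pow_zero]
  obtain _ | a := a
  · simp
  · rw [Finset.prod_range_succ, Finset.prod_range_succ', h]

theorem cf_eq_zero_of_rotate {ζ : ℂ} {a : ℕ} (hζ : IsPrimitiveRoot ζ a) {F : Germ}
    (h : rotate ζ F = F) (i j : ℕ) (hi : ¬ a ∣ i) : cf F i j = 0 := by
  have h1 := cf_rotate ζ F i j
  rw [h] at h1
  have h2 : (ζ ^ i - 1) * cf F i j = 0 := by linear_combination -h1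
  refine (mul_eq_zero.1 h2).resolve_left fun h3 => hi ?_
  exact hζ.dvd_of_pow_eq_one _ (sub_eq_zero.1 h3)

/-- An irreducible convergent germ with the injective parametrization `(t ^ a, y (t))` meets `x = 0`
with multiplicity `a`: the norm of `y - y (t)` divides it, and the quotient is convergent. -/
theorem hasYOrder_of_isUnibranch {f : Germ} (hf : IsUnibranch f) {a : ℕ} (ha : 0 < a)
    {y : PowerSeries ℂ} (hy : IsConvergent y) (hy0 : PowerSeries.constantCoeff y = 0)
    (h : HasParam f (PowerSeries.X ^ a) y) : HasYOrder f a := by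
  have hζ := Complex.isPrimitiveRoot_exp a ha.ne'
  obtain ⟨Q, hQ⟩ := exists_factorization ha hy0 hζ h.prim h.eval
  set ζ := Complex.exp (2 * Real.pi * Complex.I / a)
  set N := ∏ k ∈ Finset.range a, (X 1 - inX0 (conj ζ y k)) with hN
  have hc := constantCoeff_conj (ζ := ζ) hy0
  have hN0 : ∀ j, cf N 0 j = if a ≤ j then cf 1 0 (j - a) else 0 := by
    intro j
    rw [← cf_zero_prod_mul hc, mul_one]
  have hNne : N ≠ 0 := by
    intro h0
    have := hN0 a
    rw [h0, if_pos le_rfl, Nat.sub_self, cf_one] at this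
    simp at this
  -- both factors are invariant under `x ↦ ζ * x`, so they are series in `x ^ a`
  have rN : rotate ζ N = N := rotate_prod hζ.pow_eq_one y
  have rQ : rotate ζ Q = Q := by
    have h1 : rotate ζ (N * Q) = N * Q := by
      rw [← hQ]
      refine germ_ext fun i j => ?_
      rw [cf_rotate, cf_subst_X0_pow a ha]
      split_ifs with hi
      · obtain ⟨k, rfl⟩ := hi
        rw [pow_mul, hζ.pow_eq_one, one_pow, one_mul]
      · simp
    rw [map_mul, rN] at h1
    exact mul_left_cancel₀ hNne h1
  have dN := subst_descend ha (cf_eq_zero_of_rotate hζ rN)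
  have dQ := subst_descend ha (cf_eq_zero_of_rotate hζ rQ)
  have hfac : f = descend a N * descend a Q := by
    have h1 : subst (![X 0 ^ a, X 1] : Fin 2 → Germ) f =
        subst (![X 0 ^ a, X 1] : Fin 2 → Germ) (descend a N * descend a Q) := by
      rw [subst_mul (hasSubst_pair (by simp [ha.ne']) (by simp)), dN, dQ, hQ]
    rw [← descend_subst ha f, h1, descend_subst ha]
  have cN : IsConvergent N := isConvergent_prod (isConvergent_conj ha hζ hy) a
  have cQ : IsConvergent Q := by
    refine isConvergent_of_prod_mul hc (isConvergent_conj ha hζ hy) a ?_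
    rw [← hN, ← hQ]
    exact isConvergent_subst_X0_pow ha hf.1
  obtain ⟨a, rfl⟩ : ∃ k, a = k + 1 := ⟨a - 1, by omega⟩
  -- the norm vanishes at the origin, so the other factor is a unit
  have hunit : cf Q 0 0 ≠ 0 := by
    rcases hf.2.2 _ _ (isConvergent_descend cN) (isConvergent_descend cQ) hfac with h1 | h1
    · exfalso
      rw [constantCoeff_eq_cf, cf_descend, mul_zero, hN0, if_neg (by omega)] at h1
      exact h1 rfl
    · rwa [constantCoeff_eq_cf, cf_descend, mul_zero] at h1
  have hf0 : ∀ j, cf f 0 j = if a + 1 ≤ j then cf Q 0 (j - (a + 1)) else 0 := by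
    intro j
    have h1 := cf_subst_X0_pow (a + 1) ha f 0 j
    rw [if_pos (dvd_zero _), Nat.zero_div] at h1
    rw [← h1, hQ, cf_zero_prod_mul hc]
  refine ⟨fun j hj => ?_, ?_⟩
  · rw [hf0, if_neg (by omega)]
  · rw [hf0, if_pos le_rfl, Nat.sub_self]; exact hunit

theorem isConvergent_swapXY {F : Germ} (h : IsConvergent F) : IsConvergent (swapXY F) := by
  obtain ⟨r, hr, M, h⟩ := (isConvergent_iff F).1 h
  refine (isConvergent_iff _).2 ⟨r, hr, M, fun i j => ?_⟩
  rw [cf_swapXY, add_comm]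
  exact h j i

theorem isUnibranch_swapXY {f : Germ} (h : IsUnibranch f) : IsUnibranch (swapXY f) := by
  refine ⟨isConvergent_swapXY h.1, by rw [constantCoeff_swapXY]; exact h.2.1, ?_⟩
  intro F G hF hG hFG
  have := h.2.2 (swapXY F) (swapXY G) (isConvergent_swapXY hF) (isConvergent_swapXY hG)
    (by rw [← swapXY_mul, ← hFG, swapXY_swapXY])
  rwa [constantCoeff_swapXY, constantCoeff_swapXY] at this

/-! ### The Puiseux characteristic along the blowings up -/

/-- The arithmetic properties of a Puiseux characteristic `(β 0; β 1, …, β g)`. -/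
structure IsCharSeq (g : ℕ) (β : ℕ → ℕ) : Prop where
  pos : 0 < β 0
  not_dvd : ∀ j, 1 ≤ j → j ≤ g → ¬ charGcd β j ∣ β j
  lt : ∀ j < g, β j < β (j + 1)
  last : charGcd β (g + 1) = 1

theorem charGcd_succ_dvd (β : ℕ → ℕ) (j : ℕ) : charGcd β (j + 1) ∣ charGcd β j :=
  Nat.gcd_dvd_left _ _

theorem charGcd_succ_dvd_self (β : ℕ → ℕ) (j : ℕ) : charGcd β (j + 1) ∣ β j :=
  Nat.gcd_dvd_right _ _

theorem charGcd_dvd_of_le (β : ℕ → ℕ) {i j : ℕ} (h : i ≤ j) : charGcd β j ∣ charGcd β i := by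
  induction j, h using Nat.le_induction with
  | base => exact dvd_rfl
  | succ j _ ih => exact (charGcd_succ_dvd β j).trans ih

theorem charGcd_one (β : ℕ → ℕ) : charGcd β 1 = β 0 := by simp [charGcd]

theorem charGcd_pos {β : ℕ → ℕ} (h : 0 < β 0) (j : ℕ) : 0 < charGcd β (j + 1) := by
  have h1 : charGcd β (j + 1) ∣ β 0 := by
    rw [← charGcd_one β]; exact charGcd_dvd_of_le β (by omega)
  exact Nat.pos_of_dvd_of_pos h1 h

theorem IsPuiseuxCharacteristic.isCharSeq {f : Germ} {g : ℕ} {β : ℕ → ℕ}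
    (h : IsPuiseuxCharacteristic f g β) : IsCharSeq g β := by
  obtain ⟨h0, y, -, hy, -, hl, hlast⟩ := h
  refine ⟨h0, fun j h1 h2 => (hl j h1 h2).1.2, fun j hj => ?_, hlast⟩
  have h1 := (hl (j + 1) (by omega) (by omega)).1
  have hne : β j ≠ β (j + 1) := by
    intro h2
    exact h1.2 (by rw [← h2]; exact charGcd_succ_dvd_self β j)
  obtain _ | j := j
  · refine lt_of_le_of_ne ?_ hne
    by_contra h2
    exact h1.1 (hy _ (by omega))
  · refine lt_of_le_of_ne ((hl (j + 1) (by omega) (by omega)).2 ⟨h1.1, fun h2 => ?_⟩) hne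
    exact h1.2 ((charGcd_succ_dvd β _).trans h2)

/-- The exponents smaller than `κ` of `w` are multiples of `e`. -/
def IsLacunary (e κ : ℕ) (w : PowerSeries ℂ) : Prop :=
  ∀ k < κ, ¬ e ∣ k → PowerSeries.coeff k w = 0

theorem IsLacunary.mono {e κ κ' : ℕ} {w : PowerSeries ℂ} (h : IsLacunary e κ w) (hκ : κ' ≤ κ) :
    IsLacunary e κ' w := fun k hk => h k (by omega)

theorem coeff_mul_of_isLacunary {e κ : ℕ} {w z : PowerSeries ℂ} (hw : IsLacunary e κ w)
    (hz : IsLacunary e κ z) (hκ : ¬ e ∣ κ) : PowerSeries.coeff κ (w * z) =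
      PowerSeries.coeff 0 w * PowerSeries.coeff κ z +
        PowerSeries.coeff κ w * PowerSeries.coeff 0 z := by
  have hκ0 : κ ≠ 0 := by rintro rfl; exact hκ (dvd_zero e)
  obtain ⟨κ, rfl⟩ : ∃ k, κ = k + 1 := ⟨κ - 1, by omega⟩
  rw [PowerSeries.coeff_mul, Finset.Nat.sum_antidiagonal_eq_sum_range_succ_mk,
    Finset.sum_range_succ, Finset.sum_range_succ']
  rw [Finset.sum_eq_zero, zero_add]
  · simp
  · intro k hk
    have hk' := Finset.mem_range.1 hk
    simp only
    by_cases h : e ∣ k + 1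
    · rw [hz (κ + 1 - (k + 1)) (by omega), mul_zero]
      intro h'
      apply hκ
      have := dvd_add h h'
      rwa [show k + 1 + (κ + 1 - (k + 1)) = κ + 1 by omega] at this
    · rw [hw (k + 1) (by omega) h, zero_mul]

theorem isLacunary_of_mul {e κ : ℕ} {w z : PowerSeries ℂ} (hw0 : PowerSeries.constantCoeff w ≠ 0)
    (hw : IsLacunary e κ w) (h : IsLacunary e κ (w * z)) : IsLacunary e κ z := by
  intro k
  induction k using Nat.strong_induction_on with
  | _ k ih =>
    intro hk hek
    have h1 := coeff_mul_of_isLacunary (hw.mono hk.le)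
      (fun l hl hel => ih l hl (by omega) hel) hek
    rw [h k hk hek, hw k hk hek, zero_mul, add_zero,
      PowerSeries.coeff_zero_eq_constantCoeff_apply] at h1
    exact (mul_eq_zero.1 h1.symm).resolve_left hw0

/-- The branch `(t ^ d * W, ψ)`, with `W` a unit, at a point at which its Puiseux characteristic is
`(m_{j+1}; β_{j+1} - θ, …, β_g - θ)`, as seen from the lacunarity of `W` and `ψ`. -/
def IsFresh (g : ℕ) (β : ℕ → ℕ) (j θ : ℕ) (W ψ : PowerSeries ℂ) : Prop :=
  ∀ i, j < i → i ≤ g → IsLacunary (charGcd β i) (β i - θ) W ∧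
    IsLacunary (charGcd β i) (β i - θ) ψ ∧ PowerSeries.coeff (β i - θ) ψ ≠ 0

/-- The branch `(t ^ a * W₁, t ^ b * W₂)`, with units `W₁` and `W₂` which are lacunary up to the
orders `β i - θ`, the exponents `β i - θ` occurring in `W₂ ^ a / W₁ ^ b`. Unlike the coefficients of
`W₁` and `W₂`, this series is not affected by a reparametrization. -/
def IsLacunaryPair (g : ℕ) (β : ℕ → ℕ) (j θ a b : ℕ) (W₁ W₂ : PowerSeries ℂ) : Prop :=
  ∀ i, j < i → i ≤ g → IsLacunary (charGcd β i) (β i - θ) W₁ ∧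
    IsLacunary (charGcd β i) (β i - θ) W₂ ∧
    (a : ℂ) * PowerSeries.coeff (β i - θ) W₂ * PowerSeries.coeff 0 W₁ -
      b * PowerSeries.coeff (β i - θ) W₁ * PowerSeries.coeff 0 W₂ ≠ 0

/-- The shift `θ` of the characteristic exponents is admissible at the stage `j`. -/
def IsShift (g : ℕ) (β : ℕ → ℕ) (j θ : ℕ) : Prop :=
  charGcd β (j + 1) ∣ θ ∧ (j < g → θ < β (j + 1))

theorem IsCharSeq.lt_of_lt {g : ℕ} {β : ℕ → ℕ} (hβ : IsCharSeq g β) {i j : ℕ} (hij : i < j)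
    (hj : j ≤ g) : β i < β j := by
  induction j, hij using Nat.le_induction with
  | base => exact hβ.lt i (by omega)
  | succ j _ ih => exact (ih (by omega)).trans (hβ.lt j (by omega))

theorem IsShift.lt {g : ℕ} {β : ℕ → ℕ} (hβ : IsCharSeq g β) {j θ i : ℕ} (h : IsShift g β j θ)
    (hi : j < i) (hig : i ≤ g) : θ < β i := by
  have h1 := h.2 (by omega)
  rcases Nat.eq_or_lt_of_le hi with h2 | h2
  · rwa [← h2]
  · exact h1.trans (hβ.lt_of_lt h2 hig)

theorem IsShift.not_dvd {g : ℕ} {β : ℕ → ℕ} (hβ : IsCharSeq g β) {j θ i : ℕ}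
    (h : IsShift g β j θ) (hi : j < i) (hig : i ≤ g) : ¬ charGcd β i ∣ β i - θ := by
  intro h1
  have h2 : charGcd β i ∣ θ := (charGcd_dvd_of_le β hi).trans h.1
  apply hβ.not_dvd i (by omega) hig
  have := dvd_add h1 h2
  rwa [Nat.sub_add_cancel (h.lt hβ hi hig).le] at this

theorem isShift_self {g : ℕ} {β : ℕ → ℕ} (hβ : IsCharSeq g β) (j : ℕ) : IsShift g β j (β j) :=
  ⟨charGcd_succ_dvd_self β j, hβ.lt j⟩

theorem IsLacunaryPair.swap {g : ℕ} {β : ℕ → ℕ} {j θ a b : ℕ} {W₁ W₂ : PowerSeries ℂ}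
    (h : IsLacunaryPair g β j θ a b W₁ W₂) : IsLacunaryPair g β j θ b a W₂ W₁ := by
  intro i hi hig
  obtain ⟨h1, h2, h3⟩ := h i hi hig
  refine ⟨h2, h1, fun h4 => h3 ?_⟩
  linear_combination -h4

/-- Division of the second component by the first one. -/
theorem IsLacunaryPair.div {g : ℕ} {β : ℕ → ℕ} (hβ : IsCharSeq g β) {j θ a b : ℕ}
    {W₁ Z : PowerSeries ℂ} (hθ : IsShift g β j θ) (hW : PowerSeries.constantCoeff W₁ ≠ 0)
    (h : IsLacunaryPair g β j θ a (b + a) W₁ (W₁ * Z)) : IsLacunaryPair g β j θ a b W₁ Z := by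
  intro i hi hig
  obtain ⟨h1, h2, h3⟩ := h i hi hig
  have hZ := isLacunary_of_mul hW h1 h2
  refine ⟨h1, hZ, fun h4 => h3 ?_⟩
  rw [coeff_mul_of_isLacunary h1 hZ (hθ.not_dvd hβ hi hig), PowerSeries.coeff_mul]
  simp only [Finset.Nat.antidiagonal_zero, Finset.sum_singleton]
  push_cast
  linear_combination PowerSeries.coeff 0 W₁ * h4

/-- The direction of the tangent is transversal to both axes. -/
theorem IsLacunaryPair.isFresh {g : ℕ} {β : ℕ → ℕ} (hβ : IsCharSeq g β) {j θ a : ℕ}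
    {W₁ Z : PowerSeries ℂ} (hθ : IsShift g β j θ) (hW : PowerSeries.constantCoeff W₁ ≠ 0)
    (h : IsLacunaryPair g β j θ a a W₁ (W₁ * Z)) (c : ℂ) :
    IsFresh g β j θ W₁ (Z - PowerSeries.C c) := by
  intro i hi hig
  have h0 : IsLacunaryPair g β j θ a 0 W₁ Z :=
    IsLacunaryPair.div hβ hθ hW (by rwa [zero_add])
  obtain ⟨h1, h2, h3⟩ := h0 i hi hig
  have hC : ∀ k, ¬ charGcd β i ∣ k → PowerSeries.coeff k (PowerSeries.C c) = 0 := by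
    intro k hk
    rw [PowerSeries.coeff_C, if_neg]
    rintro rfl
    exact hk (dvd_zero _)
  refine ⟨h1, fun k hk hek => ?_, fun h4 => h3 ?_⟩
  · rw [map_sub, hC k hek, h2 k hk hek, sub_zero]
  · rw [map_sub, hC _ (hθ.not_dvd hβ hi hig), sub_zero] at h4
    rw [h4]; simp

/-- The second component has the order `b`, either a multiple of `m_{j+1}` or the first
characteristic exponent. -/
theorem IsFresh.exists_pair {g : ℕ} {β : ℕ → ℕ} (hβ : IsCharSeq g β) {j θ : ℕ}
    {W ψ : PowerSeries ℂ} (hθ : IsShift g β j θ) (hj : j < g)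
    (hW : PowerSeries.constantCoeff W ≠ 0) (hψ : PowerSeries.constantCoeff ψ = 0)
    (h : IsFresh g β j θ W ψ) :
    ∃ (b : ℕ) (W₂ : PowerSeries ℂ), 0 < b ∧ PowerSeries.constantCoeff W₂ ≠ 0 ∧
      ψ = PowerSeries.X ^ b * W₂ ∧
      ((charGcd β (j + 1) ∣ b ∧ θ + b < β (j + 1) ∧
        IsLacunaryPair g β j (θ + b) (charGcd β (j + 1)) b W W₂) ∨
      (θ + b = β (j + 1) ∧
        IsLacunaryPair g β (j + 1) (β (j + 1)) (charGcd β (j + 1)) b W W₂)) := by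
  classical
  obtain ⟨h1, h2, h3⟩ := h (j + 1) (by omega) (by omega)
  have hex : ∃ n, PowerSeries.coeff n ψ ≠ 0 := ⟨_, h3⟩
  set b := Nat.find hex with hb
  have hb1 : PowerSeries.coeff b ψ ≠ 0 := Nat.find_spec hex
  have hb2 : ∀ k < b, PowerSeries.coeff k ψ = 0 := fun k hk => not_not.1 (Nat.find_min hex hk)
  have hb3 : b ≤ β (j + 1) - θ := Nat.find_min' hex h3
  have hb0 : 0 < b := by
    rw [Nat.pos_iff_ne_zero]
    intro h0
    rw [h0] at hb1
    exact hb1 (by rw [PowerSeries.coeff_zero_eq_constantCoeff_apply, hψ])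
  obtain ⟨W₂, hW₂⟩ := PowerSeries.X_pow_dvd_iff.2 hb2
  have hcW₂ : ∀ k, PowerSeries.coeff k W₂ = PowerSeries.coeff (k + b) ψ := by
    intro k; rw [hW₂, PowerSeries.coeff_X_pow_mul]
  have hW₂0 : PowerSeries.constantCoeff W₂ ≠ 0 := by
    rw [← PowerSeries.coeff_zero_eq_constantCoeff_apply, hcW₂, zero_add]; exact hb1
  have hlt := hθ.2 hj
  have hd := hβ.pos
  have key : ∀ i, j < i → i ≤ g → charGcd β i ∣ b → θ + b < β i →
      IsLacunary (charGcd β i) (β i - (θ + b)) W ∧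
      IsLacunary (charGcd β i) (β i - (θ + b)) W₂ ∧
      ((charGcd β (j + 1) : ℕ) : ℂ) * PowerSeries.coeff (β i - (θ + b)) W₂ *
        PowerSeries.coeff 0 W - b * PowerSeries.coeff (β i - (θ + b)) W *
        PowerSeries.coeff 0 W₂ ≠ 0 := by
    intro i hi hig hib hlt
    obtain ⟨h1, h2, h3⟩ := h i hi hig
    have hnd : ¬ charGcd β i ∣ β i - (θ + b) := by
      intro h4
      apply hθ.not_dvd hβ hi hig
      have := dvd_add h4 hib
      rwa [show β i - (θ + b) + b = β i - θ by omega] at this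
    refine ⟨h1.mono (by omega), fun k hk hek => ?_, ?_⟩
    · rw [hcW₂]
      exact h2 _ (by omega) fun h4 => hek ((Nat.dvd_add_left hib).1 h4)
    · rw [h1 (β i - (θ + b)) (by omega) hnd, hcW₂, show β i - (θ + b) + b = β i - θ by omega,
        PowerSeries.coeff_zero_eq_constantCoeff_apply W]
      have h5 : ((charGcd β (j + 1) : ℕ) : ℂ) ≠ 0 :=
        Nat.cast_ne_zero.2 (charGcd_pos hβ.pos j).ne'
      rw [mul_zero, zero_mul, sub_zero]
      exact mul_ne_zero (mul_ne_zero h5 h3) hW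
  refine ⟨b, W₂, hb0, hW₂0, hW₂, ?_⟩
  rcases Nat.lt_or_ge b (β (j + 1) - θ) with hlt' | hge
  · left
    have hdvd : charGcd β (j + 1) ∣ b := by
      by_contra h4
      exact hb1 (h2 b hlt' h4)
    refine ⟨hdvd, by omega, fun i hi hig => key i hi hig ((charGcd_dvd_of_le β hi).trans hdvd) ?_⟩
    obtain rfl | h5 : i = j + 1 ∨ j + 1 < i := by omega
    · omega
    · have := hβ.lt_of_lt h5 hig; omega
  · right
    have hb4 : θ + b = β (j + 1) := by omega
    refine ⟨hb4, fun i hi hig => ?_⟩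
    have h5 := key i (by omega) hig ?_ (by rw [hb4]; exact hβ.lt_of_lt hi hig)
    · rwa [hb4] at h5
    · have h6 : charGcd β i ∣ β (j + 1) :=
        (charGcd_dvd_of_le β hi).trans (charGcd_succ_dvd_self β (j + 1))
      have h7 : charGcd β i ∣ θ := (charGcd_dvd_of_le β (by omega)).trans hθ.1
      rw [← hb4] at h6
      exact (Nat.dvd_add_right h7).1 h6

/-- A power series whose `m`-th power is `t ^ m` is `ζ * t` for some root of unity `ζ`. -/
theorem exists_eq_smul_X {σ : PowerSeries ℂ} {m : ℕ} (hm : 0 < m)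
    (h : σ ^ m = PowerSeries.X ^ m) (h0 : PowerSeries.constantCoeff σ = 0) :
    ∃ ζ : ℂ, ζ ^ m = 1 ∧ σ = ζ • PowerSeries.X := by
  obtain ⟨s, rfl⟩ := PowerSeries.X_dvd_iff.2 h0
  have hs : s ^ m = 1 := by
    rw [mul_pow] at h
    exact mul_left_cancel₀ (pow_ne_zero m PowerSeries.X_ne_zero) (by rw [h, mul_one])
  have hs0 : s ≠ 0 := by rintro rfl; rw [zero_pow hm.ne'] at hs; exact zero_ne_one hs
  have hd : PowerSeries.derivative ℂ s = 0 := by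
    have h1 := congrArg (PowerSeries.derivative ℂ) hs
    rw [Derivation.leibniz_pow, Derivation.map_one_eq_zero] at h1
    have h2 : (m : PowerSeries ℂ) * (s ^ (m - 1) * PowerSeries.derivative ℂ s) = 0 := by
      simpa using h1
    have h3 : (m : PowerSeries ℂ) ≠ 0 := by
      rw [← map_natCast (PowerSeries.C (R := ℂ))]
      exact (map_ne_zero_iff _ PowerSeries.C_injective).2 (Nat.cast_ne_zero.2 hm.ne')
    exact ((mul_eq_zero.1 ((mul_eq_zero.1 h2).resolve_left h3)).resolve_left
      (pow_ne_zero _ hs0))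
  have hc : s = PowerSeries.C (PowerSeries.constantCoeff s) := by
    apply PowerSeries.derivative.ext
    · rw [hd]; exact PowerSeries.derivative_C.symm
    · simp
  refine ⟨PowerSeries.constantCoeff s, ?_, ?_⟩
  · rw [← map_pow, hs, map_one]
  · nth_rw 1 [hc]
    rw [PowerSeries.smul_eq_C_mul, mul_comm]

theorem isPrimitiveParam_of_characteristic {g : ℕ} {β : ℕ → ℕ} (h0 : 0 < β 0)
    {y : PowerSeries ℂ} (hc : ∀ j, 1 ≤ j → j ≤ g → PowerSeries.coeff (β j) y ≠ 0)
    (hl : charGcd β (g + 1) = 1) : IsPrimitiveParam (PowerSeries.X ^ β 0) y := by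
  intro σ hσ h1 h2
  have hs := PowerSeries.HasSubst.of_constantCoeff_zero hσ
  rw [PowerSeries.subst_pow hs, PowerSeries.subst_X hs] at h1
  obtain ⟨ζ, hζ, rfl⟩ := exists_eq_smul_X h0 h1 hσ
  rw [subst_smul_X] at h2
  have h3 : ∀ j ≤ g, orderOf ζ ∣ β j := by
    intro j hj
    obtain _ | j := j
    · exact orderOf_dvd_of_pow_eq_one hζ
    · apply orderOf_dvd_of_pow_eq_one
      have h4 := congrArg (PowerSeries.coeff (β (j + 1))) h2
      rw [PowerSeries.coeff_rescale] at h4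
      exact mul_right_cancel₀ (hc (j + 1) (by omega) hj) (by rw [h4, one_mul])
  have h5 : ∀ j ≤ g + 1, orderOf ζ ∣ charGcd β j := by
    intro j
    induction j with
    | zero => exact fun _ => dvd_zero _
    | succ j ih => exact fun hj => Nat.dvd_gcd (ih (by omega)) (h3 j (by omega))
  have h6 := h5 (g + 1) le_rfl
  rw [hl, Nat.dvd_one, orderOf_eq_one_iff] at h6
  rw [h6, one_smul]

/-! ### The words of the trees -/

/-- The blocks of slopes that come from the Euclidean algorithm for `a` and `b`, the first block
having the slope `blockSlope j`. -/
noncomputable def blockWord (j a b : ℕ) : List Slope :=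
  ((euclidQuotients a b).mapIdx fun i q => List.replicate q (blockSlope (i + j))).flatten

theorem euclidQuotients_of_pos (a : ℕ) {b : ℕ} (hb : 0 < b) :
    euclidQuotients a b = a / b :: euclidQuotients b (a % b) := by
  rw [euclidQuotients, if_neg hb.ne']

theorem euclidQuotients_zero (a : ℕ) : euclidQuotients a 0 = [] := by
  rw [euclidQuotients, if_pos rfl]

theorem blockWord_zero (j a : ℕ) : blockWord j a 0 = [] := by
  rw [blockWord, euclidQuotients]; simp

theorem blockWord_of_pos (j a : ℕ) {b : ℕ} (hb : 0 < b) :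
    blockWord j a b = List.replicate (a / b) (blockSlope j) ++ blockWord (j + 1) b (a % b) := by
  rw [blockWord, euclidQuotients_of_pos a hb, List.mapIdx_cons, List.flatten_cons, zero_add,
    blockWord]
  congr 3
  funext i q
  rw [Nat.add_right_comm, Nat.add_assoc]

theorem blockWord_of_le (j : ℕ) {a b : ℕ} (hb : 0 < b) (h : b ≤ a) :
    blockWord j a b = blockSlope j :: blockWord j (a - b) b := by
  rw [blockWord_of_pos j a hb, blockWord_of_pos j (a - b) hb, Nat.div_eq_sub_div hb h,
    List.replicate_succ, Nat.mod_eq_sub_mod h]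
  rfl

theorem blockWord_of_lt (j : ℕ) {a b : ℕ} (h : a < b) :
    blockWord j a b = blockWord (j + 1) b a := by
  rw [blockWord_of_pos j a (by omega), Nat.div_eq_of_lt h, Nat.mod_eq_of_lt h]
  rfl

theorem blockWord_ne_nil (j : ℕ) {a b : ℕ} (ha : 0 < a) (hb : 0 < b) : blockWord j a b ≠ [] := by
  rcases Nat.lt_or_ge a b with h | h
  · rw [blockWord_of_lt j h, blockWord_of_le (j + 1) ha h.le]; simp
  · rw [blockWord_of_le j hb h]; simp

theorem euclidQuotients_mul {k : ℕ} (hk : 0 < k) (a b : ℕ) :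
    euclidQuotients (k * a) (k * b) = euclidQuotients a b := by
  induction b using Nat.strong_induction_on generalizing a with
  | _ b ih =>
    rcases Nat.eq_zero_or_pos b with rfl | hb
    · rw [mul_zero, euclidQuotients_zero, euclidQuotients_zero]
    · rw [euclidQuotients_of_pos _ (Nat.mul_pos hk hb), euclidQuotients_of_pos _ hb,
        Nat.mul_div_mul_left _ _ hk, Nat.mul_mod_mul_left, ih _ (Nat.mod_lt _ hb)]

theorem dropLast_blockWord_of_le (j : ℕ) {a b : ℕ} (hb : 0 < b) (h : b < a) :
    (blockWord j a b).dropLast = blockSlope j :: (blockWord j (a - b) b).dropLast := by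
  rw [blockWord_of_le j hb h.le,
    List.dropLast_cons_of_ne_nil (blockWord_ne_nil j (by omega) hb)]

/-- The word of the subtractive Euclidean algorithm for `a` and `b`, stopped when both numbers are
equal: `s` for a subtraction from `a`, and `s'` for a subtraction from `b`. -/
def euclidWord (s s' : Slope) (a b : ℕ) : List Slope :=
  if 0 < b ∧ b < a then s :: euclidWord s s' (a - b) b
  else if 0 < a ∧ a < b then s' :: euclidWord s s' a (b - a)
  else []
termination_by a + b

theorem euclidWord_of_gt (s s' : Slope) {a b : ℕ} (hb : 0 < b) (h : b < a) :
    euclidWord s s' a b = s :: euclidWord s s' (a - b) b := by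
  rw [euclidWord, if_pos ⟨hb, h⟩]

theorem euclidWord_of_lt (s s' : Slope) {a b : ℕ} (ha : 0 < a) (h : a < b) :
    euclidWord s s' a b = s' :: euclidWord s s' a (b - a) := by
  rw [euclidWord, if_neg (by omega), if_pos ⟨ha, h⟩]

theorem euclidWord_self (s s' : Slope) (a : ℕ) : euclidWord s s' a a = [] := by
  rw [euclidWord, if_neg (by omega), if_neg (by omega)]

theorem euclidWord_zero_left (s s' : Slope) (a : ℕ) : euclidWord s s' 0 a = [] := by
  rw [euclidWord, if_neg (by omega), if_neg (by omega)]

theorem euclidWord_zero_right (s s' : Slope) (a : ℕ) : euclidWord s s' a 0 = [] := by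
  rw [euclidWord, if_neg (by omega), if_neg (by omega)]

theorem euclidWord_comm (s s' : Slope) (a b : ℕ) : euclidWord s s' a b = euclidWord s' s b a := by
  induction h : a + b using Nat.strong_induction_on generalizing a b with
  | _ n ih =>
    subst h
    rcases Nat.eq_zero_or_pos a with rfl | ha
    · rw [euclidWord_zero_left, euclidWord_zero_right]
    rcases Nat.eq_zero_or_pos b with rfl | hb
    · rw [euclidWord_zero_left, euclidWord_zero_right]
    rcases lt_trichotomy a b with h | rfl | h
    · rw [euclidWord_of_lt _ _ ha h, euclidWord_of_gt _ _ ha h, ih _ (by omega) _ _ rfl]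
    · rw [euclidWord_self, euclidWord_self]
    · rw [euclidWord_of_gt _ _ hb h, euclidWord_of_lt _ _ hb h, ih _ (by omega) _ _ rfl]

theorem blockSlope_add_two {j : ℕ} (hj : 1 ≤ j) : blockSlope (j + 2) = blockSlope j := by
  obtain ⟨j, rfl⟩ : ∃ k, j = k + 1 := ⟨j - 1, by omega⟩
  simp [blockSlope, Nat.even_add_one]

theorem dropLast_blockWord_eq {j : ℕ} (hj : 1 ≤ j) {a b : ℕ} (ha : 0 < a) (hb : 0 < b) :
    (blockWord j a b).dropLast = euclidWord (blockSlope j) (blockSlope (j + 1)) a b := by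
  induction h : a + b using Nat.strong_induction_on generalizing a b j with
  | _ n ih =>
    subst h
    rcases lt_trichotomy a b with h | rfl | h
    · rw [blockWord_of_lt j h, dropLast_blockWord_of_le _ ha h, euclidWord_of_lt _ _ ha h,
        ih (b - a + a) (by omega) (by omega) (by omega) ha rfl, blockSlope_add_two hj,
        euclidWord_comm]
    · rw [blockWord_of_le j ha le_rfl, Nat.sub_self, blockWord_of_lt _ ha, blockWord_zero,
        euclidWord_self]
      rfl
    · rw [dropLast_blockWord_of_le _ hb h, euclidWord_of_gt _ _ hb h,
        ih (a - b + b) (by omega) hj (by omega) hb rfl]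

/-- The slopes of the edges of `T_{j+1} # ⋯ # T_{j+n}`. -/
def tailWord (T : ℕ → UnibranchTree) : ℕ → ℕ → List Slope
  | _, 0 => []
  | j, n + 1 => (T (j + 1)).slopes ++ tailWord T (j + 1) n

theorem tailWord_succ (T : ℕ → UnibranchTree) (j n : ℕ) :
    tailWord T j (n + 1) = tailWord T j n ++ (T (j + n + 1)).slopes := by
  induction n generalizing j with
  | zero => simp [tailWord]
  | succ n ih =>
    rw [tailWord, ih (j + 1), ← List.append_assoc]
    congr 3
    rw [show j + 1 + n = j + (n + 1) by omega]

theorem iteratedSum_slopes (T : ℕ → UnibranchTree) (g : ℕ) :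
    (UnibranchTree.iteratedSum T g).slopes = tailWord T 0 g := by
  induction g with
  | zero => rfl
  | succ g ih =>
    rw [tailWord_succ, ← ih, zero_add]; rfl

/-- The slopes of the edges of `T_{p_{j+1}, q_{j+1}} # ⋯ # T_{p_g, q_g}`. -/
noncomputable def stageWord (g : ℕ) (β : ℕ → ℕ) (j : ℕ) : List Slope :=
  tailWord (fun j => treeTpq (puiseuxP β j) (puiseuxQ β j)) j (g - j)

/-- The slopes of the edges from a point at which the characteristic exponents are shifted by `θ`,
in the stage `j`. -/
noncomputable def freshWord (g : ℕ) (β : ℕ → ℕ) (j θ : ℕ) : List Slope :=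
  (blockWord 0 (β (j + 1) - θ) (charGcd β (j + 1))).dropLast ++ stageWord g β (j + 1)

theorem stageWord_self (g : ℕ) (β : ℕ → ℕ) : stageWord g β g = [] := by
  rw [stageWord, Nat.sub_self]; rfl

/-- The numbers `p_j` and `q_j` are well defined and coprime. -/
theorem IsCharSeq.wellDefined {g : ℕ} {β : ℕ → ℕ} (hβ : IsCharSeq g β) {j : ℕ} (hj : 1 ≤ j)
    (hg : j ≤ g) : β (j - 1) < β j ∧ charGcd β (j + 1) ∣ charGcd β j ∧
      charGcd β (j + 1) ∣ β j - β (j - 1) + charGcd β j ∧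
      0 < puiseuxP β j ∧ puiseuxP β j < puiseuxQ β j ∧
      Nat.Coprime (puiseuxP β j) (puiseuxQ β j) := by
  obtain ⟨j, rfl⟩ : ∃ k, j = k + 1 := ⟨j - 1, by omega⟩
  rw [Nat.add_sub_cancel]
  have hlt := hβ.lt j (by omega)
  have h1 : charGcd β (j + 1 + 1) ∣ charGcd β (j + 1) := charGcd_succ_dvd β _
  have hd : charGcd β (j + 1) ∣ β j := charGcd_succ_dvd_self β j
  have h2 : charGcd β (j + 1 + 1) ∣ β (j + 1) - β j :=
    Nat.dvd_sub (charGcd_succ_dvd_self β _) (h1.trans hd)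
  have h3 : charGcd β (j + 1 + 1) ∣ β (j + 1) - β j + charGcd β (j + 1) := dvd_add h2 h1
  have hpos := charGcd_pos hβ.pos (j + 1)
  have hpos' := charGcd_pos hβ.pos j
  refine ⟨hlt, h1, h3, Nat.div_pos (Nat.le_of_dvd hpos' h1) hpos, ?_, ?_⟩
  · rw [puiseuxP, puiseuxQ, Nat.add_sub_cancel, Nat.div_lt_div_right hpos.ne' h1 h3]
    omega
  · rw [puiseuxP, puiseuxQ, Nat.add_sub_cancel]
    have h4 : Nat.gcd (charGcd β (j + 1)) (β (j + 1) - β j + charGcd β (j + 1)) =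
        charGcd β (j + 1 + 1) := by
      rw [Nat.gcd_add_self_right]
      apply Nat.dvd_antisymm
      · refine Nat.dvd_gcd (Nat.gcd_dvd_left _ _) ?_
        have := dvd_add (Nat.gcd_dvd_right (charGcd β (j + 1)) (β (j + 1) - β j))
          ((Nat.gcd_dvd_left (charGcd β (j + 1)) (β (j + 1) - β j)).trans hd)
        rwa [Nat.sub_add_cancel hlt.le] at this
      · exact Nat.dvd_gcd h1 h2
    have h5 := Nat.coprime_div_gcd_div_gcd (m := charGcd β (j + 1))
      (n := β (j + 1) - β j + charGcd β (j + 1)) (by rw [h4]; exact hpos)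
    rwa [h4] at h5

theorem treeTpq_slopes {g : ℕ} {β : ℕ → ℕ} (hβ : IsCharSeq g β) {j : ℕ} (hj : j < g) :
    (treeTpq (puiseuxP β (j + 1)) (puiseuxQ β (j + 1))).slopes =
      (blockWord 0 (β (j + 1) - β j + charGcd β (j + 1)) (charGcd β (j + 1))).dropLast := by
  obtain ⟨-, h1, h2, -⟩ := hβ.wellDefined (j := j + 1) (by omega) (by omega)
  have h : euclidQuotients (puiseuxQ β (j + 1)) (puiseuxP β (j + 1)) =
      euclidQuotients (β (j + 1) - β j + charGcd β (j + 1)) (charGcd β (j + 1)) := by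
    rw [← euclidQuotients_mul (charGcd_pos hβ.pos (j + 1)), puiseuxP, puiseuxQ,
      Nat.mul_div_cancel' h1, Nat.mul_div_cancel' h2, Nat.add_sub_cancel]
  rw [treeTpq, h]
  rfl

theorem stageWord_eq_append {g : ℕ} {β : ℕ → ℕ} (hβ : IsCharSeq g β) {j : ℕ} (hj : j < g) :
    stageWord g β j = (blockWord 0 (β (j + 1) - β j + charGcd β (j + 1))
      (charGcd β (j + 1))).dropLast ++ stageWord g β (j + 1) := by
  rw [stageWord, show g - j = g - (j + 1) + 1 by omega, tailWord, treeTpq_slopes hβ hj]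
  rfl

theorem stageWord_eq_cons {g : ℕ} {β : ℕ → ℕ} (hβ : IsCharSeq g β) {j : ℕ} (hj : j < g) :
    stageWord g β j = Slope.slant :: freshWord g β j (β j) := by
  have h := hβ.lt j hj
  rw [stageWord_eq_append hβ hj, dropLast_blockWord_of_le 0 (charGcd_pos hβ.pos j) (by omega),
    Nat.add_sub_cancel]
  rfl

theorem stageWord_zero {g : ℕ} {β : ℕ → ℕ} (hβ : IsCharSeq g β) (hg : 0 < g) :
    stageWord g β 0 = freshWord g β 0 0 := by
  have h := hβ.lt 0 hg
  rw [stageWord_eq_append hβ hg, freshWord, zero_add, charGcd_one, Nat.sub_zero,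
    Nat.sub_add_cancel h.le]

/-! ### The directions of the blowings up and the slopes of the edges -/

/-- The coordinate axes at an infinitely near point which are exceptional. At a satellite point,
where both are, `both σ` records in addition that the edges that end at a point in the direction
`∞` are drawn horizontally (`σ = true`) or vertically (`σ = false`) until the next free point, and
those in the direction `0` in the other way. -/
inductive AxisState : Type
  | none
  | xAxis
  | yAxis
  | both (σ : Bool)

open Classical in
/-- The exceptional axes at the point in the direction `d`. Here `xAxis` refers to `x = 0`, and
`yAxis` to `y = 0`. -/
noncomputable def AxisState.next : AxisState → Direction → AxisState
  | .none, OnePoint.some _ => .xAxis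
  | .none, OnePoint.infty => .yAxis
  | .xAxis, OnePoint.some _ => .xAxis
  | .xAxis, OnePoint.infty => .both true
  | .yAxis, OnePoint.infty => .yAxis
  | .yAxis, OnePoint.some c => if c = 0 then .both false else .xAxis
  | .both σ, OnePoint.infty => .both σ
  | .both σ, OnePoint.some c => if c = 0 then .both σ else .xAxis

/-- The slope of the edge that ends at the point in the direction `d`, if that point has the axes
`s`. -/
def edgeSlope : AxisState → Direction → Slope
  | .both true, OnePoint.infty => .horizontal
  | .both false, OnePoint.infty => .vertical
  | .both true, OnePoint.some _ => .vertical
  | .both false, OnePoint.some _ => .horizontal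
  | _, _ => .slant

/-- The slopes of the edges of the chain of points with the given directions. -/
noncomputable def slopeWord : AxisState → List Direction → List Slope
  | _, [] => []
  | s, d :: l => edgeSlope (s.next d) d :: slopeWord (s.next d) l

/-! ### Proximity -/

/-- After the direction `d` has been taken at a point, the direction of the strict transform of the
exceptional curve of that point: this curve is `x = 0` if `d` is finite, and `y = 0` if `d = ∞`. -/
noncomputable def oppositeAxis : Direction → Direction
  | OnePoint.some _ => OnePoint.infty
  | OnePoint.infty => OnePoint.some 0

theorem oppositeAxis_ne (d : Direction) : oppositeAxis d ≠ d := by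
  induction d using OnePoint.rec with
  | infty => exact OnePoint.coe_ne_infty 0
  | coe c => exact (OnePoint.coe_ne_infty c).symm

theorem strictTransform_infty_X0 : strictTransform OnePoint.infty (X 0) = X 0 :=
  strictTransform_eq (m := 1) (by rw [pullback_infty_X0, pow_one, mul_comm]; rfl)
    (not_X1_dvd (i := 1) (by rw [← coeff_single_zero]; simp))

theorem strictTransform_some_X0 (c : ℂ) : strictTransform (OnePoint.some c) (X 0) = 1 :=
  strictTransform_eq (m := 1) (by rw [pullback_some_X0, pow_one, mul_one]; rfl)
    (not_X_dvd_of_constantCoeff_ne_zero _ (by simp))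

theorem strictTransform_infty_X1 : strictTransform OnePoint.infty (X 1) = 1 :=
  strictTransform_eq (m := 1) (by rw [pullback_infty_X1, pow_one, mul_one]; rfl)
    (not_X_dvd_of_constantCoeff_ne_zero _ (by simp))

theorem strictTransform_some_X1 (c : ℂ) :
    strictTransform (OnePoint.some c) (X 1) = X 1 + C c := by
  refine strictTransform_eq (m := 1) (by rw [pullback_some_X1, pow_one]; rfl)
    (not_X0_dvd (j := 1) ?_)
  rw [← coeff_single_one]; simp [coeff_C]

theorem constantCoeff_strictTransformAt_of_unit (s : List Direction) : ∀ {S : Germ},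
    constantCoeff S ≠ 0 → constantCoeff (strictTransformAt s S) ≠ 0 := by
  induction s with
  | nil => exact id
  | cons d s ih =>
    intro S h
    refine ih (S := strictTransform d S) ?_
    rwa [strictTransform_of_unit d h, constantCoeff_pullback]

theorem constantCoeff_strictTransformAt_excEquation (s : List Direction) : ∀ d : Direction,
    constantCoeff (strictTransformAt s (excEquation d)) = 0 ↔ ∀ x ∈ s, x = oppositeAxis d := by
  induction s with
  | nil =>
    intro d
    simp [strictTransformAt, excEquation]
  | cons x s ih =>
    intro d
    rw [List.forall_mem_cons, ← ih d]
    change constantCoeff (strictTransformAt s (strictTransform x (excEquation d))) = 0 ↔ _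
    induction d using OnePoint.rec with
    | infty =>
      change constantCoeff (strictTransformAt s (strictTransform x (X 1))) = 0 ↔ _
      induction x using OnePoint.rec with
      | infty =>
        rw [strictTransform_infty_X1]
        exact iff_of_false (constantCoeff_strictTransformAt_of_unit s (by simp))
          fun h => OnePoint.infty_ne_coe 0 h.1
      | coe c =>
        rw [strictTransform_some_X1]
        by_cases hc : c = 0
        · rw [hc, map_zero, add_zero]
          exact ⟨fun h => ⟨rfl, h⟩, fun h => h.2⟩
        · exact iff_of_false (constantCoeff_strictTransformAt_of_unit s (by simpa using hc))
            fun h => hc (OnePoint.coe_injective h.1)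
    | coe e =>
      change constantCoeff (strictTransformAt s (strictTransform x (X 0))) = 0 ↔ _
      induction x using OnePoint.rec with
      | infty =>
        rw [strictTransform_infty_X0]
        exact ⟨fun h => ⟨rfl, h⟩, fun h => h.2⟩
      | coe c =>
        rw [strictTransform_some_X0]
        exact iff_of_false (constantCoeff_strictTransformAt_of_unit s (by simp))
          fun h => OnePoint.coe_ne_infty c h.1

theorem proximate_iff (l k : InfNearPoint) : Proximate l k ↔
    ∃ (d : Direction) (s : List Direction), l = k ++ d :: s ∧ ∀ x ∈ s, x = oppositeAxis d := by
  simp only [Proximate, constantCoeff_strictTransformAt_excEquation]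

/-- The direction of the `i`-th blowing up. -/
noncomputable def dirAt (D : List Direction) (i : ℕ) : Direction := D.getD i OnePoint.infty

/-- In the chain of points with the directions `D`, the point number `b` is proximate to the point
number `a`. -/
def ProxAt (D : List Direction) (b a : ℕ) : Prop :=
  a < b ∧ ∀ i, a < i → i < b → dirAt D i = oppositeAxis (dirAt D a)

/-- In the chain of points with the directions `D`, the point number `b` is a satellite. -/
def SatAt (D : List Direction) (b : ℕ) : Prop := ∃ a, a + 1 < b ∧ ProxAt D b a

theorem proximate_take_iff {D : List Direction} {a b : ℕ} (ha : a ≤ D.length)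
    (hb : b ≤ D.length) : Proximate (D.take b) (D.take a) ↔ ProxAt D b a := by
  rw [proximate_iff]
  constructor
  · rintro ⟨d, s, h, hs⟩
    have hlen := congrArg List.length h
    simp only [List.length_take, List.length_append, List.length_cons] at hlen
    rw [min_eq_left ha, min_eq_left hb] at hlen
    have hget : ∀ i, i < b → a ≤ i → D[i]? = (d :: s)[i - a]? := by
      intro i hi hai
      rw [← List.getElem?_take_of_lt hi, h, List.getElem?_append_right (by simp; omega)]
      simp [min_eq_left ha]
    have hd : dirAt D a = d := by
      rw [dirAt, List.getD_eq_getElem?_getD, hget a (by omega) le_rfl]; simp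
    refine ⟨by omega, fun i hi hib => ?_⟩
    rw [hd]
    apply hs
    obtain ⟨k, rfl⟩ : ∃ k, i = a + 1 + k := ⟨i - (a + 1), by omega⟩
    have hk : k < s.length := by omega
    rw [dirAt, List.getD_eq_getElem?_getD, hget _ hib (by omega),
      show a + 1 + k - a = k + 1 by omega, List.getElem?_cons_succ, List.getElem?_eq_getElem hk]
    exact List.getElem_mem hk
  · rintro ⟨hab, h⟩
    refine ⟨dirAt D a, (D.drop (a + 1)).take (b - a - 1), ?_, fun x hx => ?_⟩
    · obtain ⟨k, rfl⟩ : ∃ k, b = a + (k + 1) := ⟨b - a - 1, by omega⟩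
      rw [List.take_add, List.drop_eq_getElem_cons (by omega : a < D.length), List.take_succ_cons,
        dirAt, List.getD_eq_getElem _ _ (by omega), show a + (k + 1) - a - 1 = k by omega]
    · obtain ⟨k, hk, rfl⟩ := List.getElem_of_mem hx
      have hk' := hk
      simp only [List.length_take, List.length_drop] at hk'
      rw [List.getElem_take, List.getElem_drop, ← h (a + 1 + k) (by omega) (by omega), dirAt,
        List.getD_eq_getElem]

theorem proxAt_succ (D : List Direction) (a : ℕ) : ProxAt D (a + 1) a :=
  ⟨by omega, fun i h1 h2 => by omega⟩

/-- A point is proximate to its predecessor and at most one more point. -/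
theorem ProxAt.eq_of_lt {D : List Direction} {a a' b : ℕ} (h : ProxAt D b a) (h' : ProxAt D b a')
    (hlt : a < a') : a' + 1 = b := by
  by_contra hne
  have h1 := h'.1
  apply oppositeAxis_ne (dirAt D a')
  rw [← h'.2 (b - 1) (by omega) (by omega), h.2 (b - 1) (by omega) (by omega),
    h.2 a' hlt h1]

/-! ### The markings of the edges of a chain -/

/-- The marking `W` of the edges of the chain of points with the directions `D`, where `W i` is the
slope of the edge from the point number `i` to the next one, is that of the Enriques tree: edges
which end at a satellite are horizontal or vertical, the first one after a free point being
horizontal, and the slope changes if and only if the direction does. -/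
structure IsMarking (D : List Direction) (W : ℕ → Slope) : Prop where
  sat : ∀ i < D.length, W i ≠ Slope.slant ↔ SatAt D (i + 1)
  turn : ∀ i, i + 1 < D.length → SatAt D (i + 1) → SatAt D (i + 2) →
    (W (i + 1) = W i ↔ dirAt D (i + 1) = dirAt D i)
  start : ∀ i < D.length, ¬ SatAt D i → SatAt D (i + 1) → W i = Slope.horizontal

theorem Slope.eq_of_ne {s t u : Slope} (hs : s ≠ .slant) (ht : t ≠ .slant) (hu : u ≠ .slant)
    (h : s = u ↔ t = u) : s = t := by
  cases s <;> cases t <;> cases u <;> simp_all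

theorem SatAt.one_lt {D : List Direction} {b : ℕ} (h : SatAt D b) : 1 < b := by
  obtain ⟨a, h, -⟩ := h; omega

theorem IsMarking.eq {D : List Direction} {W W' : ℕ → Slope} (h : IsMarking D W)
    (h' : IsMarking D W') : ∀ i < D.length, W i = W' i := by
  intro i
  induction i with
  | zero =>
    intro hi
    have h0 : ¬ SatAt D 1 := fun h => by have := h.one_lt; omega
    rw [not_not.1 (mt (h.sat 0 hi).1 h0), not_not.1 (mt (h'.sat 0 hi).1 h0)]
  | succ i ih =>
    intro hi
    by_cases h2 : SatAt D (i + 2)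
    · by_cases h1 : SatAt D (i + 1)
      · refine Slope.eq_of_ne ((h.sat _ hi).2 h2) ((h'.sat _ hi).2 h2)
          ((h.sat i (by omega)).2 h1) ?_
        rw [h.turn i hi h1 h2, ih (by omega), h'.turn i hi h1 h2]
      · rw [h.start _ hi h1 h2, h'.start _ hi h1 h2]
    · rw [not_not.1 (mt (h.sat _ hi).1 h2), not_not.1 (mt (h'.sat _ hi).1 h2)]

/-- There is an `L`-shape branch in the path with the slopes `W`. -/
def LShapeAt (W : ℕ → Slope) (s : Slope) (a b : ℕ) : Prop :=
  a + 1 = b ∨ (a + 1 < b ∧ W a ≠ s ∧ ∀ i, a < i → i < b → W i = s)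

theorem satAt_of_proxAt {D : List Direction} {a b i : ℕ} (h : ProxAt D b a) (h1 : a + 1 < i)
    (h2 : i ≤ b) : SatAt D i :=
  ⟨a, h1, by omega, fun k hk hki => h.2 k hk (by omega)⟩

/-- In the chain of points with the directions `D`, proximity is given by `L`-shape branches. -/
theorem IsMarking.lShapeAt_iff {D : List Direction} {W : ℕ → Slope} (h : IsMarking D W) {a b : ℕ}
    (hb : b ≤ D.length) : (LShapeAt W .horizontal a b ∨ LShapeAt W .vertical a b) ↔
      ProxAt D b a := by
  constructor
  · intro hL
    obtain ⟨s, hs, hL⟩ : ∃ s, s ≠ Slope.slant ∧ LShapeAt W s a b := by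
      rcases hL with hL | hL
      · exact ⟨_, by simp, hL⟩
      · exact ⟨_, by simp, hL⟩
    rcases hL with rfl | ⟨hab, h1, h2⟩
    · exact proxAt_succ D a
    have hsat : ∀ i, a < i → i < b → SatAt D (i + 1) := fun i hi hib =>
      (h.sat i (by omega)).1 (by rwa [h2 i hi hib])
    -- the point number `a + 2` is proximate to a point before the point number `a + 1`; if this
    -- were not `a`, then the first edge would have the slope `s`, too
    have hfirst : dirAt D (a + 1) = oppositeAxis (dirAt D a) := by
      obtain ⟨k, hk, hp⟩ := hsat (a + 1) (by omega) hab
      rcases Nat.lt_or_ge k a with hka | hka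
      · exfalso
        have hs1 : SatAt D (a + 1) := satAt_of_proxAt hp (by omega) (by omega)
        apply h1
        rw [← h2 (a + 1) (by omega) hab]
        refine ((h.turn a (by omega) hs1 (hsat (a + 1) (by omega) hab)).2 ?_).symm
        rw [hp.2 a hka (by omega), hp.2 (a + 1) (by omega) (by omega)]
      · obtain rfl : k = a := by omega
        exact hp.2 _ (by omega) (by omega)
    refine ⟨by omega, fun i hi => ?_⟩
    induction i, hi using Nat.le_induction with
    | base => exact fun _ => hfirst
    | succ i hi ih =>
      intro hib
      rw [← ih (by omega)]
      refine (h.turn i (by omega) (hsat i (by omega) (by omega))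
        (hsat (i + 1) (by omega) (by omega))).1 ?_
      rw [h2 i (by omega) (by omega), h2 (i + 1) (by omega) (by omega)]
  · intro hp
    rcases Nat.eq_or_lt_of_le hp.1 with hab | hab
    · exact Or.inl (Or.inl hab)
    have hab : a + 1 < b := hab
    have hsat : ∀ i, a < i → i < b → SatAt D (i + 1) := fun i hi hib =>
      satAt_of_proxAt hp (by omega) (by omega)
    have hne : ∀ i, a < i → i < b → W i ≠ Slope.slant := fun i hi hib =>
      (h.sat i (by omega)).2 (hsat i hi hib)
    have hL : LShapeAt W (W (a + 1)) a b := by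
      refine Or.inr ⟨hab, fun h1 => ?_, fun i hi => ?_⟩
      · have h2 := (h.turn a (by omega) ((h.sat a (by omega)).1
          (by rw [h1]; exact hne _ (by omega) hab)) (hsat _ (by omega) hab)).1 h1.symm
        exact oppositeAxis_ne _ ((hp.2 (a + 1) (by omega) hab).symm.trans h2)
      · induction i, hi using Nat.le_induction with
        | base => exact fun _ => rfl
        | succ i hi ih =>
          intro hib
          rw [← ih (by omega)]
          refine (h.turn i (by omega) (hsat i (by omega) (by omega))
            (hsat (i + 1) (by omega) (by omega))).2 ?_
          rw [hp.2 i (by omega) (by omega), hp.2 (i + 1) (by omega) (by omega)]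
    have := hne (a + 1) (by omega) hab
    generalize W (a + 1) = s at hL this
    cases s
    · exact absurd rfl this
    · exact Or.inl hL
    · exact Or.inr hL

/-- Conversely, the proximity relation determines where the slopes change. -/
theorem isMarking_of_lShapeAt {D : List Direction} {W : ℕ → Slope}
    (sat : ∀ i < D.length, W i ≠ Slope.slant ↔ SatAt D (i + 1))
    (start : ∀ i < D.length, ¬ SatAt D i → SatAt D (i + 1) → W i = Slope.horizontal)
    (hL : ∀ a b, b ≤ D.length → ProxAt D b a →
      LShapeAt W .horizontal a b ∨ LShapeAt W .vertical a b) : IsMarking D W := by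
  refine ⟨sat, fun i hi h1 h2 => ?_, start⟩
  obtain ⟨k, hk, hp⟩ := h2
  obtain ⟨s, hL⟩ : ∃ s, LShapeAt W s k (i + 2) := by
    rcases hL k (i + 2) (by omega) hp with h | h
    exacts [⟨_, h⟩, ⟨_, h⟩]
  rcases hL with hL | ⟨-, h3, h4⟩
  · omega
  rcases Nat.lt_or_ge k i with hki | hki
  · refine iff_of_true ?_ ?_
    · rw [h4 i hki (by omega), h4 (i + 1) (by omega) (by omega)]
    · rw [hp.2 i hki (by omega), hp.2 (i + 1) (by omega) (by omega)]
  · obtain rfl : k = i := by omega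
    refine iff_of_false ?_ ?_
    · rw [h4 (k + 1) (by omega) (by omega)]; exact h3.symm
    · rw [hp.2 (k + 1) (by omega) (by omega)]; exact oppositeAxis_ne _

/-! ### The slopes given by the directions -/

/-- The exceptional axes at the point number `i` of the chain of points with the directions `D`. -/
noncomputable def stateAt (D : List Direction) (i : ℕ) : AxisState :=
  (D.take i).foldl AxisState.next .none

theorem stateAt_succ {D : List Direction} {i : ℕ} (hi : i < D.length) :
    stateAt D (i + 1) = (stateAt D i).next (dirAt D i) := by
  rw [stateAt, List.take_succ_eq_append_getElem hi, List.foldl_append, dirAt,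
    List.getD_eq_getElem _ _ hi]
  rfl

theorem length_slopeWord (D : List Direction) : ∀ s, (slopeWord s D).length = D.length := by
  induction D with
  | nil => intro s; rfl
  | cons d D ih => intro s; simp [slopeWord, ih]

theorem getElem_slopeWord (D : List Direction) : ∀ (s : AxisState) (i : ℕ)
    (hi : i < (slopeWord s D).length), (slopeWord s D)[i] =
      edgeSlope (((D.take i).foldl AxisState.next s).next (dirAt D i)) (dirAt D i) := by
  induction D with
  | nil => intro s i hi; simp [slopeWord] at hi
  | cons d D ih =>
    intro s i hi
    obtain _ | i := i
    · rfl
    · simp only [slopeWord, List.getElem_cons_succ]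
      rw [ih]
      rfl

/-- The direction `d` is that of one of the exceptional axes `s`: `∞` for `x = 0`, and `0` for
`y = 0`. -/
def AxisState.Contains : AxisState → Direction → Prop
  | .none, _ => False
  | .xAxis, d => d = OnePoint.infty
  | .yAxis, d => d = OnePoint.some 0
  | .both _, d => d = OnePoint.infty ∨ d = OnePoint.some 0

/-- A curve is exceptional at the next point if it is the new exceptional curve or the strict
transform of an old one that is tangent to the direction. -/
theorem AxisState.contains_next (s : AxisState) (d x : Direction) :
    (s.next d).Contains x ↔ oppositeAxis d = x ∨ (s.Contains x ∧ d = x) := by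
  induction d using OnePoint.rec with
  | infty =>
    cases s <;> simp only [AxisState.next, AxisState.Contains, oppositeAxis] <;>
      grind [OnePoint.infty_ne_coe]
  | coe c =>
    have h0 : (OnePoint.some c : Direction) = OnePoint.some 0 ↔ c = 0 :=
      OnePoint.coe_injective.eq_iff
    have h1 : (OnePoint.some c : Direction) ≠ OnePoint.infty := OnePoint.coe_ne_infty c
    by_cases hc : c = 0 <;>
    cases s <;> simp only [AxisState.next, AxisState.Contains, oppositeAxis, hc, if_true,
      if_false] <;> grind

theorem contains_stateAt {D : List Direction} (x : Direction) : ∀ i ≤ D.length,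
    ((stateAt D i).Contains x ↔
      ∃ a < i, oppositeAxis (dirAt D a) = x ∧ ∀ k, a < k → k < i → dirAt D k = x) := by
  intro i
  induction i with
  | zero => intro _; exact iff_of_false (fun h => h) (by simp)
  | succ i ih =>
    intro hi
    rw [stateAt_succ (by omega), AxisState.contains_next, ih (by omega)]
    constructor
    · rintro (h | ⟨⟨a, ha, h1, h2⟩, h3⟩)
      · exact ⟨i, by omega, h, fun k h1 h2 => by omega⟩
      · refine ⟨a, by omega, h1, fun k hk hki => ?_⟩
        rcases Nat.lt_or_ge k i with h | h
        · exact h2 k hk h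
        · obtain rfl : k = i := by omega
          exact h3
    · rintro ⟨a, ha, h1, h2⟩
      rcases Nat.lt_or_ge a i with h | h
      · exact Or.inr ⟨⟨a, h, h1, fun k hk hki => h2 k hk (by omega)⟩, h2 i h (by omega)⟩
      · obtain rfl : a = i := by omega
        exact Or.inl h1

theorem satAt_succ_iff {D : List Direction} {i : ℕ} (hi : i < D.length) :
    SatAt D (i + 1) ↔ (stateAt D i).Contains (dirAt D i) := by
  rw [contains_stateAt _ i hi.le]
  constructor
  · rintro ⟨a, ha, h⟩
    exact ⟨a, by omega, (h.2 i (by omega) (by omega)).symm, fun k hk hki => by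
      rw [h.2 k hk (by omega), h.2 i (by omega) (by omega)]⟩
  · rintro ⟨a, ha, h1, h2⟩
    refine ⟨a, by omega, by omega, fun k hk hki => ?_⟩
    rw [h1]
    rcases Nat.lt_or_ge k i with h | h
    · exact h2 k hk h
    · rw [show k = i by omega]

theorem AxisState.contains_iff (s : AxisState) (d : Direction) :
    s.Contains d ↔ ∃ σ, s.next d = .both σ := by
  induction d using OnePoint.rec with
  | infty =>
    cases s <;> simp only [AxisState.next, AxisState.Contains] <;> grind [OnePoint.infty_ne_coe]
  | coe c =>
    have h0 : (OnePoint.some c : Direction) = OnePoint.some 0 ↔ c = 0 :=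
      OnePoint.coe_injective.eq_iff
    have h1 : (OnePoint.some c : Direction) ≠ OnePoint.infty := OnePoint.coe_ne_infty c
    by_cases hc : c = 0 <;>
    cases s <;> simp only [AxisState.next, AxisState.Contains, hc, if_true, if_false] <;> grind

theorem edgeSlope_ne_slant (s : AxisState) (d : Direction) :
    edgeSlope s d ≠ Slope.slant ↔ ∃ σ, s = .both σ := by
  induction d using OnePoint.rec <;> rcases s with _ | _ | _ | σ <;> try cases σ
  all_goals simp [edgeSlope]

theorem AxisState.edgeSlope_next_of_not_both {s : AxisState} {d : Direction} {σ : Bool}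
    (hs : ∀ σ, s ≠ .both σ) (h : s.next d = .both σ) :
    edgeSlope (s.next d) d = Slope.horizontal := by
  rw [h]
  rcases s with _ | _ | _ | σ' <;> induction d using OnePoint.rec <;>
    simp only [AxisState.next] at h <;> try split_ifs at h
  all_goals cases h
  all_goals first | rfl | exact absurd rfl (hs _)

theorem AxisState.next_both {s : AxisState} {d : Direction} {σ : Bool} (h : s.next d = .both σ) :
    d = OnePoint.infty ∨ d = OnePoint.some 0 := by
  have h1 := (s.contains_iff d).2 ⟨σ, h⟩
  cases s <;> simp only [AxisState.Contains] at h1 <;> tauto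

theorem edgeSlope_both_eq_iff {σ : Bool} {d d' : Direction}
    (hd : d = OnePoint.infty ∨ d = OnePoint.some 0)
    (hd' : d' = OnePoint.infty ∨ d' = OnePoint.some 0) :
    edgeSlope (.both σ) d' = edgeSlope (.both σ) d ↔ d' = d := by
  have h1 : (OnePoint.some (0 : ℂ) : Direction) ≠ OnePoint.infty := OnePoint.coe_ne_infty 0
  rcases hd with rfl | rfl <;> rcases hd' with rfl | rfl <;> cases σ <;>
    simp [edgeSlope, h1, h1.symm]

theorem isMarking_edgeSlope (D : List Direction) :
    IsMarking D fun i => edgeSlope ((stateAt D i).next (dirAt D i)) (dirAt D i) := by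
  refine ⟨fun i hi => ?_, fun i hi h1 h2 => ?_, fun i hi h1 h2 => ?_⟩
  · rw [edgeSlope_ne_slant, ← AxisState.contains_iff, satAt_succ_iff hi]
  · rw [satAt_succ_iff hi] at h2
    rw [satAt_succ_iff (by omega)] at h1
    obtain ⟨σ, h1⟩ := (AxisState.contains_iff _ _).1 h1
    obtain ⟨σ', h2⟩ := (AxisState.contains_iff _ _).1 h2
    have h3 : stateAt D (i + 1) = .both σ := by rw [stateAt_succ (by omega), h1]
    have hd' := AxisState.next_both h2
    have h4 : σ' = σ := by
      rw [h3] at h2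
      rcases hd' with h | h <;> rw [h] at h2 <;> simp [AxisState.next] at h2 <;> exact h2.symm
    simp only [h1, h2, h4]
    exact edgeSlope_both_eq_iff (AxisState.next_both h1) hd'
  · rw [satAt_succ_iff hi] at h2
    obtain ⟨σ, h2⟩ := (AxisState.contains_iff _ _).1 h2
    refine AxisState.edgeSlope_next_of_not_both (fun τ h => h1 ?_) h2
    obtain _ | i := i
    · cases h
    · rw [satAt_succ_iff (by omega), AxisState.contains_iff, ← stateAt_succ (by omega)]
      exact ⟨τ, h⟩

/-! ### The Enriques tree of a chain of points -/

section Path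

variable {T : EnriquesTree} {N : ℕ} (e : T.Vertex ≃ Fin (N + 1))

/-- The edges of `T` are those of a path, with the vertices numbered by `e`, and their slopes are
given by `W`. -/
structure IsPath (T : EnriquesTree) {N : ℕ} (e : T.Vertex ≃ Fin (N + 1)) (W : ℕ → Slope) :
    Prop where
  edge : ∀ a b, T.Edge a b ↔ (e a : ℕ) + 1 = e b
  slope : ∀ a b (h : T.Edge a b), T.slope h = W (e a)

theorem root_eq (h : ∀ a b, T.Edge a b ↔ (e a : ℕ) + 1 = e b) : e T.root = 0 := by
  by_contra h0
  have h3 : (e T.root : ℕ) ≠ 0 := fun h => h0 (Fin.ext h)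
  have h4 := (e T.root).2
  refine T.not_edge_root (e.symm ⟨e T.root - 1, by omega⟩) ((h _ _).2 ?_)
  rw [Equiv.apply_symm_apply]
  exact Nat.sub_add_cancel (Nat.pos_of_ne_zero h3)

theorem exists_isPath (h : ∀ a b, T.Edge a b ↔ (e a : ℕ) + 1 = e b) : ∃ W, IsPath T e W := by
  classical
  have hu : ∀ a b a' b' (h₁ : T.Edge a b) (h₂ : T.Edge a' b'), (e a' : ℕ) = e a →
      T.slope h₁ = T.slope h₂ := by
    intro a b a' b' h₁ h₂ ha
    have hb : (e b' : ℕ) = e b := by rw [← (h _ _).1 h₁, ← (h _ _).1 h₂, ha]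
    obtain rfl := e.injective (Fin.ext ha)
    obtain rfl := e.injective (Fin.ext hb)
    rfl
  refine ⟨fun i => if h : ∃ a b, ∃ _ : T.Edge a b, (e a : ℕ) = i then
    T.slope h.choose_spec.choose_spec.choose else .slant, h, fun a b hab => ?_⟩
  have hex : ∃ a' b', ∃ _ : T.Edge a' b', (e a' : ℕ) = e a := ⟨a, b, hab, rfl⟩
  simp only [dif_pos hex]
  exact hu _ _ _ _ _ _ hex.choose_spec.choose_spec.choose_spec

variable {e}

theorem IsPath.edgeWithSlope_iff {W : ℕ → Slope} (h : IsPath T e W) (s : Slope) (a b : T.Vertex) :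
    T.EdgeWithSlope s a b ↔ (e a : ℕ) + 1 = e b ∧ W (e a) = s := by
  constructor
  · rintro ⟨h1, h2⟩
    exact ⟨(h.edge a b).1 h1, by rw [← h.slope a b h1, h2]⟩
  · rintro ⟨h1, h2⟩
    exact ⟨(h.edge a b).2 h1, by rw [h.slope, h2]⟩

theorem IsPath.transGen_iff {W : ℕ → Slope} (h : IsPath T e W) (s : Slope) (a b : T.Vertex) :
    Relation.TransGen (T.EdgeWithSlope s) a b ↔
      (e a : ℕ) < e b ∧ ∀ i, (e a : ℕ) ≤ i → i < e b → W i = s := by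
  constructor
  · intro hab
    induction hab with
    | single h1 =>
      obtain ⟨h2, h3⟩ := (h.edgeWithSlope_iff s _ _).1 h1
      refine ⟨by omega, fun i hi hib => ?_⟩
      rw [show i = e a by omega, h3]
    | tail _ h1 ih =>
      obtain ⟨h2, h3⟩ := (h.edgeWithSlope_iff s _ _).1 h1
      refine ⟨by omega, fun i hi hib => ?_⟩
      rename_i c d _
      rcases Nat.lt_or_ge i (e c) with h4 | h4
      · exact ih.2 i hi h4
      · rw [show i = e c by omega, h3]
  · rintro ⟨hab, hW⟩
    obtain ⟨n, hn⟩ : ∃ n, (e b : ℕ) = e a + n + 1 := ⟨e b - e a - 1, by omega⟩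
    clear hab
    induction n generalizing b with
    | zero =>
      exact .single ((h.edgeWithSlope_iff s _ _).2 ⟨by omega, hW _ le_rfl (by omega)⟩)
    | succ n ih =>
      have hlt : (e a : ℕ) + n + 1 < N + 1 := by have := (e b).2; omega
      have he : (e (e.symm ⟨e a + n + 1, hlt⟩) : ℕ) = e a + n + 1 := by simp
      refine .tail (ih (e.symm ⟨e a + n + 1, hlt⟩) (fun i hi hib => hW i hi (by omega)) he)
        ((h.edgeWithSlope_iff s _ _).2 ⟨by omega, ?_⟩)
      rw [he]
      exact hW _ (by omega) (by omega)

theorem IsPath.isLShape_iff {W : ℕ → Slope} (h : IsPath T e W) (s : Slope) (a b : T.Vertex) :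
    T.IsLShape s a b ↔ LShapeAt W s (e a) (e b) := by
  refine or_congr (h.edge a b) ⟨?_, ?_⟩
  · rintro ⟨c, h1, h2, h3⟩
    rw [h.transGen_iff] at h3
    rw [h.slope] at h2
    have h4 := (h.edge a c).1 h1
    exact ⟨by omega, h2, fun i hi hib => h3.2 i (by omega) hib⟩
  · rintro ⟨h1, h2, h3⟩
    have hlt : (e a : ℕ) + 1 < N + 1 := by have := (e b).2; omega
    have he : (e (e.symm ⟨e a + 1, hlt⟩) : ℕ) = e a + 1 := by simp
    refine ⟨e.symm ⟨e a + 1, hlt⟩, (h.edge _ _).2 he.symm, by rwa [h.slope], ?_⟩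
    rw [h.transGen_iff, he]
    exact ⟨h1, fun i hi hib => h3 i (by omega) hib⟩

end Path

variable {D : List Direction}

theorem proximate_take {b : ℕ} (hb : b ≤ D.length) (k : InfNearPoint) :
    Proximate (D.take b) k ↔ ∃ a, ProxAt D b a ∧ k = D.take a := by
  constructor
  · intro h
    obtain ⟨d, s, h1, -⟩ := id h
    have hk : k <+: D := (h1 ▸ List.prefix_append k _ : k <+: D.take b).trans (D.take_prefix b)
    have hk' := List.prefix_iff_eq_take.1 hk
    exact ⟨k.length, (proximate_take_iff hk.length_le hb).1 (hk' ▸ h), hk'⟩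
  · rintro ⟨a, h, rfl⟩
    exact (proximate_take_iff (by have := h.1; omega) hb).2 h

theorem take_inj {a b : ℕ} (ha : a ≤ D.length) (hb : b ≤ D.length) :
    D.take a = D.take b ↔ a = b := by
  refine ⟨fun h => ?_, fun h => by rw [h]⟩
  have := congrArg List.length h
  simpa [ha, hb] using this

theorem isSatellite_take_iff {b : ℕ} (hb : b ≤ D.length) :
    IsSatellite (D.take b) ↔ SatAt D b := by
  constructor
  · rintro ⟨k, k', hne, h, h'⟩
    obtain ⟨a, ha, rfl⟩ := (proximate_take hb k).1 h
    obtain ⟨a', ha', rfl⟩ := (proximate_take hb k').1 h'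
    rcases lt_trichotomy a a' with h | h | h
    · exact ⟨a, by have := ha'.1; omega, ha⟩
    · exact absurd (by rw [h]) hne
    · exact ⟨a', by have := ha.1; omega, ha'⟩
  · rintro ⟨a, hab, h⟩
    refine ⟨D.take a, D.take (b - 1), ?_, (proximate_take hb _).2 ⟨a, h, rfl⟩,
      (proximate_take hb _).2 ⟨b - 1, ?_, rfl⟩⟩
    · rw [Ne, take_inj (by omega) (by omega)]; omega
    · have := proxAt_succ D (b - 1)
      rwa [show b - 1 + 1 = b by omega] at this

theorem isFree_take_iff {b : ℕ} (hb : b ≤ D.length) :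
    IsFree (D.take b) ↔ 0 < b ∧ ¬ SatAt D b := by
  constructor
  · rintro ⟨k, hk, hu⟩
    obtain ⟨a, ha, rfl⟩ := (proximate_take hb k).1 hk
    refine ⟨by have := ha.1; omega, fun hs => ?_⟩
    obtain ⟨k, k', hne, h, h'⟩ := (isSatellite_take_iff hb).2 hs
    exact hne ((hu k h).trans (hu k' h').symm)
  · rintro ⟨h0, hs⟩
    refine ⟨D.take (b - 1), (proximate_take hb _).2 ⟨b - 1, ?_, rfl⟩, fun k hk => ?_⟩
    · have := proxAt_succ D (b - 1)
      rwa [show b - 1 + 1 = b by omega] at this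
    · obtain ⟨a, ha, rfl⟩ := (proximate_take hb k).1 hk
      have h1 := ha.1
      have h2 : ¬ a + 1 < b := fun h2 => hs ⟨a, h2, ha⟩
      rw [show a = b - 1 by omega]

/-- The condition for an edge between two points of a chain: the second one is the successor of the
first one. -/
theorem edge_take_iff {a b : ℕ} (ha : a ≤ D.length) (hb : b ≤ D.length) :
    (Proximate (D.take b) (D.take a) ∧ (IsFree (D.take b) ∨
      ∃ k, k ≠ D.take a ∧ k <+: D.take a ∧ Proximate (D.take b) k)) ↔ a + 1 = b := by
  rw [proximate_take_iff ha hb, isFree_take_iff hb]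
  constructor
  · rintro ⟨h1, ⟨-, h2⟩ | ⟨k, hk, hka, hp⟩⟩
    · by_contra h3
      exact h2 ⟨a, by have := h1.1; omega, h1⟩
    · obtain ⟨c, hc, rfl⟩ := (proximate_take hb k).1 hp
      have hcb := hc.1
      have hl := hka.length_le
      rw [List.length_take_of_le (by omega), List.length_take_of_le ha] at hl
      refine hc.eq_of_lt h1 (lt_of_le_of_ne hl ?_)
      rintro rfl
      exact hk rfl
  · rintro rfl
    refine ⟨proxAt_succ D a, ?_⟩
    by_cases hs : SatAt D (a + 1)
    · right
      obtain ⟨c, hc, hp⟩ := hs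
      refine ⟨D.take c, ?_, List.take_prefix_take_left (by omega),
        (proximate_take hb _).2 ⟨c, hp, rfl⟩⟩
      rw [Ne, take_inj (by omega) ha]; omega
    · exact Or.inl ⟨by omega, hs⟩

/-- The points of the chain with the directions `D`, numbered. -/
theorem exists_equiv_prefixes {K : Finset InfNearPoint} (hK : ∀ l, l ∈ K ↔ l <+: D) {N : ℕ}
    (hN : N = D.length) : ∃ E : {l : InfNearPoint // l ∈ K} ≃ Fin (N + 1),
      ∀ l : {l : InfNearPoint // l ∈ K}, (l : InfNearPoint) = D.take (E l) := by
  subst hN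
  have hlen : ∀ l : {l : InfNearPoint // l ∈ K}, l.1.length < D.length + 1 := fun l =>
    Nat.lt_succ_of_le ((hK l).1 l.2).length_le
  refine ⟨⟨fun l => ⟨l.1.length, hlen l⟩, fun i => ⟨D.take i, (hK _).2 (D.take_prefix i)⟩,
    fun l => Subtype.ext (List.prefix_iff_eq_take.1 ((hK l).1 l.2)).symm, fun i => ?_⟩,
    fun l => List.prefix_iff_eq_take.1 ((hK l).1 l.2)⟩
  ext
  simp only [List.length_take]
  exact min_eq_left (Nat.le_of_lt_succ i.2)

theorem isIso_toEnriquesTree_iff {T : EnriquesTree} (w : List Slope) :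
    T.IsIso (⟨w⟩ : UnibranchTree).toEnriquesTree ↔
      ∃ e : T.Vertex ≃ Fin (w.length + 1), IsPath T e fun i => w.getD i .slant := by
  have hs : ∀ (a b : Fin (w.length + 1)) (h' : (⟨w⟩ : UnibranchTree).toEnriquesTree.Edge a b),
      (⟨w⟩ : UnibranchTree).toEnriquesTree.slope h' = w.getD a .slant := by
    intro a b h'
    have h1 : (a : ℕ) + 1 = b := h'
    rw [List.getD_eq_getElem _ _ (by have := b.2; omega)]
    rfl
  constructor
  · rintro ⟨e, -, h1, h2⟩
    exact ⟨e, h1, fun a b h => (h2 a b h ((h1 a b).1 h)).trans (hs _ _ _)⟩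
  · rintro ⟨e, h1, h2⟩
    refine ⟨e, ?_, h1, fun a b h h' => (h2 a b h).trans (hs _ _ h').symm⟩
    exact root_eq e h1

/-- The Enriques tree of a chain of points is a path, the slopes of which are given by the
directions. -/
theorem isEnriquesTreeOf_iff {K : Finset InfNearPoint} (hK : ∀ l, l ∈ K ↔ l <+: D)
    (T : EnriquesTree) : IsEnriquesTreeOf K T ↔
      T.IsIso (⟨slopeWord .none D⟩ : UnibranchTree).toEnriquesTree := by
  have hN := length_slopeWord D .none
  obtain ⟨E, hE⟩ := exists_equiv_prefixes hK hN
  have hmark := isMarking_edgeSlope D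
  have hle : ∀ i : Fin ((slopeWord .none D).length + 1), (i : ℕ) ≤ D.length := fun i => by
    have := i.2; omega
  have hw : ∀ i < D.length, (slopeWord .none D).getD i .slant =
      edgeSlope ((stateAt D i).next (dirAt D i)) (dirAt D i) := fun i hi => by
    rw [List.getD_eq_getElem _ _ (by omega), getElem_slopeWord]; rfl
  rw [isIso_toEnriquesTree_iff]
  constructor
  · rintro ⟨e, he⟩
    refine ⟨e.trans E, ?_⟩
    have hev : ∀ v, (e v : InfNearPoint) = D.take (e.trans E v) := fun v => hE _
    have hedge : ∀ a b, T.Edge a b ↔ (e.trans E a : ℕ) + 1 = e.trans E b := fun a b => by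
      rw [he.edge, hev, hev, edge_take_iff (hle _) (hle _)]
    obtain ⟨W, hW⟩ := exists_isPath (e.trans E) hedge
    have hvert : ∀ i < D.length + 1, ∃ v, (e.trans E v : ℕ) = i := fun i hi =>
      ⟨(e.trans E).symm ⟨i, by omega⟩, by simp⟩
    have hWm : IsMarking D W := by
      refine isMarking_of_lShapeAt (fun i hi => ?_) (fun i hi h1 h2 => ?_) (fun a b hb h => ?_)
      · obtain ⟨v, rfl⟩ := hvert i (by omega)
        obtain ⟨v', hv'⟩ := hvert (e.trans E v + 1) (by omega)
        have h := (hedge v v').2 hv'.symm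
        rw [← hv', ← isSatellite_take_iff (hle _), ← hev, ← he.satellite v v' h, hW.slope]
        cases W (e.trans E v) <;> simp
      · obtain ⟨v, rfl⟩ := hvert i (by omega)
        obtain ⟨v', hv'⟩ := hvert (e.trans E v + 1) (by omega)
        have h := (hedge v v').2 hv'.symm
        rw [← hW.slope v v' h]
        refine he.normalized v v' h ?_ ?_
        · rw [hev, isFree_take_iff (hle _)]
          exact ⟨by have := h2.one_lt; omega, h1⟩
        · rwa [hev, isSatellite_take_iff (hle _), hv']
      · obtain ⟨v, rfl⟩ := hvert a (by have := h.1; omega)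
        obtain ⟨v', rfl⟩ := hvert b (by omega)
        rw [← hW.isLShape_iff, ← hW.isLShape_iff, he.lshape, hev, hev,
          proximate_take_iff (hle _) (hle _)]
        exact h
    refine ⟨hedge, fun a b h => ?_⟩
    have h1 := (hedge a b).1 h
    have h2 := hle (e.trans E b)
    rw [hW.slope, hw _ (by omega)]
    exact hWm.eq hmark _ (by omega)
  · rintro ⟨e, hP⟩
    have hroot := root_eq e hP.edge
    refine ⟨e.trans E.symm, ?_⟩
    have hev : ∀ v, ((e.trans E.symm) v : InfNearPoint) = D.take (e v) :=
      fun v => by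
        rw [hE]; simp
    have hWm : IsMarking D fun i => (slopeWord .none D).getD i .slant := by
      refine ⟨fun i hi => ?_, fun i hi => ?_, fun i hi => ?_⟩
      · rw [hw i hi]; exact hmark.sat i hi
      · rw [hw i (by omega), hw (i + 1) hi]; exact hmark.turn i hi
      · rw [hw i hi]; exact hmark.start i hi
    refine ⟨?_, fun a b => ?_, fun a b => ?_, fun a b h => ?_, fun a b h h1 h2 => ?_⟩
    · rw [hev, hroot]; rfl
    · rw [hev, hev, edge_take_iff (hle _) (hle _), hP.edge]
    · rw [hev, hev, proximate_take_iff (hle _) (hle _), hP.isLShape_iff, hP.isLShape_iff,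
        hWm.lShapeAt_iff (hle _)]
    · have h1 := (hP.edge a b).1 h
      have h2 := hle (e b)
      rw [hev, isSatellite_take_iff (hle _), hP.slope, ← h1, ← hWm.sat _ (by omega)]
      cases (slopeWord .none D).getD (e a) .slant <;> simp
    · have h3 := (hP.edge a b).1 h
      have h4 := hle (e b)
      rw [hev, isFree_take_iff (hle _)] at h1
      rw [hev, isSatellite_take_iff (hle _), ← h3] at h2
      rw [hP.slope]
      exact hWm.start _ (by omega) h1.2 h2

/-! ### The words along the blowings up -/

/-- The slopes of the edges from a point at which the branch is `(t ^ a * W₁, t ^ b * W₂)` and at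
most one exceptional curve, `x = 0`, passes through the point. If `a ∣ b`, then the tangent will be
transversal to both axes after `b / a` points, and the next characteristic exponent comes in. -/
noncomputable def baseWord (g : ℕ) (β : ℕ → ℕ) (j θ b a : ℕ) : List Slope :=
  open Classical in
  if a ∣ b then (blockWord 0 (b + (β (j + 1) - θ)) a).dropLast ++ stageWord g β (j + 1)
  else (blockWord 0 b a).dropLast ++ stageWord g β j

/-- The condition on the orders at a point with at most one exceptional curve, `x = 0`. -/
def IsBase (g : ℕ) (β : ℕ → ℕ) (j θ b a : ℕ) : Prop := (a ∣ b ∧ j < g) ∨ (¬ a ∣ b ∧ θ = β j)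

section Words

variable {g : ℕ} {β : ℕ → ℕ} {j θ a b : ℕ}

theorem IsBase.two_le (hβ : IsCharSeq g β) (hgcd : Nat.gcd a b = charGcd β (j + 1)) (ha : 0 < a)
    (h : IsBase g β j θ b a) : 2 ≤ a := by
  by_contra h1
  obtain rfl : a = 1 := by omega
  rcases h with ⟨-, hj⟩ | ⟨h, -⟩
  · apply hβ.not_dvd (j + 1) (by omega) hj
    rw [← hgcd, Nat.gcd_one_left]
    exact one_dvd _
  · exact h (one_dvd b)

theorem IsBase.baseWord_of_lt (ha : 0 < a) (hab : a < b)
    (h : IsBase g β j θ b a) : IsBase g β j θ (b - a) a ∧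
      baseWord g β j θ b a = .slant :: baseWord g β j θ (b - a) a := by
  have hd : a ∣ b - a ↔ a ∣ b := by rw [Nat.dvd_sub_self_right]; omega
  refine ⟨by rwa [IsBase, hd], ?_⟩
  rcases h with ⟨h, hj⟩ | ⟨h, -⟩
  · rw [baseWord, baseWord, if_pos h, if_pos (hd.2 h), dropLast_blockWord_of_le 0 ha (by omega),
      show b + (β (j + 1) - θ) - a = b - a + (β (j + 1) - θ) by omega]
    rfl
  · rw [baseWord, baseWord, if_neg h, if_neg (mt hd.1 h), dropLast_blockWord_of_le 0 ha hab]
    rfl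

theorem IsBase.baseWord_of_gt (hb : 0 < b) (hba : b < a) (h : IsBase g β j θ b a) : θ = β j ∧
    baseWord g β j θ b a = euclidWord .horizontal .vertical a b ++ stageWord g β j := by
  have hd : ¬ a ∣ b := Nat.not_dvd_of_pos_of_lt hb hba
  rcases h with ⟨h, -⟩ | ⟨-, h⟩
  · exact absurd h hd
  · refine ⟨h, ?_⟩
    rw [baseWord, if_neg hd, blockWord_of_lt 0 hba, dropLast_blockWord_eq le_rfl (by omega) hb]
    simp [blockSlope]

theorem baseWord_self (hθ : IsShift g β j θ) (hj : j < g) (ha : 0 < a)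
    (hgcd : a = charGcd β (j + 1)) :
    baseWord g β j θ a a = .slant :: freshWord g β j θ := by
  have := hθ.2 hj
  rw [baseWord, if_pos dvd_rfl, dropLast_blockWord_of_le 0 ha (by omega), Nat.add_sub_cancel_left,
    freshWord, ← hgcd]
  rfl

/-- The word at a point with the exceptional axes `s` at which the branch is
`(t ^ a * W₁, t ^ b * W₂)`. -/
def IsWordAt (g : ℕ) (β : ℕ → ℕ) (j θ a b : ℕ) (s : AxisState) (w : List Slope) : Prop :=
  match s with
  | .none => (a ≤ b ∧ IsBase g β j θ b a ∧ w = baseWord g β j θ b a) ∨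
      (b ≤ a ∧ IsBase g β j θ a b ∧ w = baseWord g β j θ a b)
  | .xAxis => IsBase g β j θ b a ∧ w = baseWord g β j θ b a
  | .yAxis => IsBase g β j θ a b ∧ w = baseWord g β j θ a b
  | .both true => θ = β j ∧ w = euclidWord .horizontal .vertical a b ++ stageWord g β j
  | .both false => θ = β j ∧ w = euclidWord .vertical .horizontal a b ++ stageWord g β j

variable {s : AxisState} {w : List Slope}

theorem IsWordAt.of_lt (ha : 0 < a) (hab : a < b)
    (h : IsWordAt g β j θ a b s w) : ∃ w',
      w = edgeSlope (s.next (OnePoint.some 0)) (OnePoint.some 0) :: w' ∧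
      IsWordAt g β j θ a (b - a) (s.next (OnePoint.some 0)) w' := by
  have hx : ∀ w, IsBase g β j θ b a → w = baseWord g β j θ b a →
      ∃ w', w = .slant :: w' ∧ IsWordAt g β j θ a (b - a) .xAxis w' := fun w h1 h2 =>
    ⟨_, h2.trans (h1.baseWord_of_lt ha hab).2, (h1.baseWord_of_lt ha hab).1, rfl⟩
  rcases s with _ | _ | _ | σ
  · rcases h with ⟨-, h1, h2⟩ | ⟨h1, -⟩
    · exact hx w h1 h2
    · omega
  · exact hx w h.1 h.2
  · obtain ⟨h1, h2⟩ := h.1.baseWord_of_gt ha hab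
    simp only [AxisState.next, if_true]
    refine ⟨euclidWord .vertical .horizontal a (b - a) ++ stageWord g β j, ?_, h1, rfl⟩
    rw [h.2, h2, euclidWord_comm, euclidWord_of_lt _ _ ha hab]
    rfl
  · simp only [AxisState.next, if_true]
    cases σ <;> obtain ⟨h1, rfl⟩ := h
    · exact ⟨_, by rw [euclidWord_of_lt _ _ ha hab]; rfl, h1, rfl⟩
    · exact ⟨_, by rw [euclidWord_of_lt _ _ ha hab]; rfl, h1, rfl⟩

theorem IsWordAt.of_gt (hb : 0 < b) (hba : b < a)
    (h : IsWordAt g β j θ a b s w) : ∃ w',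
      w = edgeSlope (s.next OnePoint.infty) OnePoint.infty :: w' ∧
      IsWordAt g β j θ (a - b) b (s.next OnePoint.infty) w' := by
  have hy : ∀ w, IsBase g β j θ a b → w = baseWord g β j θ a b →
      ∃ w', w = .slant :: w' ∧ IsWordAt g β j θ (a - b) b .yAxis w' := fun w h1 h2 =>
    ⟨_, h2.trans (h1.baseWord_of_lt hb hba).2, (h1.baseWord_of_lt hb hba).1, rfl⟩
  rcases s with _ | _ | _ | σ
  · rcases h with ⟨h1, -⟩ | ⟨-, h1, h2⟩
    · omega
    · exact hy w h1 h2
  · obtain ⟨h1, h2⟩ := h.1.baseWord_of_gt hb hba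
    refine ⟨euclidWord .horizontal .vertical (a - b) b ++ stageWord g β j, ?_, h1, rfl⟩
    rw [h.2, h2, euclidWord_of_gt _ _ hb hba]
    rfl
  · exact hy w h.1 h.2
  · cases σ <;> obtain ⟨h1, rfl⟩ := h
    · exact ⟨_, by rw [euclidWord_of_gt _ _ hb hba]; rfl, h1, rfl⟩
    · exact ⟨_, by rw [euclidWord_of_gt _ _ hb hba]; rfl, h1, rfl⟩

theorem IsWordAt.self (hβ : IsCharSeq g β) (hθ : IsShift g β j θ) (ha : 0 < a)
    (hgcd : a = charGcd β (j + 1)) (hj : j < g) (h : IsWordAt g β j θ a a s w) :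
    w = .slant :: freshWord g β j θ := by
  have h0 := baseWord_self hθ hj ha hgcd
  rcases s with _ | _ | _ | σ
  · rcases h with ⟨-, -, rfl⟩ | ⟨-, -, rfl⟩ <;> exact h0
  · exact h.2.trans h0
  · exact h.2.trans h0
  · cases σ <;> obtain ⟨h1, rfl⟩ := h <;>
    rw [euclidWord_self, List.nil_append, stageWord_eq_cons hβ hj, h1]

theorem IsWordAt.self_last (h : IsWordAt g β g θ a a s w) : w = [] := by
  have h0 : ¬ IsBase g β g θ a a := by
    rintro (⟨-, h⟩ | ⟨h, -⟩)
    · exact lt_irrefl _ h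
    · exact h dvd_rfl
  rcases s with _ | _ | _ | σ
  · rcases h with ⟨-, h, -⟩ | ⟨-, h, -⟩ <;> exact absurd h h0
  · exact absurd h.1 h0
  · exact absurd h.1 h0
  · cases σ <;> obtain ⟨-, rfl⟩ := h <;> rw [euclidWord_self, stageWord_self] <;> rfl

end Words

/-! ### The bad points -/

/-- The bad points that are equal or infinitely near to a point, with the total transform `T` and
the strict transform `S` there, form a chain, the edges of which have the slopes `w`. -/
def HasBadChain (T S : Germ) (s : AxisState) (w : List Slope) : Prop :=
  ∃ D : List Direction, (∀ l, IsBad (totalTransformAt l T) (strictTransformAt l S) ↔ l <+: D) ∧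
    slopeWord s D = w

theorem HasBadChain.nil {T S : Germ} (s : AxisState) (h0 : IsBad T S)
    (h : ∀ d, IsMonomialPair (pullback d T) (strictTransform d S) ∨
      IsTransversalPair (pullback d T) (strictTransform d S)) : HasBadChain T S s [] := by
  refine ⟨[], fun l => ?_, rfl⟩
  rw [List.prefix_nil]
  obtain _ | ⟨d, l⟩ := l
  · exact iff_of_true h0 rfl
  · refine iff_of_false ?_ (by simp)
    rcases h d with h | h
    · exact (h.transformAt l).not_isBad
    · exact h.transformAt l

theorem HasBadChain.cons {T S : Germ} {s : AxisState} {w : List Slope} (h0 : IsBad T S)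
    (d : Direction) (h : ∀ d', d' ≠ d → IsMonomialPair (pullback d' T) (strictTransform d' S))
    (hd : HasBadChain (pullback d T) (strictTransform d S) (s.next d) w) :
    HasBadChain T S s (edgeSlope (s.next d) d :: w) := by
  obtain ⟨D, hD, rfl⟩ := hd
  refine ⟨d :: D, fun l => ?_, rfl⟩
  obtain _ | ⟨d', l⟩ := l
  · exact iff_of_true h0 (List.nil_prefix)
  · rw [List.cons_prefix_cons]
    by_cases hdd : d' = d
    · subst hdd
      exact (hD l).trans (by simp)
    · exact iff_of_false ((h d' hdd).transformAt l).not_isBad fun h => hdd h.1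

/-- At a point, the curve `S = 0` is the branch `(t ^ a * W₁, t ^ b * W₂)`, the exceptional curves
are among the axes, with the multiplicities `A` and `B` in the total transform, and the shift of the
characteristic exponents is `θ`, in the stage `j`. -/
structure IsBranchAt (g : ℕ) (β : ℕ → ℕ) (j θ a b : ℕ) (W₁ W₂ : PowerSeries ℂ) (T S w : Germ)
    (A B : ℕ) : Prop where
  le : j ≤ g
  left_pos : 0 < a
  right_pos : 0 < b
  left_unit : PowerSeries.constantCoeff W₁ ≠ 0
  right_unit : PowerSeries.constantCoeff W₂ ≠ 0
  param : HasParam S (PowerSeries.X ^ a * W₁) (PowerSeries.X ^ b * W₂)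
  yOrder : HasYOrder S a
  unit : constantCoeff w ≠ 0
  total : T = w * X 0 ^ A * X 1 ^ B * S
  shift : IsShift g β j θ
  pair : IsLacunaryPair g β j θ a b W₁ W₂
  gcd : Nat.gcd a b = charGcd β (j + 1)

/-- The exceptional axes are those in `s`, where `A` and `B` are the multiplicities of `x = 0` and
`y = 0` in the total transform. -/
def AxisState.Multiplicities : AxisState → ℕ → ℕ → Prop
  | .none, A, B => A = 0 ∧ B = 0
  | .xAxis, A, B => 0 < A ∧ B = 0
  | .yAxis, A, B => A = 0 ∧ 0 < B
  | .both _, A, B => 0 < A ∧ 0 < B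

theorem AxisState.Multiplicities.next_zero {s : AxisState} {A B a : ℕ}
    (h : s.Multiplicities A B) (ha : 0 < a) :
    (s.next (OnePoint.some 0)).Multiplicities (A + B + a) B := by
  rcases s with _ | _ | _ | σ <;> obtain ⟨h1, h2⟩ := h <;>
    simp only [AxisState.next, if_true] <;> exact ⟨by omega, h2⟩

theorem AxisState.Multiplicities.next_infty {s : AxisState} {A B b : ℕ}
    (h : s.Multiplicities A B) (hb : 0 < b) :
    (s.next OnePoint.infty).Multiplicities A (A + B + b) := by
  rcases s with _ | _ | _ | σ <;> obtain ⟨h1, h2⟩ := h <;> exact ⟨h1, by omega⟩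

theorem AxisState.next_of_ne_zero (s : AxisState) {c : ℂ} (hc : c ≠ 0) :
    s.next (OnePoint.some c) = .xAxis := by
  cases s <;> simp [AxisState.next, hc]

section Branch

variable {g : ℕ} {β : ℕ → ℕ} {j θ a b : ℕ} {W₁ W₂ : PowerSeries ℂ} {T S w : Germ} {A B : ℕ}

theorem IsBranchAt.xOrder (h : IsBranchAt g β j θ a b W₁ W₂ T S w A B) : HasXOrder S b :=
  h.param.hasXOrder h.left_pos h.right_pos ⟨W₁, h.left_unit, rfl⟩ ⟨W₂, h.right_unit, rfl⟩ h.yOrder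

theorem IsBranchAt.isBad (hβ : IsCharSeq g β) (h : IsBranchAt g β j θ a b W₁ W₂ T S w A B)
    {s : AxisState} (hs : s.Multiplicities A B) {v : List Slope} (hv : IsWordAt g β j θ a b s v) :
    IsBad T S := by
  have ha := h.left_pos
  have hb := h.right_pos
  have hT := h.total
  rcases s with _ | _ | _ | σ <;> obtain ⟨h1, h2⟩ := hs
  · left
    rcases hv with ⟨hle, hv, -⟩ | ⟨hle, hv, -⟩
    · have := hv.two_le hβ h.gcd ha
      exact isSingular_of_two_le this (by omega) h.yOrder h.xOrder
    · have := hv.two_le hβ ((Nat.gcd_comm _ _).trans h.gcd) hb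
      exact isSingular_of_two_le (by omega) this h.yOrder h.xOrder
  · rw [h2, pow_zero, mul_one] at hT
    exact isBad_of_two_le h1 h.unit hT (hv.1.two_le hβ h.gcd ha) h.yOrder
  · rw [h1, pow_zero, mul_one] at hT
    exact isBad_of_two_le' h2 h.unit hT (hv.1.two_le hβ ((Nat.gcd_comm _ _).trans h.gcd) hb)
      h.xOrder
  · exact isBad_of_axes h1 h2 h.unit hT ha h.yOrder h.xOrder

/-- The blowing up of a point at which the tangent of the branch is `y = 0`. -/
theorem IsBranchAt.blowUp_zero (hβ : IsCharSeq g β)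
    (h : IsBranchAt g β j θ a b W₁ W₂ T S w A B) (hab : a < b) :
    (∃ W₂' w', IsBranchAt g β j θ a (b - a) W₁ W₂' (pullback (OnePoint.some 0) T)
      (strictTransform (OnePoint.some 0) S) w' (A + B + a) B) ∧
    ∀ d, d ≠ OnePoint.some 0 → IsMonomialPair (pullback d T) (strictTransform d S) := by
  obtain ⟨c, rfl⟩ : ∃ c, b = c + a := ⟨b - a, by omega⟩
  obtain ⟨Z, rfl⟩ : ∃ Z, W₂ = W₁ * Z :=
    ⟨W₁⁻¹ * W₂, by rw [← mul_assoc, PowerSeries.mul_inv_cancel _ h.left_unit, one_mul]⟩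
  have hZ : PowerSeries.constantCoeff Z ≠ 0 := fun hZ =>
    h.right_unit (by rw [map_mul, hZ, mul_zero])
  have hc : 0 < c := by omega
  have hp := h.param
  rw [show PowerSeries.X ^ (c + a) * (W₁ * Z) = PowerSeries.X ^ a * W₁ *
    (PowerSeries.C (0 : ℂ) + PowerSeries.X ^ c * Z) by rw [map_zero, zero_add]; ring] at hp
  obtain ⟨G, hG, hGo, hGp⟩ := hp.exists_pullback_some h.left_pos ⟨W₁, h.left_unit, rfl⟩
    (by simp [hc.ne']) h.yOrder
  have hst : strictTransform (OnePoint.some 0) S = G := strictTransform_eq hG hGo.not_X0_dvd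
  refine ⟨⟨Z, pullback (OnePoint.some 0) w, ?_⟩, fun d hd => ?_⟩
  · rw [hst, Nat.add_sub_cancel]
    refine ⟨h.le, h.left_pos, hc, h.left_unit, hZ, hGp, hGo,
      by rw [constantCoeff_pullback]; exact h.unit, ?_, h.shift, h.pair.div hβ h.shift h.left_unit,
      ?_⟩
    · rw [h.total]
      simp only [pullback_mul, pullback_pow]
      rw [pullback_some_X0, pullback_some_X1, hG, map_zero, add_zero]
      ring
    · rw [← h.gcd, Nat.gcd_add_self_right]
  · obtain ⟨U, hU, hU'⟩ := exists_pullback_eq_of_ne hG hGo.1 hGo.2 d hd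
    exact isMonomialPair_of_pullback h.unit h.total hU hU'

/-- The blowing up of a point at which the tangent of the branch is `x = 0`. -/
theorem IsBranchAt.blowUp_infty (hβ : IsCharSeq g β)
    (h : IsBranchAt g β j θ a b W₁ W₂ T S w A B) (hba : b < a) :
    (∃ W₁' w', IsBranchAt g β j θ (a - b) b W₁' W₂ (pullback OnePoint.infty T)
      (strictTransform OnePoint.infty S) w' A (A + B + b)) ∧
    ∀ d, d ≠ OnePoint.infty → IsMonomialPair (pullback d T) (strictTransform d S) := by
  obtain ⟨c, rfl⟩ : ∃ c, a = c + b := ⟨a - b, by omega⟩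
  obtain ⟨Z, rfl⟩ : ∃ Z, W₁ = W₂ * Z :=
    ⟨W₂⁻¹ * W₁, by rw [← mul_assoc, PowerSeries.mul_inv_cancel _ h.right_unit, one_mul]⟩
  have hZ : PowerSeries.constantCoeff Z ≠ 0 := fun hZ =>
    h.left_unit (by rw [map_mul, hZ, mul_zero])
  have hc : 0 < c := by omega
  have hp := h.param
  rw [show PowerSeries.X ^ (c + b) * (W₂ * Z) = PowerSeries.X ^ b * W₂ *
    (PowerSeries.X ^ c * Z) by ring] at hp
  obtain ⟨G, hG, hGo, hGp⟩ := hp.exists_pullback_infty h.right_pos ⟨W₂, h.right_unit, rfl⟩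
    (by simp [hc.ne']) h.xOrder
  have hst : strictTransform OnePoint.infty S = G := strictTransform_eq hG hGo.not_X1_dvd
  refine ⟨⟨Z, pullback OnePoint.infty w, ?_⟩, fun d hd => ?_⟩
  · rw [hst, Nat.add_sub_cancel]
    refine ⟨h.le, hc, h.right_pos, hZ, h.right_unit, hGp,
      hGp.hasYOrder hc h.right_pos ⟨Z, hZ, rfl⟩ ⟨W₂, h.right_unit, rfl⟩ hGo,
      by rw [constantCoeff_pullback]; exact h.unit, ?_, h.shift,
      (h.pair.swap.div hβ h.shift h.right_unit).swap, ?_⟩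
    · rw [h.total]
      simp only [pullback_mul, pullback_pow]
      rw [pullback_infty_X0, pullback_infty_X1, hG]
      ring
    · rw [← h.gcd, Nat.gcd_add_self_left]
  · obtain ⟨U, hU, hU'⟩ := exists_pullback_eq_of_ne_infty hG hGo d hd
    exact isMonomialPair_of_pullback h.unit h.total hU hU'

/-- The blowing up of a point at which the tangent of the branch is neither `x = 0` nor `y = 0`. -/
theorem IsBranchAt.blowUp_diagonal (hβ : IsCharSeq g β)
    (h : IsBranchAt g β j θ a a W₁ W₂ T S w A B) :
    ∃ γ : ℂ, γ ≠ 0 ∧ (∃ (ψ : PowerSeries ℂ) (w' : Germ), PowerSeries.constantCoeff ψ = 0 ∧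
      IsFresh g β j θ W₁ ψ ∧
      HasParam (strictTransform (OnePoint.some γ) S) (PowerSeries.X ^ a * W₁) ψ ∧
      HasYOrder (strictTransform (OnePoint.some γ) S) a ∧ constantCoeff w' ≠ 0 ∧
      pullback (OnePoint.some γ) T =
        w' * X 0 ^ (A + B + a) * strictTransform (OnePoint.some γ) S) ∧
    ∀ d, d ≠ OnePoint.some γ → IsMonomialPair (pullback d T) (strictTransform d S) := by
  obtain ⟨Z, rfl⟩ : ∃ Z, W₂ = W₁ * Z :=
    ⟨W₁⁻¹ * W₂, by rw [← mul_assoc, PowerSeries.mul_inv_cancel _ h.left_unit, one_mul]⟩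
  set γ := PowerSeries.constantCoeff Z with hγ
  have hγ0 : γ ≠ 0 := fun hZ => h.right_unit (by rw [map_mul, ← hγ, hZ, mul_zero])
  have hp := h.param
  rw [show PowerSeries.X ^ a * (W₁ * Z) = PowerSeries.X ^ a * W₁ *
    (PowerSeries.C γ + (Z - PowerSeries.C γ)) by ring] at hp
  have hψ : PowerSeries.constantCoeff (Z - PowerSeries.C γ) = 0 := by simp [hγ]
  obtain ⟨G, hG, hGo, hGp⟩ := hp.exists_pullback_some h.left_pos ⟨W₁, h.left_unit, rfl⟩
    hψ h.yOrder
  have hst : strictTransform (OnePoint.some γ) S = G := strictTransform_eq hG hGo.not_X0_dvd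
  refine ⟨γ, hγ0, ⟨Z - PowerSeries.C γ, pullback (OnePoint.some γ) w * (X 1 + C γ) ^ B, hψ,
    h.pair.isFresh hβ h.shift h.left_unit γ, ?_, ?_, ?_, ?_⟩, fun d hd => ?_⟩
  · rwa [hst]
  · rwa [hst]
  · simpa [constantCoeff_pullback, h.unit] using fun h => absurd h hγ0
  · rw [h.total, hst]
    simp only [pullback_mul, pullback_pow]
    rw [pullback_some_X0, pullback_some_X1, hG, mul_pow]
    ring
  · obtain ⟨U, hU, hU'⟩ := exists_pullback_eq_of_ne hG hGo.1 hGo.2 d hd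
    exact isMonomialPair_of_pullback h.unit h.total hU hU'

/-- The branch at the point after a free one. -/
theorem exists_isBranchAt_of_isFresh (hβ : IsCharSeq g β) (hθ : IsShift g β j θ) (hj : j < g)
    (ha : a = charGcd β (j + 1)) (hW : PowerSeries.constantCoeff W₁ ≠ 0) {ψ : PowerSeries ℂ}
    (hψ : PowerSeries.constantCoeff ψ = 0) (h : IsFresh g β j θ W₁ ψ)
    (hp : HasParam S (PowerSeries.X ^ a * W₁) ψ) (hS : HasYOrder S a) (hw : constantCoeff w ≠ 0)
    (hT : T = w * X 0 ^ A * S) : ∃ j' θ' b W₂, ψ = PowerSeries.X ^ b * W₂ ∧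
      IsBranchAt g β j' θ' a b W₁ W₂ T S w A 0 ∧ IsBase g β j' θ' b a ∧
      baseWord g β j' θ' b a = freshWord g β j θ := by
  have hlt := hθ.2 hj
  have ha0 : 0 < a := ha ▸ charGcd_pos hβ.pos j
  have hT' : T = w * X 0 ^ A * X 1 ^ 0 * S := by rw [hT, pow_zero, mul_one]
  obtain ⟨b, W₂, hb, hW₂, rfl, ⟨h1, h2, h3⟩ | ⟨h1, h2⟩⟩ := h.exists_pair hβ hθ hj hW hψ
  · rw [← ha] at h1 h3
    refine ⟨j, θ + b, b, W₂, rfl, ⟨hj.le, ha0, hb, hW, hW₂, hp, hS, hw, hT',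
      ⟨?_, fun _ => h2⟩, h3, ?_⟩, Or.inl ⟨h1, hj⟩, ?_⟩
    · exact dvd_add hθ.1 (ha ▸ h1)
    · rw [Nat.gcd_eq_left h1, ha]
    · rw [baseWord, if_pos h1, freshWord, ← ha,
        show b + (β (j + 1) - (θ + b)) = β (j + 1) - θ by omega]
  · rw [← ha] at h2
    have hnd : ¬ a ∣ b := by
      intro hd
      apply hβ.not_dvd (j + 1) (by omega) hj
      rw [← h1]
      exact dvd_add hθ.1 (ha ▸ hd)
    refine ⟨j + 1, β (j + 1), b, W₂, rfl, ⟨hj, ha0, hb, hW, hW₂, hp, hS, hw, hT',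
      isShift_self hβ _, h2, ?_⟩, Or.inr ⟨hnd, rfl⟩, ?_⟩
    · obtain ⟨k, hk⟩ := hθ.1
      rw [charGcd, ← h1, hk, ← ha, Nat.gcd_mul_left_add_right]
    · rw [baseWord, if_neg hnd, freshWord, ← ha, show b = β (j + 1) - θ by omega]

end Branch

/-- The bad points form a chain, the slopes of which are given by the Puiseux characteristic. -/
theorem IsBranchAt.hasBadChain {g : ℕ} {β : ℕ → ℕ} (hβ : IsCharSeq g β) (v : List Slope) :
    ∀ {j θ a b : ℕ} {W₁ W₂ : PowerSeries ℂ} {T S w : Germ} {A B : ℕ} {s : AxisState},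
      IsBranchAt g β j θ a b W₁ W₂ T S w A B → s.Multiplicities A B →
      IsWordAt g β j θ a b s v → HasBadChain T S s v := by
  induction v with
  | nil =>
    intro j θ a b W₁ W₂ T S w A B s h hs hv
    have hbad := h.isBad hβ hs hv
    rcases lt_trichotomy a b with hab | rfl | hab
    · obtain ⟨v', h1, -⟩ := hv.of_lt h.left_pos hab
      simp at h1
    · have ha := h.gcd
      rw [Nat.gcd_self] at ha
      rcases Nat.lt_or_eq_of_le h.le with hj | rfl
      · have := hv.self hβ h.shift h.left_pos ha hj
        simp at this
      · obtain ⟨γ, -, ⟨ψ, w', -, -, -, h1, h2, h3⟩, h4⟩ := h.blowUp_diagonal hβ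
        refine HasBadChain.nil s hbad fun d => ?_
        by_cases hd : d = OnePoint.some γ
        · subst hd
          rw [ha, hβ.last] at h1
          right
          exact ⟨by rw [constantCoeff_eq_cf]; exact h1.1 0 one_pos, h1.2, w', _, h2, h3⟩
        · exact Or.inl (h4 d hd)
    · obtain ⟨v', h1, -⟩ := hv.of_gt h.right_pos hab
      simp at h1
  | cons x v ih =>
    intro j θ a b W₁ W₂ T S w A B s h hs hv
    have hbad := h.isBad hβ hs hv
    rcases lt_trichotomy a b with hab | rfl | hab
    · obtain ⟨v', h1, h2⟩ := hv.of_lt h.left_pos hab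
      obtain ⟨rfl, rfl⟩ := List.cons_eq_cons.1 h1
      obtain ⟨⟨W₂', w', h3⟩, h4⟩ := h.blowUp_zero hβ hab
      exact HasBadChain.cons hbad _ h4 (ih h3 (hs.next_zero h.left_pos) h2)
    · have ha := h.gcd
      rw [Nat.gcd_self] at ha
      rcases Nat.lt_or_eq_of_le h.le with hj | rfl
      · obtain ⟨rfl, rfl⟩ := List.cons_eq_cons.1 (hv.self hβ h.shift h.left_pos ha hj)
        obtain ⟨γ, hγ, ⟨ψ, w', h0, h1, h2, h3, h4, h5⟩, h6⟩ := h.blowUp_diagonal hβ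
        obtain ⟨j', θ', b', W₂', -, h7, h8, h9⟩ := exists_isBranchAt_of_isFresh hβ h.shift hj ha
          h.left_unit h0 h1 h2 h3 h4 h5
        have hn := s.next_of_ne_zero hγ
        have := HasBadChain.cons (s := s) hbad _ h6 (by
          rw [hn]
          exact ih h7 ⟨by have := h.left_pos; omega, rfl⟩ ⟨h8, h9.symm⟩)
        rwa [hn] at this
      · exact absurd hv.self_last (by simp)
    · obtain ⟨v', h1, h2⟩ := hv.of_gt h.right_pos hab
      obtain ⟨rfl, rfl⟩ := List.cons_eq_cons.1 h1
      obtain ⟨⟨W₂', w', h3⟩, h4⟩ := h.blowUp_infty hβ hab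
      exact HasBadChain.cons hbad _ h4 (ih h3 (hs.next_infty h.right_pos) h2)

/-! ### The minimal log resolution -/

/-- The bad points of a singular branch. -/
theorem hasBadChain_of_isUnibranch {f : Germ} (hf : IsUnibranch f) (hs : IsSingular f) {g : ℕ}
    {β : ℕ → ℕ} (h : IsPuiseuxCharacteristic f g β) :
    HasBadChain f f .none (stageWord g β 0) := by
  have hβ := h.isCharSeq
  obtain ⟨hm, y, hy, hy0, hfy, hl, hlast⟩ := h
  have hy00 : PowerSeries.constantCoeff y = 0 := by
    rw [← PowerSeries.coeff_zero_eq_constantCoeff_apply]; exact hy0 0 hm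
  have hprim := isPrimitiveParam_of_characteristic hm (fun j h1 h2 => (hl j h1 h2).1.1) hlast
  have hX : PowerSeries.constantCoeff (PowerSeries.X ^ β 0 : PowerSeries ℂ) = 0 := by
    simp [hm.ne']
  -- the case in which the first component is `t ^ m`; in the other one the axes are exchanged
  have main : ∀ S : Germ, IsUnibranch S → IsSingular S →
      evalAt (PowerSeries.X ^ β 0) y S = 0 → ∃ j θ b W₂, y = PowerSeries.X ^ b * W₂ ∧ β 0 ≤ b ∧
        IsBranchAt g β j θ (β 0) b 1 W₂ S S 1 0 0 ∧ IsBase g β j θ b (β 0) ∧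
        baseWord g β j θ b (β 0) = stageWord g β 0 := by
    intro S hSu hSs hev
    have hp : HasParam S (PowerSeries.X ^ β 0) y := ⟨hev, hprim⟩
    have hS := hasYOrder_of_isUnibranch hSu hm hy hy00 hp
    have hg : 0 < g := by
      rw [Nat.pos_iff_ne_zero]
      rintro rfl
      rw [zero_add, charGcd_one] at hlast
      rw [hlast] at hS
      -- a curve of multiplicity one is smooth
      exact hS.2 ((isSingular_iff S).1 hSs).2.2
    have hfresh : IsFresh g β 0 0 1 y := by
      intro i hi hig
      have h1 := hl i hi hig
      refine ⟨fun k _ hk => ?_, fun k hk hik => ?_, by rw [Nat.sub_zero]; exact h1.1.1⟩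
      · rw [PowerSeries.coeff_one, if_neg]
        rintro rfl
        exact hk (dvd_zero _)
      · by_contra h2
        have := h1.2 ⟨h2, hik⟩
        omega
    rw [← mul_one (PowerSeries.X ^ β 0)] at hp
    obtain ⟨j, θ, b, W₂, h1, h2, h3, h4⟩ := exists_isBranchAt_of_isFresh (T := S) (w := 1) (A := 0)
      hβ ⟨dvd_zero _, fun h => (Nat.zero_le _).trans_lt (hβ.lt 0 h)⟩ hg (charGcd_one β).symm
      (by simp) hy00 hfresh hp hS (by simp) (by simp)
    refine ⟨j, θ, b, W₂, h1, ?_, h2, h3, h4.trans (stageWord_zero hβ hg).symm⟩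
    by_contra hlt
    have h5 := hy0 b (by omega)
    rw [h1, PowerSeries.coeff_X_pow_mul', if_pos le_rfl, Nat.sub_self,
      PowerSeries.coeff_zero_eq_constantCoeff_apply] at h5
    exact h2.right_unit h5
  rcases hfy with hfy | hfy
  · obtain ⟨j, θ, b, W₂, -, hle, h2, h3, h4⟩ := main f hf hs hfy
    exact h2.hasBadChain hβ _ ⟨rfl, rfl⟩ (Or.inl ⟨hle, h3, h4.symm⟩)
  · obtain ⟨j, θ, b, W₂, rfl, hle, h2, h3, h4⟩ := main (swapXY f) (isUnibranch_swapXY hf)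
      (isSingular_swapXY.2 hs) (by rw [evalAt_swapXY hX hy00]; exact hfy)
    have hp := h2.param.swap (by simp [hm.ne']) (by simp [h2.right_pos.ne'])
    rw [swapXY_swapXY] at hp
    have h5 : IsBranchAt g β j θ b (β 0) W₂ 1 f f 1 0 0 :=
      ⟨h2.le, h2.right_pos, hm, h2.right_unit, h2.left_unit, hp, hasXOrder_swapXY.1 (by
        simpa using h2.xOrder), by simp, by simp, h2.shift, h2.pair.swap,
        (Nat.gcd_comm _ _).trans h2.gcd⟩
    exact h5.hasBadChain hβ _ ⟨rfl, rfl⟩ (Or.inr ⟨hle, h3, h4.symm⟩)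

section Resolution

variable {f : Germ} {D : List Direction}

/-- A log resolution blows up all bad points, if these form a chain. -/
theorem IsLogResolution.mem_of_prefix
    (hD : ∀ l, IsBad (totalTransformAt l f) (strictTransformAt l f) ↔ l <+: D)
    {K : Finset InfNearPoint} (hK : IsLogResolution f K) {l : InfNearPoint} (hl : l <+: D) :
    l ∈ K := by
  induction h : l.length using Nat.strong_induction_on generalizing l with
  | _ n ih =>
    by_contra hlK
    have hp : IsPointAbove K l := by
      refine ⟨hlK, fun k hk hne => ih k.length ?_ (hk.trans hl) rfl⟩
      rw [← h]
      exact lt_of_le_of_ne hk.length_le fun h' => hne (hk.eq_of_length h')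
    have h1 := hK.2 l hp
    rcases (hD l).2 hl with h2 | h2
    · exact h1.1 h2
    · exact h2 h1.2

theorem isLogResolution_of_forall_mem_iff
    (hD : ∀ l, IsBad (totalTransformAt l f) (strictTransformAt l f) ↔ l <+: D)
    {K : Finset InfNearPoint} (hK : ∀ l, l ∈ K ↔ l <+: D) : IsLogResolution f K := by
  refine ⟨fun l hl k hk => (hK k).2 (hk.trans ((hK l).1 hl)), fun l hl => ?_⟩
  have h1 := mt (hD l).1 (mt (hK l).2 hl.1)
  rw [IsBad, not_or, not_not] at h1
  exact h1

/-- If the bad points form a chain, then the minimal log resolution is the blowing up of these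
points. -/
theorem isMinimalLogResolution_iff
    (hD : ∀ l, IsBad (totalTransformAt l f) (strictTransformAt l f) ↔ l <+: D)
    (K : Finset InfNearPoint) : IsMinimalLogResolution f K ↔ ∀ l, l ∈ K ↔ l <+: D := by
  classical
  have h0 : ∀ l, l ∈ D.inits.toFinset ↔ l <+: D := fun l => by simp
  constructor
  · rintro ⟨h1, h2⟩
    have hsub : D.inits.toFinset ⊆ K := fun l hl => h1.mem_of_prefix hD ((h0 l).1 hl)
    rw [← Finset.eq_of_subset_of_card_le hsub (h2 _ (isLogResolution_of_forall_mem_iff hD h0))]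
    exact h0
  · intro hK
    exact ⟨isLogResolution_of_forall_mem_iff hD hK, fun K' hK' =>
      Finset.card_le_card fun l hl => hK'.mem_of_prefix hD ((hK l).1 hl)⟩

theorem existsUnique_isMinimalLogResolution
    (hD : ∀ l, IsBad (totalTransformAt l f) (strictTransformAt l f) ↔ l <+: D) :
    ∃! K : Finset InfNearPoint, IsMinimalLogResolution f K := by
  classical
  simp only [isMinimalLogResolution_iff hD]
  refine ⟨D.inits.toFinset, fun l => by simp, fun K hK => ?_⟩
  ext l
  rw [hK l]
  simp

end Resolution

end PlaneBranch

theorem mainTheorem4 (f : Germ) (hf : IsUnibranch f) (hs : IsSingular f)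
    (g : ℕ) (β : ℕ → ℕ) (hβ : IsPuiseuxCharacteristic f g β) :
    -- the trees `T_{p_j,q_j}` are well defined
    (∀ j, 1 ≤ j → j ≤ g →
      β (j - 1) < β j ∧ charGcd β (j + 1) ∣ charGcd β j ∧
      charGcd β (j + 1) ∣ β j - β (j - 1) + charGcd β j ∧
      0 < puiseuxP β j ∧ puiseuxP β j < puiseuxQ β j ∧
      Nat.Coprime (puiseuxP β j) (puiseuxQ β j)) ∧
    -- the minimal log resolution exists and is unique
    (∃! K : Finset InfNearPoint, IsMinimalLogResolution f K) ∧
    -- its Enriques tree is the connected sum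
    ∀ K : Finset InfNearPoint, IsMinimalLogResolution f K →
      ∀ T : EnriquesTree, IsEnriquesTreeOf K T ↔
        T.IsIso (UnibranchTree.iteratedSum
          (fun j => treeTpq (puiseuxP β j) (puiseuxQ β j)) g).toEnriquesTree := by
  obtain ⟨D, hD, hw⟩ := hasBadChain_of_isUnibranch hf hs hβ
  refine ⟨fun j h1 h2 => hβ.isCharSeq.wellDefined h1 h2, existsUnique_isMinimalLogResolution hD,
    fun K hK T => ?_⟩
  rw [isEnriquesTreeOf_iff ((isMinimalLogResolution_iff hD K).1 hK), hw]
  have htree : UnibranchTree.iteratedSum (fun j => treeTpq (puiseuxP β j) (puiseuxQ β j)) g =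
      ⟨stageWord g β 0⟩ := by
    rw [stageWord, Nat.sub_zero, ← iteratedSum_slopes]
  rw [htree]
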